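/- **Conventions.** $\Theta_2$ is Joyal's 2-cell category: the full subcategory of the category of strict 2-categories spanned by the free 2-categories $[n;q_1,\dots,q_n]$ with objects $0,\dots,n$ and $\hom(k,\ell)=[q_{k+1}]\times\dots\times[q_\ell]$ if $k\le\ell$, and $\hom(k,\ell)=\varnothing$ otherwise. A cellular set is a functor $\Theta_2^{\mathrm{op}}\to\mathrm{Set}$; $\Theta_2^{\theta}$ is the representable one, and $N(\mathscr C)$ is the nerve of a 2-category $\mathscr C$, whose $\kappa$-cells are the 2-functors $\kappa\to\mathscr C$. Let $\boxtimes_a$ be the $a$-ary lax Gray tensor product of 2-categories, with generating interchange 2-cells $\gamma_{f,g}:(g\text{ then }f)\Rightarrow(f\text{ then }g)$ for 1-cells $f$ of the $i$-th and $g$ of the $j$-th factor, $i<j$. The Gray tensor product of cellular sets is the extension of $(\theta_1,\dots,\theta_a)\mapsto N(\boxtimes_a(\theta_1,\dots,\theta_a))$ that is cocontinuous in each variable, i.e. $$\otimes_a(X^1,\dots,X^a)=\int^{\zeta_1,\dots,\zeta_a\in\Theta_2}\bigl(X^1_{\zeta_1}\times\dots\times X^a_{\zeta_a}\bigr)* N\bigl(\boxtimes_a(\zeta_1,\dots,\zeta_a)\bigr).$$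 Fix $a,b_1,\dots,b_a\in\mathbb N$, put $b=b_1+\dots+b_a$, and fix $\theta_1,\dots,\theta_b\in\Theta_2$. Let $\rho:\{1,\dots,b\}\to\{1,\dots,a\}$ be defined by $\sum_{u<\rho(i)}b_u<i\le\sum_{u\le\rho(i)}b_u$, and for $1\le u\le a$ let $\boldsymbol\theta_u$ be the list of those $\theta_i$ with $\rho(i)=u$, in order. Put $$A=\otimes_a\bigl(\otimes_{b_1}(\Theta_2^{\theta_1},\dots,\Theta_2^{\theta_{b_1}}),\dots,\otimes_{b_a}(\Theta_2^{\theta_{b-b_a+1}},\dots,\Theta_2^{\theta_b})\bigr)=\otimes_a\bigl(N(\boxtimes_{b_1}\boldsymbol\theta_1),\dots,N(\boxtimes_{b_a}\boldsymbol\theta_a)\bigr),$$ $$B=\otimes_b(\Theta_2^{\theta_1},\dots,\Theta_2^{\theta_b})=N\bigl(\boxtimes_b(\theta_1,\dots,\theta_b)\bigr).$$ There is a unique canonical associativity 2-functor $J:\boxtimes_a(\boxtimes_{b_1}\boldsymbol\theta_1,\dots,\boxtimes_{b_a}\boldsymbol\theta_a)\to\boxtimes_b(\theta_1,\dots,\theta_b)$,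 i.e. a unique 2-functor that concatenates tuples of objects and sends each generating 1-cell and 2-cell to the generating cell with the same name. The comparison map $\mu:A\to B$ sends the $\kappa$-cell represented by 2-functors $\chi:\kappa\to\boxtimes_a(\zeta_1,\dots,\zeta_a)$ and $\psi_u:\zeta_u\to\boxtimes_{b_u}\boldsymbol\theta_u$ $(1\le u\le a)$ to the composite $J\circ\boxtimes_a(\psi_1,\dots,\psi_a)\circ\chi$. **Shuffles.** Every 1-cell $f:\boldsymbol s\to\boldsymbol t$ of $\boxtimes_b(\theta_1,\dots,\theta_b)$ decomposes uniquely into atomic 1-cells, each raising a single coordinate by one; denote by $(i|k)$ the one raising the $i$-th coordinate from $k-1$ to $k$. Each element of $S(\boldsymbol s,\boldsymbol t)=\{(i|k):1\le i\le b,\ s_i<k\le t_i\}$ occurs exactly once, so $f$ determines a total order on $S(\boldsymbol s,\boldsymbol t)$, its underlying shuffle. A $(1;q)$-cell $\phi:[1;q]\to\boxtimes_b(\theta_1,\dots,\theta_b)$ has the endpoints $\boldsymbol s=\phi(0)$, $\boldsymbol t=\phi(1)$ and the underlying shuffles $\preceq_0,\dots,\preceq_q$ on $S=S(\boldsymbol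 s,\boldsymbol t)$, where $\preceq_p$ is the underlying shuffle of the image under $\phi$ of the $p$-th 1-cell $0\to1$ of $[1;q]$. **Pure cells.** A $(1;q)$-cell $\phi$ of $B$ is *pure* if for all $(i|k),(j|\ell)\in S$ with $\rho(i)=\rho(j)$ at least one of the following holds: (i) $(i|k)\preceq_p(j|\ell)$ for all $0\le p\le q$; (ii) $(j|\ell)\preceq_p(i|k)$ for all $0\le p\le q$; (iii) for all $(m|r)\in S$ and all $0\le p\le q$, if $(i|k)\preceq_p(m|r)\preceq_p(j|\ell)$ or $(j|\ell)\preceq_p(m|r)\preceq_p(i|k)$, then $\rho(m)=\rho(i)$. An $(n;\boldsymbol q)$-cell $\phi$ of $B$ is *pure* if for each $1\le k\le n$ the $(1;q_k)$-cell obtained by restricting $\phi$ along the face map $\eta_h^k:[1;q_k]\to[n;\boldsymbol q]$ onto $\{k-1,k\}$ is pure. **Theorem.** The map $\mu:A\to B$ is a monomorphism of cellular sets, and its image consists precisely of the pure cells of $B$. -/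

import Mathlib

open CategoryTheory

namespace GrayTheta

/-! ### Strict 2-categories -/

/-- A (small, strict) 2-category.  `Cell x y` is the set of all 2-cells between 1-cells `x → y`;
a 2-cell `α` goes from the 1-cell `src α` to the 1-cell `tgt α`.  Compositions are written in
diagrammatic order; `vcomp` is vertical and `hcomp` is horizontal composition. -/
structure TwoCat : Type 1 where
  Obj : Type
  Hom : Obj → Obj → Type
  Cell : Obj → Obj → Type
  src : ∀ {x y}, Cell x y → Hom x y
  tgt : ∀ {x y}, Cell x y → Hom x y
  id₁ : ∀ x, Hom x x
  comp₁ : ∀ {x y z}, Hom x y → Hom y z → Hom x z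
  id₂ : ∀ {x y}, Hom x y → Cell x y
  vcomp : ∀ {x y} (α β : Cell x y), tgt α = src β → Cell x y
  hcomp : ∀ {x y z}, Cell x y → Cell y z → Cell x z
  id_comp₁ : ∀ {x y} (f : Hom x y), comp₁ (id₁ x) f = f
  comp₁_id : ∀ {x y} (f : Hom x y), comp₁ f (id₁ y) = f
  comp₁_assoc : ∀ {x y z w} (f : Hom x y) (g : Hom y z) (h : Hom z w),
    comp₁ (comp₁ f g) h = comp₁ f (comp₁ g h)
  src_id₂ : ∀ {x y} (f : Hom x y), src (id₂ f) = f
  tgt_id₂ : ∀ {x y} (f : Hom x y), tgt (id₂ f) = f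
  src_vcomp : ∀ {x y} (α β : Cell x y) (e : tgt α = src β), src (vcomp α β e) = src α
  tgt_vcomp : ∀ {x y} (α β : Cell x y) (e : tgt α = src β), tgt (vcomp α β e) = tgt β
  src_hcomp : ∀ {x y z} (α : Cell x y) (β : Cell y z), src (hcomp α β) = comp₁ (src α) (src β)
  tgt_hcomp : ∀ {x y z} (α : Cell x y) (β : Cell y z), tgt (hcomp α β) = comp₁ (tgt α) (tgt β)
  id_vcomp : ∀ {x y} (α : Cell x y) (e), vcomp (id₂ (src α)) α e = α
  vcomp_id : ∀ {x y} (α : Cell x y) (e), vcomp α (id₂ (tgt α)) e = α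
  vcomp_assoc : ∀ {x y} (α β γ : Cell x y) (e₁ e₂ e₃ e₄),
    vcomp (vcomp α β e₁) γ e₂ = vcomp α (vcomp β γ e₃) e₄
  id_hcomp : ∀ {x y} (α : Cell x y), hcomp (id₂ (id₁ x)) α = α
  hcomp_id : ∀ {x y} (α : Cell x y), hcomp α (id₂ (id₁ y)) = α
  hcomp_assoc : ∀ {x y z w} (α : Cell x y) (β : Cell y z) (γ : Cell z w),
    hcomp (hcomp α β) γ = hcomp α (hcomp β γ)
  hcomp_id₂ : ∀ {x y z} (f : Hom x y) (g : Hom y z), hcomp (id₂ f) (id₂ g) = id₂ (comp₁ f g)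
  interchange : ∀ {x y z} (α α' : Cell x y) (β β' : Cell y z) (e₁ e₂ e₃),
    hcomp (vcomp α α' e₁) (vcomp β β' e₂) = vcomp (hcomp α β) (hcomp α' β') e₃

/-- A (strict) 2-functor. -/
@[ext]
structure TwoFunctor (C D : TwoCat) : Type where
  obj : C.Obj → D.Obj
  map : ∀ {x y}, C.Hom x y → D.Hom (obj x) (obj y)
  cell : ∀ {x y}, C.Cell x y → D.Cell (obj x) (obj y)
  src_cell : ∀ {x y} (α : C.Cell x y), D.src (cell α) = map (C.src α)
  tgt_cell : ∀ {x y} (α : C.Cell x y), D.tgt (cell α) = map (C.tgt α)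
  map_id : ∀ x, map (C.id₁ x) = D.id₁ (obj x)
  map_comp : ∀ {x y z} (f : C.Hom x y) (g : C.Hom y z),
    map (C.comp₁ f g) = D.comp₁ (map f) (map g)
  cell_id : ∀ {x y} (f : C.Hom x y), cell (C.id₂ f) = D.id₂ (map f)
  cell_vcomp : ∀ {x y} (α β : C.Cell x y) (e e'),
    cell (C.vcomp α β e) = D.vcomp (cell α) (cell β) e'
  cell_hcomp : ∀ {x y z} (α : C.Cell x y) (β : C.Cell y z),
    cell (C.hcomp α β) = D.hcomp (cell α) (cell β)

/-- The category of 2-categories and 2-functors. -/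
instance : Category TwoCat where
  Hom := TwoFunctor
  id C :=
    { obj := fun x => x
      map := fun f => f
      cell := fun α => α
      src_cell := fun _ => rfl
      tgt_cell := fun _ => rfl
      map_id := fun _ => rfl
      map_comp := fun _ _ => rfl
      cell_id := fun _ => rfl
      cell_vcomp := fun _ _ _ _ => rfl
      cell_hcomp := fun _ _ => rfl }
  comp F G :=
    { obj := fun x => G.obj (F.obj x)
      map := fun f => G.map (F.map f)
      cell := fun α => G.cell (F.cell α)
      src_cell := fun α => by rw [G.src_cell, F.src_cell]
      tgt_cell := fun α => by rw [G.tgt_cell, F.tgt_cell]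
      map_id := fun x => by rw [F.map_id, G.map_id]
      map_comp := fun f g => by rw [F.map_comp, G.map_comp]
      cell_id := fun f => by rw [F.cell_id, G.cell_id]
      cell_vcomp := fun α β e e' => by
        rw [F.cell_vcomp α β e (by rw [F.tgt_cell, F.src_cell, e]), G.cell_vcomp]
      cell_hcomp := fun α β => by rw [F.cell_hcomp, G.cell_hcomp] }

/-! ### The category `Θ₂` and cellular sets -/

/-- An object `[n; q₁, …, qₙ]` of `Θ₂`; the entry `q m` is `q_{m+1}`. -/
structure Theta : Type where
  n : ℕ
  q : Fin n → ℕ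

namespace Theta

/-- A 1-cell `k → l` of `[n; q]`: it exists only if `k ≤ l`, and is then an element of
`[q_{k+1}] × ⋯ × [q_l]`.  The index `m` stands for the elementary step `m → m + 1`. -/
@[ext]
structure Hom (κ : Theta) (k l : Fin (κ.n + 1)) : Type where
  le : k ≤ l
  val : ∀ m : Fin κ.n, k ≤ m.castSucc → m.castSucc < l → Fin (κ.q m + 1)

/-- The product order on the hom-category. -/
def Hom.Le {κ : Theta} {k l : Fin (κ.n + 1)} (f g : κ.Hom k l) : Prop :=
  ∀ m h₁ h₂, f.val m h₁ h₂ ≤ g.val m h₁ h₂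

/-- Identity 1-cells. -/
def Hom.id {κ : Theta} (k : Fin (κ.n + 1)) : κ.Hom k k :=
  ⟨le_rfl, fun _ h₁ h₂ => absurd h₂ (not_lt.mpr h₁)⟩

/-- Composition of 1-cells is concatenation of tuples. -/
def Hom.comp {κ : Theta} {j k l : Fin (κ.n + 1)} (f : κ.Hom j k) (g : κ.Hom k l) : κ.Hom j l :=
  ⟨f.le.trans g.le, fun m h₁ h₂ =>
    if h : m.castSucc < k then f.val m h₁ h else g.val m (not_lt.mp h) h₂⟩

theorem Hom.id_comp {κ : Theta} {k l : Fin (κ.n + 1)} (f : κ.Hom k l) :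
    (Hom.id k).comp f = f := by
  ext m h₁ h₂
  simp [Hom.comp, not_lt.mpr h₁]

theorem Hom.comp_id {κ : Theta} {k l : Fin (κ.n + 1)} (f : κ.Hom k l) :
    f.comp (Hom.id l) = f := by
  ext m h₁ h₂
  simp [Hom.comp, h₂]

theorem Hom.comp_assoc {κ : Theta} {j k l p : Fin (κ.n + 1)} (f : κ.Hom j k) (g : κ.Hom k l)
    (h : κ.Hom l p) : (f.comp g).comp h = f.comp (g.comp h) := by
  ext m h₁ h₂
  have hg := g.le
  simp only [Hom.comp]
  by_cases a : m.castSucc < k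
  · have b : m.castSucc < l := lt_of_lt_of_le a hg
    simp [a, b]
  · by_cases b : m.castSucc < l <;> simp [a, b]

/-- The free 2-category `[n; q]`. -/
def toTwoCat (κ : Theta) : TwoCat where
  Obj := Fin (κ.n + 1)
  Hom := κ.Hom
  Cell k l := {p : κ.Hom k l × κ.Hom k l // p.1.Le p.2}
  src α := α.1.1
  tgt α := α.1.2
  id₁ := Hom.id
  comp₁ := Hom.comp
  id₂ f := ⟨(f, f), fun _ _ _ => le_rfl⟩
  vcomp α β e := ⟨(α.1.1, β.1.2), fun m h₁ h₂ =>
    (α.2 m h₁ h₂).trans (le_of_eq_of_le (by rw [e]) (β.2 m h₁ h₂))⟩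
  hcomp α β := ⟨(α.1.1.comp β.1.1, α.1.2.comp β.1.2), fun m h₁ h₂ => by
    simp only [Hom.comp]
    split_ifs
    · exact α.2 _ _ _
    · exact β.2 _ _ _⟩
  id_comp₁ := Hom.id_comp
  comp₁_id := Hom.comp_id
  comp₁_assoc := Hom.comp_assoc
  src_id₂ _ := rfl
  tgt_id₂ _ := rfl
  src_vcomp _ _ _ := rfl
  tgt_vcomp _ _ _ := rfl
  src_hcomp _ _ := rfl
  tgt_hcomp _ _ := rfl
  id_vcomp _ _ := rfl
  vcomp_id _ _ := rfl
  vcomp_assoc _ _ _ _ _ _ _ := rfl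
  id_hcomp _ := Subtype.ext (Prod.ext (Hom.id_comp _) (Hom.id_comp _))
  hcomp_id _ := Subtype.ext (Prod.ext (Hom.comp_id _) (Hom.comp_id _))
  hcomp_assoc _ _ _ := Subtype.ext (Prod.ext (Hom.comp_assoc _ _ _) (Hom.comp_assoc _ _ _))
  hcomp_id₂ _ _ := rfl
  interchange _ _ _ _ _ _ _ := rfl

/-- `Θ₂` is the full subcategory of the category of 2-categories spanned by the `[n; q]`. -/
instance : Category Theta where
  Hom κ l := κ.toTwoCat ⟶ l.toTwoCat
  id κ := 𝟙 κ.toTwoCat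
  comp F G := CategoryStruct.comp (obj := TwoCat) F G

/-- The inclusion of `Θ₂` into the category of 2-categories. -/
def incl : Theta ⥤ TwoCat where
  obj := toTwoCat
  map F := F

/-- The object `[1; q]`. -/
def globe (q : ℕ) : Theta := ⟨1, fun _ => q⟩

/-- The 1-cell `p : 0 → 1` of `[1; q]`. -/
def globeArrow {q : ℕ} (p : Fin (q + 1)) : (globe q).toTwoCat.Hom (0 : Fin 2) (1 : Fin 2) :=
  (⟨Fin.zero_le _, fun _ _ _ => p⟩ : (globe q).Hom (0 : Fin 2) (1 : Fin 2))

theorem eq_of_interval {κ : Theta} {k m : Fin κ.n} {x y : Fin 2}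
    (h₁ : k.val + x.val ≤ m.val) (h₂ : m.val < k.val + y.val) : k = m ∧ x.val = 0 ∧ y.val = 1 := by
  have := x.isLt
  have := y.isLt
  exact ⟨Fin.ext (by omega), by omega, by omega⟩

/-- The action of `etaH` on objects. -/
def etaHObj (κ : Theta) (k : Fin κ.n) (x : Fin 2) : Fin (κ.n + 1) :=
  ⟨k.val + x.val, by omega⟩

/-- The action of `etaH` on 1-cells. -/
def etaHMap (κ : Theta) (k : Fin κ.n) {x y : Fin 2} (f : (globe (κ.q k)).Hom x y) :
    κ.Hom (κ.etaHObj k x) (κ.etaHObj k y) :=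
  ⟨Nat.add_le_add_left f.le k.val, fun m h₁ h₂ =>
    have h := eq_of_interval (κ := κ) (k := k) (m := m) (x := x) (y := y) h₁ h₂
    Fin.cast (by rw [h.1]; rfl)
      (f.val (0 : Fin 1) (Fin.le_def.mpr (by simp [h.2.1])) (Fin.lt_def.mpr (by simp [h.2.2])))⟩

theorem etaHMap_comp (κ : Theta) (k : Fin κ.n) {x y z : Fin 2} (f : (globe (κ.q k)).Hom x y)
    (g : (globe (κ.q k)).Hom y z) :
    κ.etaHMap k (f.comp g) = (κ.etaHMap k f).comp (κ.etaHMap k g) := by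
  refine Hom.ext ?_
  funext m h₁ h₂
  have h := eq_of_interval (κ := κ) (k := k) (m := m) (x := x) (y := z) h₁ h₂
  obtain ⟨rfl, hx, hz⟩ := h
  have hy := y.isLt
  simp only [etaHMap, Hom.comp]
  by_cases c : y.val = 0
  · have c₁ : ¬ (Fin.castSucc (0 : Fin 1) < y) := by simp [Fin.lt_def, c]
    have c₂ : ¬ (k.castSucc < κ.etaHObj k y) := by simp [Fin.lt_def, etaHObj, c]
    rw [dif_neg c₂]
    congr 1
    exact dif_neg c₁
  · have c₁ : Fin.castSucc (0 : Fin 1) < y := by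
      simp only [Fin.lt_def]; simp; omega
    have c₂ : k.castSucc < κ.etaHObj k y := by
      simp only [Fin.lt_def, etaHObj, Fin.val_castSucc]; omega
    rw [dif_pos c₂]
    congr 1
    exact dif_pos c₁

/-- The face map `η_h^k = [{k-1, k}; id] : [1; q_k] → [n; q]`; the index `k : Fin n` stands for
the `(k + 1)`-st elementary step `k → k + 1` of `[n; q]`. -/
def etaH (κ : Theta) (k : Fin κ.n) : globe (κ.q k) ⟶ κ :=
  ({ obj := κ.etaHObj k
     map := κ.etaHMap k
     cell := fun α => ⟨(κ.etaHMap k α.1.1, κ.etaHMap k α.1.2), fun m h₁ h₂ => α.2 _ _ _⟩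
     src_cell := fun _ => rfl
     tgt_cell := fun _ => rfl
     map_id := fun x => by
      refine Hom.ext ?_
      funext m h₁ h₂
      exact absurd h₂ (not_lt.mpr h₁)
     map_comp := κ.etaHMap_comp k
     cell_id := fun _ => rfl
     cell_vcomp := fun _ _ _ _ => rfl
     cell_hcomp := fun _ _ =>
      Subtype.ext (Prod.ext (κ.etaHMap_comp k _ _) (κ.etaHMap_comp k _ _)) } :
    TwoFunctor (globe (κ.q k)).toTwoCat κ.toTwoCat)

end Theta

/-- The nerve functor on objects: `N(C)` has as `κ`-cells the 2-functors `κ → C`. -/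
def nerve (C : TwoCat) : Thetaᵒᵖ ⥤ Type :=
  Theta.incl.op ⋙ yoneda.obj C

/-! ### The `ι`-ary Gray tensor product -/

section Gray

variable {ι : Type} (A : ι → TwoCat)

/-- `x` and `y` agree except that the `i`-th coordinate changes from `a` to `b`. -/
def Move (i : ι) (a b : (A i).Obj) (x y : ∀ i, (A i).Obj) : Prop :=
  x i = a ∧ y i = b ∧ ∀ j, j ≠ i → x j = y j

/-- Formal composites of the generating 1-cells `(…, f, …)`, with `f` a 1-cell of `A i`. -/
inductive Word : (∀ i, (A i).Obj) → (∀ i, (A i).Obj) → Type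
  | id (x) : Word x x
  | gen {x y} (i : ι) {a b : (A i).Obj} (f : (A i).Hom a b) (h : Move A i a b x y) : Word x y
  | comp {x y z} (u : Word x y) (v : Word y z) : Word x z

/-- The congruence on formal composites generated by the category axioms and by functoriality of
the generating 1-cells in each coordinate. -/
inductive Word.Rel : ∀ {x y}, Word A x y → Word A x y → Prop
  | refl {x y} (u : Word A x y) : Rel u u
  | symm {x y} {u v : Word A x y} : Rel u v → Rel v u
  | trans {x y} {u v w : Word A x y} : Rel u v → Rel v w → Rel u w
  | comp_congr {x y z} {u u' : Word A x y} {v v' : Word A y z} :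
      Rel u u' → Rel v v' → Rel (.comp u v) (.comp u' v')
  | id_comp {x y} (u : Word A x y) : Rel (.comp (.id x) u) u
  | comp_id {x y} (u : Word A x y) : Rel (.comp u (.id y)) u
  | assoc {x y z w} (u : Word A x y) (v : Word A y z) (s : Word A z w) :
      Rel (.comp (.comp u v) s) (.comp u (.comp v s))
  | gen_id {x} (i : ι) (a : (A i).Obj) (h : Move A i a a x x) :
      Rel (.gen i ((A i).id₁ a) h) (.id x)
  | gen_comp {x y z} (i : ι) {a b c : (A i).Obj} (f : (A i).Hom a b) (g : (A i).Hom b c)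
      (h : Move A i a b x y) (h' : Move A i b c y z) (h'' : Move A i a c x z) :
      Rel (.gen i ((A i).comp₁ f g) h'') (.comp (.gen i f h) (.gen i g h'))

instance Word.setoid (x y : ∀ i, (A i).Obj) : Setoid (Word A x y) :=
  ⟨Word.Rel A, .refl, .symm, .trans⟩

/-- 1-cells of the Gray tensor product. -/
def GHom (x y : ∀ i, (A i).Obj) : Type := Quotient (Word.setoid A x y)

variable {A}

namespace GHom

/-- Identity 1-cells. -/
def id (x : ∀ i, (A i).Obj) : GHom A x x := Quotient.mk _ (.id x)

/-- The generating 1-cell given by the 1-cell `f` of `A i`. -/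
def gen {x y : ∀ i, (A i).Obj} (i : ι) {a b : (A i).Obj} (f : (A i).Hom a b)
    (h : Move A i a b x y) : GHom A x y := Quotient.mk _ (.gen i f h)

/-- Composition of 1-cells. -/
def comp {x y z : ∀ i, (A i).Obj} (f : GHom A x y) (g : GHom A y z) : GHom A x z :=
  Quotient.map₂ Word.comp (fun _ _ h _ _ h' => .comp_congr h h') f g

theorem id_comp {x y : ∀ i, (A i).Obj} (f : GHom A x y) : (id x).comp f = f := by
  induction f using Quotient.ind
  exact Quotient.sound (.id_comp _)

theorem comp_id {x y : ∀ i, (A i).Obj} (f : GHom A x y) : f.comp (id y) = f := by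
  induction f using Quotient.ind
  exact Quotient.sound (.comp_id _)

theorem assoc {x y z w : ∀ i, (A i).Obj} (f : GHom A x y) (g : GHom A y z) (h : GHom A z w) :
    (f.comp g).comp h = f.comp (g.comp h) := by
  induction f using Quotient.ind
  induction g using Quotient.ind
  induction h using Quotient.ind
  exact Quotient.sound (.assoc _ _ _)

theorem gen_id {x : ∀ i, (A i).Obj} (i : ι) (a : (A i).Obj) (h : Move A i a a x x) :
    gen i ((A i).id₁ a) h = id x := Quotient.sound (.gen_id i a h)

theorem gen_comp {x y z : ∀ i, (A i).Obj} (i : ι) {a b c : (A i).Obj} (f : (A i).Hom a b)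
    (g : (A i).Hom b c) (h : Move A i a b x y) (h' : Move A i b c y z) (h'' : Move A i a c x z) :
    gen i ((A i).comp₁ f g) h'' = (gen i f h).comp (gen i g h') :=
  Quotient.sound (.gen_comp i f g h h' h'')

end GHom

variable {B : ι → TwoCat}

theorem Move.map (F : ∀ i, TwoFunctor (A i) (B i)) {i : ι} {a b : (A i).Obj}
    {x y : ∀ i, (A i).Obj} (h : Move A i a b x y) :
    Move B i ((F i).obj a) ((F i).obj b) (fun i => (F i).obj (x i)) (fun i => (F i).obj (y i)) :=
  ⟨congrArg _ h.1, congrArg _ h.2.1, fun j hj => congrArg _ (h.2.2 j hj)⟩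

/-- Apply a family of 2-functors to a formal composite of 1-cells. -/
def Word.map (F : ∀ i, TwoFunctor (A i) (B i)) : ∀ {x y : ∀ i, (A i).Obj}, Word A x y →
    Word B (fun i => (F i).obj (x i)) (fun i => (F i).obj (y i))
  | _, _, .id _ => .id _
  | _, _, .gen i f h => .gen i ((F i).map f) (h.map F)
  | _, _, .comp u v => .comp (u.map F) (v.map F)

theorem Word.Rel.map (F : ∀ i, TwoFunctor (A i) (B i)) {x y : ∀ i, (A i).Obj} {u v : Word A x y}
    (h : Word.Rel A u v) : Word.Rel B (u.map F) (v.map F) := by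
  induction h with
  | refl => exact .refl _
  | symm _ ih => exact ih.symm
  | trans _ _ ih ih' => exact ih.trans ih'
  | comp_congr _ _ ih ih' => exact .comp_congr ih ih'
  | id_comp => exact .id_comp _
  | comp_id => exact .comp_id _
  | assoc => exact .assoc _ _ _
  | gen_id i a h =>
    simp only [Word.map, (F i).map_id]
    exact .gen_id _ _ _
  | gen_comp i f g h h' h'' =>
    simp only [Word.map, (F i).map_comp]
    exact .gen_comp _ _ _ _ _ _

/-- Apply a family of 2-functors to a 1-cell. -/
def GHom.map (F : ∀ i, TwoFunctor (A i) (B i)) {x y : ∀ i, (A i).Obj} (f : GHom A x y) :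
    GHom B (fun i => (F i).obj (x i)) (fun i => (F i).obj (y i)) :=
  Quotient.map (Word.map F) (fun _ _ h => Word.Rel.map F h) f

theorem GHom.map_comp (F : ∀ i, TwoFunctor (A i) (B i)) {x y z : ∀ i, (A i).Obj}
    (f : GHom A x y) (g : GHom A y z) : (f.comp g).map F = (f.map F).comp (g.map F) := by
  induction f using Quotient.ind
  induction g using Quotient.ind
  rfl

theorem Word.map_map {C : ι → TwoCat} (F : ∀ i, A i ⟶ B i) (G : ∀ i, B i ⟶ C i)
    {x y : ∀ i, (A i).Obj} (u : Word A x y) : (u.map F).map G = u.map (fun i => F i ≫ G i) := by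
  induction u with
  | id => rfl
  | gen => rfl
  | comp u v ih ih' => exact congrArg₂ Word.comp ih ih'

theorem GHom.map_map {C : ι → TwoCat} (F : ∀ i, A i ⟶ B i) (G : ∀ i, B i ⟶ C i)
    {x y : ∀ i, (A i).Obj} (f : GHom A x y) : (f.map F).map G = f.map (fun i => F i ≫ G i) := by
  induction f using Quotient.ind
  exact congrArg (Quotient.mk _) (Word.map_map F G _)

variable [LinearOrder ι] (A)

open GHom in
/-- Formal composites of the generating 2-cells: `cell i α` for a 2-cell `α` of `A i`, and the
interchange 2-cell `γ_{f,g} : (g then f) ⇒ (f then g)` for `i < j`, a 1-cell `f` of `A i` and a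
1-cell `g` of `A j`, over a square of objects with `f : x → y`, `f : z → w`, `g : x → z` and
`g : y → w`. -/
inductive Term : ∀ {x y : ∀ i, (A i).Obj}, GHom A x y → GHom A x y → Type
  | id {x y} (f : GHom A x y) : Term f f
  | vcomp {x y} {f g g' h : GHom A x y} (s : Term f g) (t : Term g' h) (e : g = g') : Term f h
  | hcomp {x y z} {f g : GHom A x y} {f' g' : GHom A y z} (s : Term f g) (t : Term f' g') :
      Term (f.comp f') (g.comp g')
  | cell {x y} (i : ι) {a b : (A i).Obj} (α : (A i).Cell a b) (h : Move A i a b x y) :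
      Term (gen i ((A i).src α) h) (gen i ((A i).tgt α) h)
  | γ {x y z w} {i j : ι} (hij : i < j) {a b : (A i).Obj} {c d : (A j).Obj}
      (f : (A i).Hom a b) (g : (A j).Hom c d)
      (fxy : Move A i a b x y) (fzw : Move A i a b z w)
      (gxz : Move A j c d x z) (gyw : Move A j c d y w) :
      Term ((gen j g gxz).comp (gen i f fzw)) ((gen i f fxy).comp (gen j g gyw))

open GHom in
/-- The congruence on formal composites of 2-cells generated by the 2-category axioms,
2-functoriality of `cell`, and the coherence relations for `γ`: naturality in 2-cells,
compatibility with identities and with composition (in both variables), and, for three distinct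
coordinates, the cube relation (naturality of `γ` with respect to the 2-cells `γ`). -/
inductive Term.Rel : ∀ {x y : ∀ i, (A i).Obj} {f g f' g' : GHom A x y},
    Term A f g → Term A f' g' → Prop
  | refl {x y} {f g : GHom A x y} (s : Term A f g) : Rel s s
  | symm {x y} {f g f' g' : GHom A x y} {s : Term A f g} {t : Term A f' g'} : Rel s t → Rel t s
  | trans {x y} {f g f' g' f'' g'' : GHom A x y} {s : Term A f g} {t : Term A f' g'}
      {r : Term A f'' g''} : Rel s t → Rel t r → Rel s r
  | vcomp_congr {x y} {f g g₁ h f' g' g₁' h' : GHom A x y} {s : Term A f g} {t : Term A g₁ h}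
      {s' : Term A f' g'} {t' : Term A g₁' h'} (e e') :
      Rel s s' → Rel t t' → Rel (.vcomp s t e) (.vcomp s' t' e')
  | hcomp_congr {x y z} {f g f' g' : GHom A x y} {h k h' k' : GHom A y z} {s : Term A f g}
      {t : Term A h k} {s' : Term A f' g'} {t' : Term A h' k'} :
      Rel s s' → Rel t t' → Rel (.hcomp s t) (.hcomp s' t')
  | id_vcomp {x y} {f g : GHom A x y} (s : Term A f g) : Rel (.vcomp (.id f) s rfl) s
  | vcomp_id {x y} {f g : GHom A x y} (s : Term A f g) : Rel (.vcomp s (.id g) rfl) s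
  | vcomp_assoc {x y} {f g g' h h' k : GHom A x y} (s : Term A f g) (t : Term A g' h)
      (r : Term A h' k) (e e') :
      Rel (.vcomp (.vcomp s t e) r e') (.vcomp s (.vcomp t r e') e)
  | id_hcomp {x y} {f g : GHom A x y} (s : Term A f g) : Rel (.hcomp (.id (GHom.id x)) s) s
  | hcomp_id {x y} {f g : GHom A x y} (s : Term A f g) : Rel (.hcomp s (.id (GHom.id y))) s
  | hcomp_assoc {x y z w} {f g : GHom A x y} {f' g' : GHom A y z} {f'' g'' : GHom A z w}
      (s : Term A f g) (t : Term A f' g') (r : Term A f'' g'') :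
      Rel (.hcomp (.hcomp s t) r) (.hcomp s (.hcomp t r))
  | hcomp_ids {x y z} (f : GHom A x y) (g : GHom A y z) :
      Rel (.hcomp (.id f) (.id g)) (.id (f.comp g))
  | interchange {x y z} {f g g₁ h : GHom A x y} {f' g' g₁' h' : GHom A y z} (s : Term A f g)
      (t : Term A g₁ h) (s' : Term A f' g') (t' : Term A g₁' h') (e e' e'') :
      Rel (.hcomp (.vcomp s t e) (.vcomp s' t' e')) (.vcomp (.hcomp s s') (.hcomp t t') e'')
  | cell_id {x y} (i : ι) {a b : (A i).Obj} (f : (A i).Hom a b) (h : Move A i a b x y) :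
      Rel (.cell i ((A i).id₂ f) h) (.id (gen i f h))
  | cell_vcomp {x y} (i : ι) {a b : (A i).Obj} (α β : (A i).Cell a b) (e)
      (h : Move A i a b x y) (e') :
      Rel (.cell i ((A i).vcomp α β e) h) (.vcomp (.cell i α h) (.cell i β h) e')
  | cell_hcomp {x y z} (i : ι) {a b c : (A i).Obj} (α : (A i).Cell a b) (β : (A i).Cell b c)
      (h : Move A i a b x y) (h' : Move A i b c y z) (h'' : Move A i a c x z) :
      Rel (.cell i ((A i).hcomp α β) h'') (.hcomp (.cell i α h) (.cell i β h'))
  | γ_natural_left {x y z w} {i j : ι} (hij : i < j) {a b : (A i).Obj} {c d : (A j).Obj}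
      (α : (A i).Cell a b) (g : (A j).Hom c d)
      (fxy : Move A i a b x y) (fzw : Move A i a b z w)
      (gxz : Move A j c d x z) (gyw : Move A j c d y w) :
      Rel (.vcomp (.γ hij ((A i).src α) g fxy fzw gxz gyw)
            (.hcomp (.cell i α fxy) (.id (gen j g gyw))) rfl)
          (.vcomp (.hcomp (.id (gen j g gxz)) (.cell i α fzw))
            (.γ hij ((A i).tgt α) g fxy fzw gxz gyw) rfl)
  | γ_natural_right {x y z w} {i j : ι} (hij : i < j) {a b : (A i).Obj} {c d : (A j).Obj}
      (f : (A i).Hom a b) (β : (A j).Cell c d)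
      (fxy : Move A i a b x y) (fzw : Move A i a b z w)
      (gxz : Move A j c d x z) (gyw : Move A j c d y w) :
      Rel (.vcomp (.γ hij f ((A j).src β) fxy fzw gxz gyw)
            (.hcomp (.id (gen i f fxy)) (.cell j β gyw)) rfl)
          (.vcomp (.hcomp (.cell j β gxz) (.id (gen i f fzw)))
            (.γ hij f ((A j).tgt β) fxy fzw gxz gyw) rfl)
  | γ_id_left {x z} {i j : ι} (hij : i < j) (a : (A i).Obj) {c d : (A j).Obj}
      (g : (A j).Hom c d) (fx : Move A i a a x x) (fz : Move A i a a z z)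
      (gxz : Move A j c d x z) :
      Rel (.γ hij ((A i).id₁ a) g fx fz gxz gxz) (.id (gen j g gxz))
  | γ_id_right {x y} {i j : ι} (hij : i < j) {a b : (A i).Obj} (c : (A j).Obj)
      (f : (A i).Hom a b) (fxy : Move A i a b x y) (gx : Move A j c c x x)
      (gy : Move A j c c y y) :
      Rel (.γ hij f ((A j).id₁ c) fxy fxy gx gy) (.id (gen i f fxy))
  | γ_comp_left {x y y' z w w'} {i j : ι} (hij : i < j) {a b b' : (A i).Obj} {c d : (A j).Obj}
      (f : (A i).Hom a b) (f' : (A i).Hom b b') (g : (A j).Hom c d)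
      (fxy : Move A i a b x y) (fyy' : Move A i b b' y y') (fxy' : Move A i a b' x y')
      (fzw : Move A i a b z w) (fww' : Move A i b b' w w') (fzw' : Move A i a b' z w')
      (gxz : Move A j c d x z) (gyw : Move A j c d y w) (gyw' : Move A j c d y' w') :
      Rel (.γ hij ((A i).comp₁ f f') g fxy' fzw' gxz gyw')
          (.vcomp (.hcomp (.γ hij f g fxy fzw gxz gyw) (.id (gen i f' fww')))
            (.hcomp (.id (gen i f fxy)) (.γ hij f' g fyy' fww' gyw gyw')) (assoc _ _ _))
  | γ_comp_right {x y z z' w w'} {i j : ι} (hij : i < j) {a b : (A i).Obj} {c d d' : (A j).Obj}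
      (f : (A i).Hom a b) (g : (A j).Hom c d) (g' : (A j).Hom d d')
      (fxy : Move A i a b x y) (fzw : Move A i a b z w) (fzw' : Move A i a b z' w')
      (gxz : Move A j c d x z) (gzz' : Move A j d d' z z') (gxz' : Move A j c d' x z')
      (gyw : Move A j c d y w) (gww' : Move A j d d' w w') (gyw' : Move A j c d' y w') :
      Rel (.γ hij f ((A j).comp₁ g g') fxy fzw' gxz' gyw')
          (.vcomp (.hcomp (.id (gen j g gxz)) (.γ hij f g' fzw fzw' gzz' gww'))
            (.hcomp (.γ hij f g fxy fzw gxz gyw) (.id (gen j g' gww'))) (assoc _ _ _).symm)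
  | cube {x₀₀₀ x₁₀₀ x₀₁₀ x₁₁₀ x₀₀₁ x₁₀₁ x₀₁₁ x₁₁₁} {i j k : ι} (hij : i < j) (hjk : j < k)
      (hik : i < k) {a a' : (A i).Obj} {b b' : (A j).Obj} {c c' : (A k).Obj}
      (f : (A i).Hom a a') (g : (A j).Hom b b') (h : (A k).Hom c c')
      (f₀₀ : Move A i a a' x₀₀₀ x₁₀₀) (f₁₀ : Move A i a a' x₀₁₀ x₁₁₀)
      (f₀₁ : Move A i a a' x₀₀₁ x₁₀₁) (f₁₁ : Move A i a a' x₀₁₁ x₁₁₁)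
      (g₀₀ : Move A j b b' x₀₀₀ x₀₁₀) (g₁₀ : Move A j b b' x₁₀₀ x₁₁₀)
      (g₀₁ : Move A j b b' x₀₀₁ x₀₁₁) (g₁₁ : Move A j b b' x₁₀₁ x₁₁₁)
      (h₀₀ : Move A k c c' x₀₀₀ x₀₀₁) (h₁₀ : Move A k c c' x₁₀₀ x₁₀₁)
      (h₀₁ : Move A k c c' x₀₁₀ x₀₁₁) (h₁₁ : Move A k c c' x₁₁₀ x₁₁₁) :
      Rel (.vcomp
            (.vcomp (.hcomp (.γ hjk g h g₀₀ g₀₁ h₀₀ h₀₁) (.id (gen i f f₁₁)))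
              (.hcomp (.id (gen j g g₀₀)) (.γ hik f h f₁₀ f₁₁ h₀₁ h₁₁)) (assoc _ _ _))
            (.hcomp (.γ hij f g f₀₀ f₁₀ g₀₀ g₁₀) (.id (gen k h h₁₁))) (assoc _ _ _).symm)
          (.vcomp
            (.vcomp (.hcomp (.id (gen k h h₀₀)) (.γ hij f g f₀₁ f₁₁ g₀₁ g₁₁))
              (.hcomp (.γ hik f h f₀₀ f₀₁ h₀₀ h₁₀) (.id (gen j g g₁₁))) (assoc _ _ _).symm)
            (.hcomp (.id (gen i f f₀₀)) (.γ hjk g h g₁₀ g₁₁ h₁₀ h₁₁)) (assoc _ _ _))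

variable {A}

/-- Related formal composites have the same boundary. -/
theorem Term.Rel.boundary {x y : ∀ i, (A i).Obj} {f g f' g' : GHom A x y} {s : Term A f g}
    {t : Term A f' g'} (h : Term.Rel A s t) : f = f' ∧ g = g' := by
  induction h with
  | refl => exact ⟨rfl, rfl⟩
  | symm _ ih => exact ⟨ih.1.symm, ih.2.symm⟩
  | trans _ _ ih ih' => exact ⟨ih.1.trans ih'.1, ih.2.trans ih'.2⟩
  | vcomp_congr _ _ _ _ ih ih' => exact ⟨ih.1, ih'.2⟩
  | hcomp_congr _ _ ih ih' => exact ⟨by rw [ih.1, ih'.1], by rw [ih.2, ih'.2]⟩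
  | id_vcomp => exact ⟨rfl, rfl⟩
  | vcomp_id => exact ⟨rfl, rfl⟩
  | vcomp_assoc => exact ⟨rfl, rfl⟩
  | id_hcomp => exact ⟨GHom.id_comp _, GHom.id_comp _⟩
  | hcomp_id => exact ⟨GHom.comp_id _, GHom.comp_id _⟩
  | hcomp_assoc => exact ⟨GHom.assoc _ _ _, GHom.assoc _ _ _⟩
  | hcomp_ids => exact ⟨rfl, rfl⟩
  | interchange => exact ⟨rfl, rfl⟩
  | cell_id i f h => exact ⟨by rw [(A i).src_id₂], by rw [(A i).tgt_id₂]⟩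
  | cell_vcomp i α β e h e' => exact ⟨by rw [(A i).src_vcomp], by rw [(A i).tgt_vcomp]⟩
  | cell_hcomp i α β h h' h'' =>
    exact ⟨by rw [(A i).src_hcomp, GHom.gen_comp i _ _ h h' h''],
      by rw [(A i).tgt_hcomp, GHom.gen_comp i _ _ h h' h'']⟩
  | γ_natural_left => exact ⟨rfl, rfl⟩
  | γ_natural_right => exact ⟨rfl, rfl⟩
  | γ_id_left => exact ⟨by rw [GHom.gen_id, GHom.comp_id], by rw [GHom.gen_id, GHom.id_comp]⟩
  | γ_id_right => exact ⟨by rw [GHom.gen_id, GHom.id_comp], by rw [GHom.gen_id, GHom.comp_id]⟩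
  | γ_comp_left hij f f' g fxy fyy' fxy' fzw fww' fzw' =>
    exact ⟨by rw [GHom.gen_comp _ _ _ fzw fww' fzw', GHom.assoc],
      by rw [GHom.gen_comp _ _ _ fxy fyy' fxy', GHom.assoc]⟩
  | γ_comp_right hij f g g' fxy fzw fzw' gxz gzz' gxz' gyw gww' gyw' =>
    exact ⟨by rw [GHom.gen_comp _ _ _ gxz gzz' gxz', GHom.assoc],
      by rw [GHom.gen_comp _ _ _ gyw gww' gyw', GHom.assoc]⟩
  | cube => exact ⟨GHom.assoc _ _ _, GHom.assoc _ _ _⟩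

variable (A)

/-- Formal composites of 2-cells between 1-cells `x → y`. -/
structure PreCell (x y : ∀ i, (A i).Obj) : Type where
  src : GHom A x y
  tgt : GHom A x y
  term : Term A src tgt

instance PreCell.setoid (x y : ∀ i, (A i).Obj) : Setoid (PreCell A x y) :=
  ⟨fun s t => Term.Rel A s.term t.term, fun _ => .refl _, .symm, .trans⟩

/-- 2-cells of the Gray tensor product. -/
def GCell (x y : ∀ i, (A i).Obj) : Type := Quotient (PreCell.setoid A x y)

variable {A}

namespace GCell

/-- The 2-cell represented by a formal composite. -/
def mk {x y : ∀ i, (A i).Obj} {f g : GHom A x y} (s : Term A f g) : GCell A x y :=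
  Quotient.mk _ ⟨f, g, s⟩

theorem sound {x y : ∀ i, (A i).Obj} {f g f' g' : GHom A x y} {s : Term A f g}
    {t : Term A f' g'} (h : Term.Rel A s t) : mk s = mk t := Quotient.sound h

theorem ind {x y : ∀ i, (A i).Obj} {P : GCell A x y → Prop}
    (h : ∀ (f g : GHom A x y) (s : Term A f g), P (mk s)) (α : GCell A x y) : P α := by
  induction α using Quotient.ind with
  | _ s => exact h _ _ s.term

/-- The source 1-cell. -/
def src {x y : ∀ i, (A i).Obj} (α : GCell A x y) : GHom A x y :=
  Quotient.lift PreCell.src (fun _ _ h => (Term.Rel.boundary h).1) α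

/-- The target 1-cell. -/
def tgt {x y : ∀ i, (A i).Obj} (α : GCell A x y) : GHom A x y :=
  Quotient.lift PreCell.tgt (fun _ _ h => (Term.Rel.boundary h).2) α

/-- Horizontal composition. -/
def hcomp {x y z : ∀ i, (A i).Obj} (α : GCell A x y) (β : GCell A y z) : GCell A x z :=
  Quotient.map₂ (fun s t => ⟨_, _, .hcomp s.term t.term⟩) (fun _ _ h _ _ h' => .hcomp_congr h h')
    α β

theorem src_out {x y : ∀ i, (A i).Obj} (α : GCell A x y) : (Quotient.out α).src = src α := by
  conv_rhs => rw [← Quotient.out_eq α]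
  rfl

theorem tgt_out {x y : ∀ i, (A i).Obj} (α : GCell A x y) : (Quotient.out α).tgt = tgt α := by
  conv_rhs => rw [← Quotient.out_eq α]
  rfl

/-- Vertical composition. -/
noncomputable def vcomp {x y : ∀ i, (A i).Obj} (α β : GCell A x y) (e : tgt α = src β) :
    GCell A x y :=
  mk (.vcomp (Quotient.out α).term (Quotient.out β).term (by rw [tgt_out, src_out, e]))

theorem vcomp_mk {x y : ∀ i, (A i).Obj} {f g g' h : GHom A x y} (s : Term A f g)
    (t : Term A g' h) (e : tgt (mk s) = src (mk t)) :
    vcomp (mk s) (mk t) e = mk (.vcomp s t e) :=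
  sound (.vcomp_congr _ _ (Quotient.exact (Quotient.out_eq (mk s)))
    (Quotient.exact (Quotient.out_eq (mk t))))

end GCell

variable (A)

/-- The (lax) Gray tensor product of a family of 2-categories indexed by a linearly ordered set,
given by generators and relations. -/
noncomputable def gray : TwoCat where
  Obj := ∀ i, (A i).Obj
  Hom := GHom A
  Cell := GCell A
  src := GCell.src
  tgt := GCell.tgt
  id₁ := GHom.id
  comp₁ := GHom.comp
  id₂ f := GCell.mk (.id f)
  vcomp := GCell.vcomp
  hcomp := GCell.hcomp
  id_comp₁ := GHom.id_comp
  comp₁_id := GHom.comp_id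
  comp₁_assoc := GHom.assoc
  src_id₂ _ := rfl
  tgt_id₂ _ := rfl
  src_vcomp α _ _ := GCell.src_out α
  tgt_vcomp _ β _ := GCell.tgt_out β
  src_hcomp α β := by
    induction α using GCell.ind
    induction β using GCell.ind
    rfl
  tgt_hcomp α β := by
    induction α using GCell.ind
    induction β using GCell.ind
    rfl
  id_vcomp α e := by
    induction α using GCell.ind with
    | _ f g s =>
      refine (GCell.vcomp_mk (.id f) s e).trans (GCell.sound (.id_vcomp s))
  vcomp_id α e := by
    induction α using GCell.ind with
    | _ f g s =>
      refine (GCell.vcomp_mk s (.id g) e).trans (GCell.sound (.vcomp_id s))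
  vcomp_assoc α β γ e₁ e₂ e₃ e₄ := by
    induction α using GCell.ind
    induction β using GCell.ind
    induction γ using GCell.ind
    simp only [GCell.vcomp_mk]
    exact GCell.sound (.vcomp_assoc _ _ _ _ _)
  id_hcomp α := by
    induction α using GCell.ind
    exact GCell.sound (.id_hcomp _)
  hcomp_id α := by
    induction α using GCell.ind
    exact GCell.sound (.hcomp_id _)
  hcomp_assoc α β γ := by
    induction α using GCell.ind
    induction β using GCell.ind
    induction γ using GCell.ind
    exact GCell.sound (.hcomp_assoc _ _ _)
  hcomp_id₂ f g := GCell.sound (.hcomp_ids f g)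
  interchange α α' β β' e₁ e₂ e₃ := by
    induction α using GCell.ind with | _ _ _ s => ?_
    induction α' using GCell.ind with | _ _ _ s' => ?_
    induction β using GCell.ind with | _ _ _ t => ?_
    induction β' using GCell.ind with | _ _ _ t' => ?_
    simp only [GCell.vcomp_mk]
    refine Eq.trans ?_ (GCell.vcomp_mk (.hcomp s t) (.hcomp s' t') e₃).symm
    exact GCell.sound (.interchange _ _ _ _ _ _ _)

variable {A}

/-- Apply a family of 2-functors to a formal composite of 2-cells. -/
def Term.map (F : ∀ i, TwoFunctor (A i) (B i)) : ∀ {x y : ∀ i, (A i).Obj} {f g : GHom A x y},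
    Term A f g → {t : PreCell B (fun i => (F i).obj (x i)) (fun i => (F i).obj (y i)) //
      t.src = f.map F ∧ t.tgt = g.map F}
  | _, _, _, _, .id f => ⟨⟨_, _, .id (f.map F)⟩, rfl, rfl⟩
  | _, _, _, _, .vcomp s t e =>
    ⟨⟨_, _, .vcomp (s.map F).1.term (t.map F).1.term
      (by rw [(s.map F).2.2, (t.map F).2.1, e])⟩, (s.map F).2.1, (t.map F).2.2⟩
  | _, _, _, _, .hcomp s t =>
    ⟨⟨_, _, .hcomp (s.map F).1.term (t.map F).1.term⟩,
      (congrArg₂ GHom.comp (s.map F).2.1 (t.map F).2.1).trans (GHom.map_comp F _ _).symm,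
      (congrArg₂ GHom.comp (s.map F).2.2 (t.map F).2.2).trans (GHom.map_comp F _ _).symm⟩
  | _, _, _, _, .cell i α h =>
    ⟨⟨_, _, .cell i ((F i).cell α) (h.map F)⟩, congrArg (GHom.gen i · (h.map F)) ((F i).src_cell α),
      congrArg (GHom.gen i · (h.map F)) ((F i).tgt_cell α)⟩
  | _, _, _, _, .γ hij f g h₁ h₂ h₃ h₄ =>
    ⟨⟨_, _, .γ hij ((F _).map f) ((F _).map g) (h₁.map F) (h₂.map F) (h₃.map F) (h₄.map F)⟩,
      rfl, rfl⟩

theorem Term.Rel.id_congr {x y : ∀ i, (A i).Obj} {f f' : GHom A x y} (e : f = f') :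
    Term.Rel A (.id f) (.id f') := e ▸ .refl _

theorem Term.Rel.γ_congr_left {x y z w : ∀ i, (A i).Obj} {i j : ι} (hij : i < j)
    {a b : (A i).Obj} {c d : (A j).Obj} {f f' : (A i).Hom a b} (e : f = f') (g : (A j).Hom c d)
    (h₁ : Move A i a b x y) (h₂ : Move A i a b z w) (h₃ : Move A j c d x z)
    (h₄ : Move A j c d y w) :
    Term.Rel A (.γ hij f g h₁ h₂ h₃ h₄) (.γ hij f' g h₁ h₂ h₃ h₄) := e ▸ .refl _

theorem Term.Rel.γ_congr_right {x y z w : ∀ i, (A i).Obj} {i j : ι} (hij : i < j)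
    {a b : (A i).Obj} {c d : (A j).Obj} (f : (A i).Hom a b) {g g' : (A j).Hom c d} (e : g = g')
    (h₁ : Move A i a b x y) (h₂ : Move A i a b z w) (h₃ : Move A j c d x z)
    (h₄ : Move A j c d y w) :
    Term.Rel A (.γ hij f g h₁ h₂ h₃ h₄) (.γ hij f g' h₁ h₂ h₃ h₄) := e ▸ .refl _

theorem Term.Rel.map (F : ∀ i, TwoFunctor (A i) (B i)) {x y : ∀ i, (A i).Obj}
    {f g f' g' : GHom A x y} {s : Term A f g} {t : Term A f' g'} (h : Term.Rel A s t) :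
    Term.Rel B (s.map F).1.term (t.map F).1.term := by
  induction h with
  | refl => exact .refl _
  | symm _ ih => exact ih.symm
  | trans _ _ ih ih' => exact ih.trans ih'
  | vcomp_congr _ _ _ _ ih ih' => exact .vcomp_congr _ _ ih ih'
  | hcomp_congr _ _ ih ih' => exact .hcomp_congr ih ih'
  | id_vcomp s =>
    exact .trans (.vcomp_congr _ rfl (.id_congr (s.map F).2.1.symm) (.refl _)) (.id_vcomp _)
  | vcomp_id s =>
    exact .trans (.vcomp_congr _ rfl (.refl _) (.id_congr (s.map F).2.2.symm)) (.vcomp_id _)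
  | vcomp_assoc => exact .vcomp_assoc _ _ _ _ _
  | id_hcomp => exact .id_hcomp _
  | hcomp_id => exact .hcomp_id _
  | hcomp_assoc => exact .hcomp_assoc _ _ _
  | hcomp_ids f g =>
    exact .trans (.hcomp_ids _ _) (.id_congr (GHom.map_comp F f g).symm)
  | interchange => exact .interchange _ _ _ _ _ _ _
  | cell_id i f h =>
    dsimp only [Term.map]
    rw [(F i).cell_id]
    exact .cell_id _ _ _
  | cell_vcomp i α β e h e' =>
    dsimp only [Term.map]
    rw [(F i).cell_vcomp α β e (by rw [(F i).src_cell, (F i).tgt_cell, e])]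
    exact .cell_vcomp _ _ _ _ _ _
  | cell_hcomp i α β h h' h'' =>
    dsimp only [Term.map]
    rw [(F i).cell_hcomp]
    exact .cell_hcomp _ _ _ _ _ _
  | γ_natural_left hij α g h₁ h₂ h₃ h₄ =>
    exact .trans
      (.vcomp_congr _ rfl (.γ_congr_left _ ((F _).src_cell α).symm _ _ _ _ _) (.refl _))
      (.trans (.γ_natural_left hij ((F _).cell α) ((F _).map g) (h₁.map F) (h₂.map F)
        (h₃.map F) (h₄.map F))
      (.vcomp_congr rfl _ (.refl _) (.γ_congr_left _ ((F _).tgt_cell α) _ _ _ _ _)))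
  | γ_natural_right hij f β h₁ h₂ h₃ h₄ =>
    exact .trans
      (.vcomp_congr _ rfl (.γ_congr_right _ _ ((F _).src_cell β).symm _ _ _ _) (.refl _))
      (.trans (.γ_natural_right hij ((F _).map f) ((F _).cell β) (h₁.map F) (h₂.map F)
        (h₃.map F) (h₄.map F))
      (.vcomp_congr rfl _ (.refl _) (.γ_congr_right _ _ ((F _).tgt_cell β) _ _ _ _)))
  | γ_id_left hij a g =>
    dsimp only [Term.map]
    rw [(F _).map_id]
    exact .γ_id_left _ _ _ _ _ _
  | γ_id_right hij c f =>
    dsimp only [Term.map]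
    rw [(F _).map_id]
    exact .γ_id_right _ _ _ _ _ _
  | γ_comp_left hij f f' g h₁ h₂ h₃ h₄ h₅ h₆ =>
    dsimp only [Term.map]
    rw [(F _).map_comp]
    exact .γ_comp_left hij _ _ _ _ _ _ _ _ _ _ _ _
  | γ_comp_right hij f g g' h₁ h₂ h₃ h₄ h₅ h₆ =>
    dsimp only [Term.map]
    rw [(F _).map_comp]
    exact .γ_comp_right hij _ _ _ _ _ _ _ _ _ _ _ _
  | cube hij hjk hik f g h => exact .cube hij hjk hik _ _ _ _ _ _ _ _ _ _ _ _ _ _ _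

/-- Apply a family of 2-functors to a 2-cell. -/
def GCell.map (F : ∀ i, TwoFunctor (A i) (B i)) {x y : ∀ i, (A i).Obj} (α : GCell A x y) :
    GCell B (fun i => (F i).obj (x i)) (fun i => (F i).obj (y i)) :=
  Quotient.map (fun s => (s.term.map F).1) (fun _ _ h => Term.Rel.map F h) α

/-- The Gray tensor product of a family of 2-functors. -/
noncomputable def grayMap (F : ∀ i, A i ⟶ B i) : gray A ⟶ gray B :=
  ({ obj := fun x i => (F i).obj (x i)
     map := GHom.map F
     cell := GCell.map F
     src_cell := fun α => by
      induction α using GCell.ind with | _ f g s => exact (s.map F).2.1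
     tgt_cell := fun α => by
      induction α using GCell.ind with | _ f g s => exact (s.map F).2.2
     map_id := fun _ => rfl
     map_comp := GHom.map_comp F
     cell_id := fun _ => rfl
     cell_vcomp := fun α β e e' => by
      induction α using GCell.ind with | _ f g s => ?_
      induction β using GCell.ind with | _ f' g' t => ?_
      refine (congrArg (GCell.map F) (GCell.vcomp_mk s t e)).trans ?_
      exact (GCell.vcomp_mk (s.map F).1.term (t.map F).1.term e').symm
     cell_hcomp := fun α β => by
      induction α using GCell.ind
      induction β using GCell.ind
      rfl } : TwoFunctor (gray A) (gray B))

theorem Term.map_map {C : ι → TwoCat} (F : ∀ i, A i ⟶ B i) (G : ∀ i, B i ⟶ C i)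
    {x y : ∀ i, (A i).Obj} {f g : GHom A x y} (s : Term A f g) :
    Term.Rel C ((s.map F).1.term.map G).1.term (s.map (fun i => F i ≫ G i)).1.term := by
  induction s with
  | id f => exact .id_congr (GHom.map_map F G f)
  | vcomp s t e ih ih' => exact .vcomp_congr _ _ ih ih'
  | hcomp s t ih ih' => exact .hcomp_congr ih ih'
  | cell => exact .refl _
  | γ => exact .refl _

theorem grayMap_comp {C : ι → TwoCat} (F : ∀ i, A i ⟶ B i) (G : ∀ i, B i ⟶ C i) :
    grayMap (fun i => F i ≫ G i) = grayMap F ≫ grayMap G := by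
  have h₁ : ∀ {x y} (f : GHom A x y),
      (grayMap (fun i => F i ≫ G i)).map f = (grayMap F ≫ grayMap G).map f :=
    fun f => (GHom.map_map F G f).symm
  have h₂ : ∀ {x y} (α : GCell A x y),
      (grayMap (fun i => F i ≫ G i)).cell α = (grayMap F ≫ grayMap G).cell α := fun α => by
    induction α using GCell.ind with | _ f g s => ?_
    exact GCell.sound (Term.map_map F G s).symm
  refine TwoFunctor.ext rfl (heq_of_eq ?_) (heq_of_eq ?_)
  · funext x y f
    exact h₁ f
  · funext x y α
    exact h₂ α

end Gray

/-! ### The Gray tensor product of cellular sets -/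

section Tensor

variable {ι : Type} [LinearOrder ι]

/-- Representatives of `κ`-cells of the Gray tensor product of a family of cellular sets. -/
structure PreTensor (X : ι → Thetaᵒᵖ ⥤ Type) (κ : Theta) : Type where
  ζ : ι → Theta
  x : ∀ i, (X i).obj (Opposite.op (ζ i))
  χ : κ.toTwoCat ⟶ gray (fun i => (ζ i).toTwoCat)

/-- The generating identifications `(x · α, χ) ∼ (x, ⊠ α ∘ χ)` of the coend. -/
inductive PreTensor.Rel (X : ι → Thetaᵒᵖ ⥤ Type) (κ : Theta) :
    PreTensor X κ → PreTensor X κ → Prop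
  | mk {ζ ζ' : ι → Theta} (α : ∀ i, ζ i ⟶ ζ' i) (x : ∀ i, (X i).obj (Opposite.op (ζ' i)))
      (χ : κ.toTwoCat ⟶ gray (fun i => (ζ i).toTwoCat)) :
      Rel X κ ⟨ζ, fun i => (X i).map (α i).op (x i), χ⟩
        ⟨ζ', x, χ ≫ grayMap (fun i => Theta.incl.map (α i))⟩

/-- The Gray tensor product of a family of cellular sets, i.e. the coend
`∫^ζ (∏ i, X i (ζ i)) × N(⊠ ζ)`. -/
noncomputable def tensor (X : ι → Thetaᵒᵖ ⥤ Type) : Thetaᵒᵖ ⥤ Type where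
  obj κ := Quot (PreTensor.Rel X κ.unop)
  map f := TypeCat.ofHom (Quot.map (fun s => ⟨s.ζ, s.x, Theta.incl.map f.unop ≫ s.χ⟩)
    (by rintro _ _ ⟨α, x, χ⟩; exact .mk α x _))
  map_id κ := by
    ext s
    induction s using Quot.ind
    rfl
  map_comp f g := by
    ext s
    induction s using Quot.ind
    rfl

end Tensor

/-! ### The comparison map -/

section Comparison

variable {ι : Type} {β : ι → Type} [LinearOrder ι] [∀ u, LinearOrder (β u)]

/-- The concatenation of a family of families, indexed by the lexicographically ordered sum. -/
def flat {V : Type*} (A : ∀ u, β u → V) (p : Σₗ u, β u) : V := A (ofLex p).1 (ofLex p).2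

theorem lex_lt_left {u v : ι} (huv : u < v) (i : β u) (j : β v) :
    (toLex ⟨u, i⟩ : Σₗ u, β u) < toLex ⟨v, j⟩ := Sigma.Lex.left _ _ huv

theorem lex_lt_right {u : ι} {i j : β u} (hij : i < j) :
    (toLex ⟨u, i⟩ : Σₗ u, β u) < toLex ⟨u, j⟩ := Sigma.Lex.right _ _ hij

variable {A : ∀ u, β u → TwoCat}

/-- `J` is the canonical associativity 2-functor from the nested Gray tensor product to the total
one: it concatenates tuples of objects, and sends every generating 1-cell and 2-cell of the nested
tensor product to the generating cell of the total tensor product of the same name.  (There are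
two kinds of generators `γ`: those inside a subtensor and those between two subtensors.)  Since
all cells are composites of these generators, at most one 2-functor satisfies this. -/
structure IsAssociator (J : TwoFunctor (gray (fun u => gray (A u))) (gray (flat A))) : Prop where
  obj : ∀ (X : ∀ u i, (A u i).Obj) (p : Σₗ u, β u), J.obj X p = X (ofLex p).1 (ofLex p).2
  map_gen : ∀ {X Y : ∀ u i, (A u i).Obj} {u : ι} {P Q : ∀ i, (A u i).Obj} {i : β u}
    {a b : (A u i).Obj} (f : (A u i).Hom a b) (h : Move (A u) i a b P Q)
    (H : Move (fun u => gray (A u)) u P Q X Y),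
    ∃ h' : Move (flat A) (toLex ⟨u, i⟩) a b (J.obj X) (J.obj Y),
      J.map (GHom.gen (A := fun u => gray (A u)) u (GHom.gen i f h) H) =
        GHom.gen (A := flat A) (toLex ⟨u, i⟩) f h'
  cell_cell : ∀ {X Y : ∀ u i, (A u i).Obj} {u : ι} {P Q : ∀ i, (A u i).Obj} {i : β u}
    {a b : (A u i).Obj} (α : (A u i).Cell a b) (h : Move (A u) i a b P Q)
    (H : Move (fun u => gray (A u)) u P Q X Y),
    ∃ h' : Move (flat A) (toLex ⟨u, i⟩) a b (J.obj X) (J.obj Y),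
      J.cell (GCell.mk (A := fun u => gray (A u)) (.cell u (GCell.mk (.cell i α h)) H)) =
        GCell.mk (A := flat A) (.cell (toLex ⟨u, i⟩) α h')
  cell_γ_inner : ∀ {X Y : ∀ u i, (A u i).Obj} {u : ι} {P Q R S : ∀ i, (A u i).Obj} {i j : β u}
    (hij : i < j) {a b : (A u i).Obj} {c d : (A u j).Obj} (f : (A u i).Hom a b)
    (g : (A u j).Hom c d) (h₁ : Move (A u) i a b P Q) (h₂ : Move (A u) i a b R S)
    (h₃ : Move (A u) j c d P R) (h₄ : Move (A u) j c d Q S)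
    (H : Move (fun u => gray (A u)) u P S X Y),
    ∃ (Z W : ∀ p, (flat A p).Obj) (h₁' : Move (flat A) (toLex ⟨u, i⟩) a b (J.obj X) Z)
      (h₂' : Move (flat A) (toLex ⟨u, i⟩) a b W (J.obj Y))
      (h₃' : Move (flat A) (toLex ⟨u, j⟩) c d (J.obj X) W)
      (h₄' : Move (flat A) (toLex ⟨u, j⟩) c d Z (J.obj Y)),
      J.cell (GCell.mk (A := fun u => gray (A u))
          (.cell u (GCell.mk (.γ hij f g h₁ h₂ h₃ h₄)) H)) =
        GCell.mk (A := flat A) (.γ (lex_lt_right hij) f g h₁' h₂' h₃' h₄')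
  cell_γ_outer : ∀ {X Y Z W : ∀ u i, (A u i).Obj} {u v : ι} (huv : u < v)
    {P Q : ∀ i, (A u i).Obj} {R S : ∀ j, (A v j).Obj} {i : β u} {j : β v}
    {a b : (A u i).Obj} {c d : (A v j).Obj} (f : (A u i).Hom a b) (g : (A v j).Hom c d)
    (h : Move (A u) i a b P Q) (k : Move (A v) j c d R S)
    (H₁ : Move (fun u => gray (A u)) u P Q X Y) (H₂ : Move (fun u => gray (A u)) u P Q Z W)
    (H₃ : Move (fun u => gray (A u)) v R S X Z) (H₄ : Move (fun u => gray (A u)) v R S Y W),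
    ∃ (h₁' : Move (flat A) (toLex ⟨u, i⟩) a b (J.obj X) (J.obj Y))
      (h₂' : Move (flat A) (toLex ⟨u, i⟩) a b (J.obj Z) (J.obj W))
      (h₃' : Move (flat A) (toLex ⟨v, j⟩) c d (J.obj X) (J.obj Z))
      (h₄' : Move (flat A) (toLex ⟨v, j⟩) c d (J.obj Y) (J.obj W)),
      J.cell (GCell.mk (A := fun u => gray (A u))
          (.γ huv (GHom.gen i f h) (GHom.gen j g k) H₁ H₂ H₃ H₄)) =
        GCell.mk (A := flat A) (.γ (lex_lt_left huv i j) f g h₁' h₂' h₃' h₄')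

/-- The comparison map induced by the associativity 2-functor `J`: it sends the cell represented
by `χ : κ → ⊠ ζ` and `ψ u : ζ u → ⊠ (A u)` to the composite of `χ`, `⊠ ψ` and `J`. -/
noncomputable def comparison (J : gray (fun u => gray (A u)) ⟶ gray (flat A)) :
    tensor (fun u => nerve (gray (A u))) ⟶ nerve (gray (flat A)) where
  app κ := TypeCat.ofHom (Quot.lift
    (fun s => (s.χ ≫ grayMap (B := fun u => gray (A u)) s.x ≫ J : κ.unop.toTwoCat ⟶ _))
    (by
      rintro _ _ ⟨α, x, χ⟩
      have := grayMap_comp (fun u => Theta.incl.map (α u)) (C := fun u => gray (A u)) x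
      exact congrArg (fun G => χ ≫ G ≫ J) this))
  naturality κ l f := by
    ext s
    induction s using Quot.ind
    rfl

end Comparison

/-! ### Pure cells -/

section Pure

variable {ι : Type}

/-- An object of `[n; q]` as a natural number. -/
def Theta.pos {κ : Theta} (x : κ.toTwoCat.Obj) : ℕ := Fin.val (n := κ.n + 1) x

/-- The set `S(s, t)` of all `(i|k)` with `s_i < k ≤ t_i`. -/
def stepSet {T : ι → Theta} (s t : ∀ i, (T i).toTwoCat.Obj) : Set (ι × ℕ) :=
  {p | Theta.pos (s p.1) < p.2 ∧ p.2 ≤ Theta.pos (t p.1)}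

/-- The atomic factors of a formal composite of generating 1-cells, in order; the factor moving
the `i`-th coordinate from `k - 1` to `k` is recorded as `(i|k)`. -/
def Word.steps {T : ι → Theta} : ∀ {x y : ∀ i, (T i).toTwoCat.Obj},
    Word (fun i => (T i).toTwoCat) x y → List (ι × ℕ)
  | _, _, .id _ => []
  | _, _, @Word.gen _ _ _ _ i a b _ _ =>
    (List.range' (Theta.pos a + 1)
      (Theta.pos b - Theta.pos a)).map (Prod.mk i)
  | _, _, .comp u v => u.steps ++ v.steps

theorem range'_split {a b c : ℕ} (h : a ≤ b) (h' : b ≤ c) :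
    List.range' (a + 1) (c - a) = List.range' (a + 1) (b - a) ++ List.range' (b + 1) (c - b) := by
  have e : b + 1 = (a + 1) + (b - a) := by omega
  rw [e, List.range'_append_1]
  congr 1
  omega

theorem Word.Rel.steps {T : ι → Theta} {x y : ∀ i, (T i).toTwoCat.Obj}
    {u v : Word (fun i => (T i).toTwoCat) x y} (h : Word.Rel _ u v) : u.steps = v.steps := by
  induction h with
  | refl => rfl
  | symm _ ih => exact ih.symm
  | trans _ _ ih ih' => exact ih.trans ih'
  | comp_congr _ _ ih ih' => exact congrArg₂ _ ih ih'
  | id_comp => rfl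
  | comp_id => exact List.append_nil _
  | assoc => exact List.append_assoc _ _ _
  | gen_id i a h => simp [Word.steps]
  | @gen_comp _ _ _ i a b c f g h h' h'' =>
    have hf : Theta.pos a ≤ Theta.pos b := Theta.Hom.le f
    have hg : Theta.pos b ≤ Theta.pos c := Theta.Hom.le g
    simp only [Word.steps, ← List.map_append]
    congr 1
    exact range'_split hf hg

/-- The atomic factors of a 1-cell of `⊠ T`, in order.  (Only the horizontal part of the atomic
factors is recorded, so this is also the list for its image in `⊠ T̄`.) -/
def GHom.steps {T : ι → Theta} {x y : ∀ i, (T i).toTwoCat.Obj}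
    (f : GHom (fun i => (T i).toTwoCat) x y) : List (ι × ℕ) :=
  Quotient.lift Word.steps (fun _ _ h => Word.Rel.steps h) f

variable [LinearOrder ι]

/-- The underlying shuffle of a 1-cell `f : s → t` of `⊠ T`: the total order on `S(s, t)` in which
the atomic factors occur in `f`. -/
def GHom.Prec {T : ι → Theta} {x y : ∀ i, (T i).toTwoCat.Obj}
    (f : GHom (fun i => (T i).toTwoCat) x y) (p r : ι × ℕ) : Prop :=
  f.steps.idxOf p ≤ f.steps.idxOf r

/-- The `p`-th underlying shuffle of a `(1; q)`-cell of `N(⊠ T)`. -/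
def shuffle {T : ι → Theta} {q : ℕ}
    (φ : TwoFunctor (Theta.globe q).toTwoCat (gray (fun i => (T i).toTwoCat))) (p : Fin (q + 1))
    (σ τ : ι × ℕ) : Prop :=
  GHom.Prec (φ.map (Theta.globeArrow p)) σ τ

/-- Purity of a `(1; q)`-cell of `N(⊠ T)` with respect to a partition `ρ` of the tensor factors. -/
def IsPureGlobe {υ : Type} (ρ : ι → υ) {T : ι → Theta} {q : ℕ}
    (φ : TwoFunctor (Theta.globe q).toTwoCat (gray (fun i => (T i).toTwoCat))) : Prop :=
  ∀ σ ∈ stepSet (φ.obj (0 : Fin 2)) (φ.obj (1 : Fin 2)),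
  ∀ τ ∈ stepSet (φ.obj (0 : Fin 2)) (φ.obj (1 : Fin 2)), ρ σ.1 = ρ τ.1 →
    (∀ p, shuffle φ p σ τ) ∨ (∀ p, shuffle φ p τ σ) ∨
    (∀ μ ∈ stepSet (φ.obj (0 : Fin 2)) (φ.obj (1 : Fin 2)), ∀ p,
      (shuffle φ p σ μ ∧ shuffle φ p μ τ) ∨ (shuffle φ p τ μ ∧ shuffle φ p μ σ) →
        ρ μ.1 = ρ σ.1)

/-- Purity of a `κ`-cell of `N(⊠ T)`: every `(1; q_k)`-cell `φ · η_h^k` is pure. -/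
def IsPure {υ : Type} (ρ : ι → υ) {T : ι → Theta} {κ : Theta}
    (φ : κ.toTwoCat ⟶ gray (fun i => (T i).toTwoCat)) : Prop :=
  ∀ k : Fin κ.n, IsPureGlobe ρ (Theta.incl.map (κ.etaH k) ≫ φ)

end Pure

end GrayTheta

/-!
The proof describes all 2-categories involved by words.

A 1-cell of a Gray tensor product of free 2-categories `[n; q]` is the same thing as a word of
letters `(i, k, v)`, where the coordinate `i` moves from `k` to `k + 1` along the edge number `v`
(`GHom.letters_injective`, `GHom.exists_letters`).  Between parallel 1-cells there is at most one
2-cell, and there is one if and only if the words are comparable for the relation `LLe`: the edge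
numbers increase, and letters of earlier coordinates move to the front (`GCell.lle`,
`GCell.exists_of_lle`, `GCell.thin`).  Uniqueness is the main point.  A *crossing cell* pulls one
atomic 1-cell of the coordinate `i` to the front, across 1-cells of coordinates `j > i`; it is
determined by its source (`Cross.unique`).  The naturality and cube relations of the interchange
cells say that crossing cells absorb all other 2-cells, so that every 2-cell factors through the
crossing cell that creates the first letter of its target (`factorsThroughCross`).  Induction on
the target then gives uniqueness.  Consequently a 2-functor from `[n; q]` to such a tensor product
is an increasing family of words (`PathModel.ext`, `PathModel.exists_functor`), and the
associativity 2-functor exists and is unique because it has to be the concatenation of words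
(`existsUnique_isAssociator`).

Give a coordinate of the flat tensor product the index of its block as its colour.  The comparison
map replaces each letter of `χ` of colour `u` by a word of colour `u`.  Two letters of the same
colour can change their order only inside one of these monochromatic words, so the image consists
of pure cells (`purePair_flatMap`, `pure_assembled`).

Conversely, a pure cell `φ` has a *canonical factorization*.  Its first part `X` remembers only
the sequences of colours of the words of `φ`; by purity these are increasing in the edge number
(`Coloring.lle_colorPath`).  Its second part consists of the part of `φ` of each colour `u`, cut
into pieces wherever an edge of `φ` begins or a letter of another colour follows; by purity the
steps before a cut are the same for all edge numbers (`Coloring.take_pull_keys`), so that the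
pieces form a 2-functor.  Each piece is contiguous in the word of `φ`, so `φ` is recovered from
the two parts (`Coloring.flatMap_colorPath`).  Hence every pure cell is in the image
(`PathModel.exists_canonical`, `assembled_eq_of_canonical`).

The canonical factorization depends only on `φ`, so the comparison map is injective as soon as
every representative `(χ, ψ)` of a cell is equivalent to the canonical factorization of its image
(`tensorMk_eq_of_canonical`).  The case of only one colour shows that each `ψ u` factors as `g u`
followed by some `ψ' u`, where `g u` preserves the lengths of words
(`PathModel.exists_unit_factorization`).  In the coend, `g u` may be moved to `χ`, and the
resulting `χ'` has the same sequences of colours and the same cuts as `φ`.  Now the canonical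
factorization of `χ'`, for the colouring in which all coordinates have different colours, consists
of the same `X` and of functors `γ u`, which may be moved back; since the composite of `γ u` and
`ψ' u` cuts the part of colour `u` of `φ` at the same places, it is the second part of the
canonical factorization of `φ`.
-/

namespace GrayTheta

/-! ### Words and paths -/

/-- A letter `(i, k, v)`: the `i`-th coordinate moves from `k` to `k + 1` along the edge number
`v`. -/
abbrev Letter (ι : Type) : Type := ι × ℕ × ℕ

/-- The atomic step `(i, k)` underlying a letter, without the choice of the edge. -/
def Letter.key {ι : Type} (a : Letter ι) : ι × ℕ := (a.1, a.2.1)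

/-- `κ` has an edge number `v` from `k` to `k + 1`. -/
def Theta.Ok (κ : Theta) (k v : ℕ) : Prop := ∃ h : k < κ.n, v ≤ κ.q ⟨k, h⟩

/-- `Bef L σ τ`: the step `σ` occurs in the word `L` before the step `τ`. -/
def Bef {ι : Type} (L : List (Letter ι)) (σ τ : ι × ℕ) : Prop :=
  List.Sublist [σ, τ] (L.map Letter.key)

/-- The number of letters of a word that move the coordinate `i`. -/
def cnt {ι : Type} [DecidableEq ι] (i : ι) (L : List (Letter ι)) : ℕ :=
  L.countP (fun a => a.1 = i)

theorem pair_sublist_iff {α : Type} {a b : α} {L : List α} :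
    List.Sublist [a, b] L ↔ ∃ L₁ L₂, L = L₁ ++ L₂ ∧ a ∈ L₁ ∧ b ∈ L₂ := by
  constructor
  · intro h
    have h' : List.Sublist ([a] ++ [b]) L := h
    obtain ⟨L₁, L₂, rfl, h₁, h₂⟩ := List.append_sublist_iff.1 h'
    exact ⟨L₁, L₂, rfl, List.singleton_sublist.1 h₁, List.singleton_sublist.1 h₂⟩
  · rintro ⟨L₁, L₂, rfl, h₁, h₂⟩
    exact (List.singleton_sublist.2 h₁).append (List.singleton_sublist.2 h₂)

section Words

variable {ι : Type}

theorem bef_iff {L : List (Letter ι)} {σ τ : ι × ℕ} :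
    Bef L σ τ ↔ ∃ L₁ L₂, L = L₁ ++ L₂ ∧ σ ∈ L₁.map Letter.key ∧ τ ∈ L₂.map Letter.key := by
  unfold Bef
  rw [pair_sublist_iff]
  constructor
  · rintro ⟨K₁, K₂, h, h₁, h₂⟩
    obtain ⟨L₁, L₂, rfl, rfl, rfl⟩ := List.map_eq_append_iff.1 h
    exact ⟨L₁, L₂, rfl, h₁, h₂⟩
  · rintro ⟨L₁, L₂, rfl, h₁, h₂⟩
    exact ⟨_, _, List.map_append, h₁, h₂⟩

theorem bef_append {L M : List (Letter ι)} {σ τ : ι × ℕ} :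
    Bef (L ++ M) σ τ ↔
      Bef L σ τ ∨ (σ ∈ L.map Letter.key ∧ τ ∈ M.map Letter.key) ∨ Bef M σ τ := by
  constructor
  · intro h
    unfold Bef at h
    rw [List.map_append] at h
    obtain ⟨K₁, K₂, e, h₁, h₂⟩ := List.sublist_append_iff.1 h
    rcases K₁ with _ | ⟨c, K₁⟩
    · simp only [List.nil_append] at e
      subst e
      exact .inr (.inr h₂)
    · rcases K₁ with _ | ⟨d, K₁⟩
      · simp only [List.cons_append, List.nil_append, List.cons.injEq] at e
        obtain ⟨rfl, rfl⟩ := e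
        exact .inr (.inl ⟨List.singleton_sublist.1 h₁, List.singleton_sublist.1 h₂⟩)
      · simp only [List.cons_append, List.cons.injEq, List.nil_eq, List.append_eq_nil_iff] at e
        obtain ⟨rfl, rfl, rfl, rfl⟩ := e
        exact .inl h₁
  · rintro (h | ⟨h₁, h₂⟩ | h)
    · exact List.Sublist.trans h (by rw [List.map_append]; exact List.sublist_append_left _ _)
    · exact bef_iff.2 ⟨_, _, rfl, h₁, h₂⟩
    · exact List.Sublist.trans h (by rw [List.map_append]; exact List.sublist_append_right _ _)

theorem bef_cons {a : Letter ι} {M : List (Letter ι)} {σ τ : ι × ℕ} :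
    Bef (a :: M) σ τ ↔ (σ = a.key ∧ τ ∈ M.map Letter.key) ∨ Bef M σ τ := by
  rw [← List.singleton_append, bef_append]
  constructor
  · rintro (h | h | h)
    · have := List.Sublist.length_le h
      simp at this
    · exact .inl ⟨by simpa using h.1, h.2⟩
    · exact .inr h
  · rintro (h | h)
    · exact .inr (.inl ⟨by simpa using h.1, h.2⟩)
    · exact .inr (.inr h)

theorem not_bef_nil {σ τ : ι × ℕ} : ¬ Bef ([] : List (Letter ι)) σ τ := by
  intro h
  have := List.Sublist.length_le h
  simp at this

theorem Bef.mem_left {L : List (Letter ι)} {σ τ : ι × ℕ} (h : Bef L σ τ) :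
    σ ∈ L.map Letter.key := List.Sublist.subset h (by simp)

theorem Bef.mem_right {L : List (Letter ι)} {σ τ : ι × ℕ} (h : Bef L σ τ) :
    τ ∈ L.map Letter.key := List.Sublist.subset h (by simp)

theorem Bef.asymm {L : List (Letter ι)} (hL : (L.map Letter.key).Nodup) {σ τ : ι × ℕ}
    (h : Bef L σ τ) : ¬ Bef L τ σ := by
  induction L with
  | nil => exact absurd h not_bef_nil
  | cons a L ih =>
    simp only [List.map_cons, List.nodup_cons] at hL
    intro h'
    rcases bef_cons.1 h with ⟨rfl, h₁⟩ | h₁ <;> rcases bef_cons.1 h' with ⟨rfl, h₂⟩ | h₂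
    · exact hL.1 h₁
    · exact hL.1 h₂.mem_right
    · exact hL.1 h₁.mem_right
    · exact ih hL.2 h₁ h₂

theorem Bef.ne {L : List (Letter ι)} (hL : (L.map Letter.key).Nodup) {σ τ : ι × ℕ}
    (h : Bef L σ τ) : σ ≠ τ := by
  rintro rfl
  exact h.asymm hL h

theorem bef_total {L : List (Letter ι)} {σ τ : ι × ℕ} (hσ : σ ∈ L.map Letter.key)
    (hτ : τ ∈ L.map Letter.key) (hne : σ ≠ τ) : Bef L σ τ ∨ Bef L τ σ := by
  induction L with
  | nil => simp at hσ
  | cons a L ih =>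
    simp only [List.map_cons, List.mem_cons] at hσ hτ
    rcases hσ with rfl | hσ <;> rcases hτ with rfl | hτ
    · exact absurd rfl hne
    · exact .inl (bef_cons.2 (.inl ⟨rfl, hτ⟩))
    · exact .inr (bef_cons.2 (.inl ⟨rfl, hσ⟩))
    · exact (ih hσ hτ).imp (fun h => bef_cons.2 (.inr h)) (fun h => bef_cons.2 (.inr h))

theorem mem_keys {L : List (Letter ι)} {i : ι} {k : ℕ} :
    (i, k) ∈ L.map Letter.key ↔ ∃ v, (i, k, v) ∈ L := by
  simp only [List.mem_map, Letter.key]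
  constructor
  · rintro ⟨⟨i', k', v⟩, h, e⟩
    obtain ⟨rfl, rfl⟩ := Prod.mk.inj e
    exact ⟨v, h⟩
  · rintro ⟨v, h⟩
    exact ⟨_, h, rfl⟩

/-- Steps of the middle part of a path keep their order there. -/
theorem bef_middle {A L B : List (Letter ι)} (h : (List.map Letter.key (A ++ (L ++ B))).Nodup)
    {σ τ : ι × ℕ} (hσ : σ ∈ L.map Letter.key) (hτ : τ ∈ L.map Letter.key)
    (hb : Bef (A ++ (L ++ B)) σ τ) : Bef L σ τ := by
  have hne := hb.ne h
  rcases bef_total hσ hτ hne with h' | h'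
  · exact h'
  · exact absurd (bef_append.2 (.inr (.inr (bef_append.2 (.inl h'))))) (hb.asymm h)

variable [LinearOrder ι]

theorem cnt_cons (i : ι) (a : Letter ι) (L : List (Letter ι)) :
    cnt i (a :: L) = cnt i L + if a.1 = i then 1 else 0 := by
  simp [cnt, List.countP_cons]

@[simp] theorem cnt_nil (i : ι) : cnt i ([] : List (Letter ι)) = 0 := rfl

/-- `IsPath T x L y`: the letters of `L` are composable and lead from the vertex `x` to the
vertex `y`. -/
def IsPath (T : ι → Theta) : (ι → ℕ) → List (Letter ι) → (ι → ℕ) → Prop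
  | x, [], y => x = y
  | x, a :: L, y => x a.1 = a.2.1 ∧ (T a.1).Ok a.2.1 a.2.2 ∧
      IsPath T (Function.update x a.1 (a.2.1 + 1)) L y

variable {T : ι → Theta} {x y z : ι → ℕ} {L M : List (Letter ι)}

theorem isPath_append : IsPath T x (L ++ M) z ↔ ∃ y, IsPath T x L y ∧ IsPath T y M z := by
  induction L generalizing x with
  | nil => simp [IsPath]
  | cons a L ih =>
    simp only [List.cons_append, IsPath, ih]
    constructor
    · rintro ⟨h₁, h₂, y, h₃, h₄⟩
      exact ⟨y, ⟨h₁, h₂, h₃⟩, h₄⟩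
    · rintro ⟨y, ⟨h₁, h₂, h₃⟩, h₄⟩
      exact ⟨h₁, h₂, y, h₃, h₄⟩

theorem IsPath.append (h : IsPath T x L y) (h' : IsPath T y M z) : IsPath T x (L ++ M) z :=
  isPath_append.2 ⟨y, h, h'⟩

theorem IsPath.eq_add (h : IsPath T x L y) (i : ι) : y i = x i + cnt i L := by
  induction L generalizing x with
  | nil => simp [show x = y from h]
  | cons a L ih =>
    rw [ih h.2.2, cnt_cons]
    by_cases e : a.1 = i
    · subst e
      simp [h.1]; ring
    · simp [e, Function.update_of_ne (Ne.symm e)]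

theorem IsPath.unique {y' : ι → ℕ} (h : IsPath T x L y) (h' : IsPath T x L y') : y = y' := by
  funext i
  rw [h.eq_add, h'.eq_add]

theorem IsPath.of_append_left (h : IsPath T x L y) (h' : IsPath T x (L ++ M) z) :
    IsPath T y M z := by
  obtain ⟨y', h₁, h₂⟩ := isPath_append.1 h'
  rwa [h.unique h₁]

theorem IsPath.le (h : IsPath T x L y) (i : ι) : x i ≤ y i := by
  rw [h.eq_add]; omega

theorem IsPath.ok (h : IsPath T x L y) {a : Letter ι} (ha : a ∈ L) : (T a.1).Ok a.2.1 a.2.2 := by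
  induction L generalizing x with
  | nil => simp at ha
  | cons b L ih =>
    rcases List.mem_cons.1 ha with rfl | ha
    · exact h.2.1
    · exact ih h.2.2 ha

/-- The set of the steps of a path depends only on its end points: they are the
steps of each coordinate between those of the end points. -/
theorem IsPath.mem_keys_iff (h : IsPath T x L y) {σ : ι × ℕ} :
    σ ∈ L.map Letter.key ↔ x σ.1 ≤ σ.2 ∧ σ.2 < y σ.1 := by
  obtain ⟨i, k⟩ := σ
  induction L generalizing x with
  | nil => simp [show x = y from h]
  | cons b L ih =>
    obtain ⟨j, l, v⟩ := b
    have hle := h.2.2.le i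
    have h1 : x j = l := h.1
    rw [List.map_cons, List.mem_cons, ih h.2.2]
    by_cases e : i = j
    · subst e
      simp only [Function.update_self] at hle ⊢
      simp only [Letter.key, Prod.mk.injEq, true_and]
      omega
    · simp [Letter.key, e]

theorem IsPath.nodup (h : IsPath T x L y) : (L.map Letter.key).Nodup := by
  induction L generalizing x with
  | nil => simp
  | cons a L ih =>
    rw [List.map_cons, List.nodup_cons]
    refine ⟨fun hm => ?_, ih h.2.2⟩
    have := (h.2.2.mem_keys_iff).1 hm
    simp [Letter.key] at this

/-- Every step occurs at most once in a path, so it is taken along only one edge. -/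
theorem IsPath.val_unique (h : IsPath T x L y) {i : ι} {k v v' : ℕ} (h₁ : (i, k, v) ∈ L)
    (h₂ : (i, k, v') ∈ L) : v = v' := by
  have := List.inj_on_of_nodup_map h.nodup h₁ h₂ rfl
  simpa using this

theorem IsPath.eq_nil (h : IsPath T x L x) : L = [] := by
  rcases L with _ | ⟨a, L⟩
  · rfl
  · have := h.mem_keys_iff (σ := a.key)
    simp only [List.map_cons, List.mem_cons, true_or, true_iff] at this
    omega

theorem IsPath.bef_of_lt (h : IsPath T x L y) {i : ι} {k l : ℕ} (hkl : k < l) (hk : x i ≤ k)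
    (hl : l < y i) : Bef L (i, k) (i, l) := by
  induction L generalizing x with
  | nil => simp [show x = y from h] at *; omega
  | cons b L ih =>
    obtain ⟨j, m, v⟩ := b
    have h1 : x j = m := h.1
    rw [bef_cons]
    by_cases e : i = j
    · subst e
      by_cases e' : k = m
      · subst e'
        refine .inl ⟨rfl, ?_⟩
        rw [h.2.2.mem_keys_iff]
        simp; omega
      · exact .inr (ih h.2.2 (by simp; omega))
    · exact .inr (ih h.2.2 (by simpa [e] using hk))

/-- The order on words with the same boundary that corresponds to the existence of a 2-cell:
the edges may only increase, and a letter moving an earlier coordinate may only be pulled to the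
front of a letter moving a later coordinate. -/
def LLe (L L' : List (Letter ι)) : Prop :=
  (∀ i k v v', (i, k, v) ∈ L → (i, k, v') ∈ L' → v ≤ v') ∧
  ∀ i j k l, i < j → Bef L (i, k) (j, l) → Bef L' (i, k) (j, l)

theorem IsPath.lle_refl (h : IsPath T x L y) : LLe L L :=
  ⟨fun _ _ _ _ h₁ h₂ => (h.val_unique h₁ h₂).le, fun _ _ _ _ _ h => h⟩

theorem LLe.trans {L' L'' : List (Letter ι)} (hL : IsPath T x L y) (hL' : IsPath T x L' y)
    (h : LLe L L') (h' : LLe L' L'') : LLe L L'' := by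
  refine ⟨fun i k v v'' h₁ h₂ => ?_, fun i j k l hij hb => h'.2 i j k l hij (h.2 i j k l hij hb)⟩
  obtain ⟨v', hv'⟩ := mem_keys.1 ((hL'.mem_keys_iff).2 ((hL.mem_keys_iff).1 (mem_keys.2 ⟨v, h₁⟩)))
  exact (h.1 _ _ _ _ h₁ hv').trans (h'.1 _ _ _ _ hv' h₂)

theorem LLe.append {L' M' : List (Letter ι)} (hL : IsPath T x L y) (hL' : IsPath T x L' y)
    (hM : IsPath T y M z) (hM' : IsPath T y M' z) (h : LLe L L') (h' : LLe M M') :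
    LLe (L ++ M) (L' ++ M') := by
  constructor
  · intro i k v v' h₁ h₂
    have a := fun w e => (hL.mem_keys_iff).1 (mem_keys (i := i) (k := k).2 ⟨w, e⟩)
    have b := fun w e => (hL'.mem_keys_iff).1 (mem_keys (i := i) (k := k).2 ⟨w, e⟩)
    have c := fun w e => (hM.mem_keys_iff).1 (mem_keys (i := i) (k := k).2 ⟨w, e⟩)
    have d := fun w e => (hM'.mem_keys_iff).1 (mem_keys (i := i) (k := k).2 ⟨w, e⟩)
    rcases List.mem_append.1 h₁ with h₁ | h₁ <;> rcases List.mem_append.1 h₂ with h₂ | h₂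
    · exact h.1 _ _ _ _ h₁ h₂
    · have := a _ h₁; have := d _ h₂; simp only at *; omega
    · have := b _ h₂; have := c _ h₁; simp only at *; omega
    · exact h'.1 _ _ _ _ h₁ h₂
  · intro i j k l hij hb
    rcases bef_append.1 hb with hb | hb | hb
    · exact bef_append.2 (.inl (h.2 _ _ _ _ hij hb))
    · refine bef_append.2 (.inr (.inl ⟨?_, ?_⟩))
      · rw [hL'.mem_keys_iff, ← hL.mem_keys_iff]; exact hb.1
      · rw [hM'.mem_keys_iff, ← hM.mem_keys_iff]; exact hb.2
    · exact bef_append.2 (.inr (.inr (h'.2 _ _ _ _ hij hb)))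

theorem LLe.middle {A B A' L' B' : List (Letter ι)} (h : LLe (A ++ (L ++ B)) (A' ++ (L' ++ B')))
    (hL : IsPath T x L y) (hL' : IsPath T x L' y)
    (hn : (List.map Letter.key (A' ++ (L' ++ B'))).Nodup) : LLe L L' := by
  constructor
  · intro i k v v' h₁ h₂
    exact h.1 i k v v' (by simp [h₁]) (by simp [h₂])
  · intro i j k l hij hb
    refine bef_middle hn ?_ ?_ (h.2 i j k l hij (bef_append.2 (.inr (.inr (bef_append.2 (.inl hb))))))
    · rw [hL'.mem_keys_iff, ← hL.mem_keys_iff]; exact hb.mem_left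
    · rw [hL'.mem_keys_iff, ← hL.mem_keys_iff]; exact hb.mem_right

end Words

/-! ### Restriction of words to a set of coordinates -/

section Pull

variable {ι β : Type} (e : β → ι)

/-- Relabelling of a letter. -/
def push (a : Letter β) : Letter ι := (e a.1, a.2)

/-- The letters of a word that move a coordinate in the image of `e`. -/
noncomputable def pull (L : List (Letter ι)) : List (Letter β) :=
  L.filterMap (fun a => (Function.partialInv e a.1).map (·, a.2))

theorem push_injective (he : Function.Injective e) : Function.Injective (push e) := by
  rintro ⟨i, p⟩ ⟨j, q⟩ h
  simp only [push, Prod.mk.injEq] at h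
  rw [he h.1, h.2]

theorem pull_append (L M : List (Letter ι)) : pull e (L ++ M) = pull e L ++ pull e M :=
  List.filterMap_append

theorem pull_push (he : Function.Injective e) (L : List (Letter β)) :
    pull e (L.map (push e)) = L := by
  unfold pull
  rw [List.filterMap_map]
  conv_rhs => rw [← List.filterMap_some (l := L)]
  congr 1
  funext a
  simp [push, Function.partialInv_left he]

theorem pull_cons_of_eq (he : Function.Injective e) (i : β) (p : ℕ × ℕ) (L : List (Letter ι)) :
    pull e ((e i, p) :: L) = (i, p) :: pull e L := by
  simp [pull, Function.partialInv_left he]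

theorem partialInv_of_notMem {i : ι} (h : i ∉ Set.range e) : Function.partialInv e i = none := by
  unfold Function.partialInv
  rw [dif_neg]
  rintro ⟨j, hj⟩
  exact h ⟨j, hj⟩

theorem pull_cons_of_notMem {a : Letter ι} (h : a.1 ∉ Set.range e) (L : List (Letter ι)) :
    pull e (a :: L) = pull e L := by
  simp [pull, partialInv_of_notMem e h]

theorem mem_pull (he : Function.Injective e) {L : List (Letter ι)} {a : Letter β} :
    a ∈ pull e L ↔ push e a ∈ L := by
  induction L with
  | nil => simp [pull]
  | cons b L ih =>
    by_cases h : b.1 ∈ Set.range e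
    · obtain ⟨i, hi⟩ := h
      obtain ⟨j, p⟩ := b
      simp only at hi
      subst hi
      rw [pull_cons_of_eq e he, List.mem_cons, List.mem_cons, ih]
      refine or_congr ⟨?_, ?_⟩ Iff.rfl
      · rintro rfl; rfl
      · intro h
        exact push_injective e he h
    · rw [pull_cons_of_notMem e h, List.mem_cons, ih]
      refine ⟨.inr, ?_⟩
      rintro (rfl | h')
      · exact absurd ⟨_, rfl⟩ h
      · exact h'

theorem bef_pull (he : Function.Injective e) {L : List (Letter ι)} {σ τ : β × ℕ} :
    Bef (pull e L) σ τ ↔ Bef L (e σ.1, σ.2) (e τ.1, τ.2) := by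
  induction L with
  | nil => exact ⟨fun h => absurd h not_bef_nil, fun h => absurd h not_bef_nil⟩
  | cons b L ih =>
    have hm : (e τ.1, τ.2) ∈ L.map Letter.key ↔ τ ∈ (pull e L).map Letter.key := by
      obtain ⟨i, k⟩ := τ
      rw [mem_keys, mem_keys]
      simp only [mem_pull e he]
      rfl
    by_cases h : b.1 ∈ Set.range e
    · obtain ⟨i, hi⟩ := h
      obtain ⟨j, p⟩ := b
      simp only at hi
      subst hi
      rw [pull_cons_of_eq e he, bef_cons, bef_cons, ih, hm]
      refine or_congr (and_congr ?_ Iff.rfl) Iff.rfl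
      simp [Letter.key, Prod.ext_iff, he.eq_iff]
    · rw [pull_cons_of_notMem e h, ih, bef_cons]
      refine ⟨.inr, ?_⟩
      rintro (h' | h')
      · exact absurd ⟨σ.1, congrArg Prod.fst h'.1⟩ h
      · exact h'

theorem bef_push (he : Function.Injective e) {L : List (Letter β)} {σ τ : β × ℕ} :
    Bef (L.map (push e)) (e σ.1, σ.2) (e τ.1, τ.2) ↔ Bef L σ τ := by
  rw [← bef_pull e he, pull_push e he]

theorem map_pull (he : Function.Injective e) (L : List (Letter ι)) [DecidablePred (· ∈ Set.range e)] :
    (pull e L).map (push e) = L.filter (fun a => a.1 ∈ Set.range e) := by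
  induction L with
  | nil => rfl
  | cons b L ih =>
    by_cases h : b.1 ∈ Set.range e
    · obtain ⟨i, hi⟩ := h
      obtain ⟨j, p⟩ := b
      simp only at hi
      subst hi
      rw [pull_cons_of_eq e he, List.filter_cons_of_pos (by simp), ← ih]
      rfl
    · rw [pull_cons_of_notMem e h, List.filter_cons_of_neg (by simpa using h), ih]

variable [LinearOrder ι] [LinearOrder β]

theorem IsPath.pull (he : Function.Injective e) {T : ι → Theta} {x y : ι → ℕ}
    {L : List (Letter ι)} (h : IsPath T x L y) :
    IsPath (fun i => T (e i)) (fun i => x (e i)) (pull e L) (fun i => y (e i)) := by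
  induction L generalizing x with
  | nil =>
    have : x = y := h
    subst this
    rfl
  | cons b L ih =>
    have h' := ih h.2.2
    by_cases hb : b.1 ∈ Set.range e
    · obtain ⟨j, hj⟩ := hb
      obtain ⟨j, p⟩ := b
      simp only at hj
      subst hj
      rw [pull_cons_of_eq e he]
      refine ⟨h.1, h.2.1, ?_⟩
      convert h' using 1
      funext i
      by_cases hi : i = j
      · subst hi; simp
      · simp [Function.update_of_ne hi, Function.update_of_ne (he.ne hi)]
    · rw [pull_cons_of_notMem e hb]
      convert h' using 1
      funext i
      rw [Function.update_of_ne]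
      intro h''
      exact hb ⟨i, h''⟩

theorem LLe.pull (he : StrictMono e) {L L' : List (Letter ι)} (h : LLe L L') :
    LLe (pull e L) (pull e L') := by
  constructor
  · intro i k v v' h₁ h₂
    rw [mem_pull e he.injective] at h₁ h₂
    exact h.1 _ _ _ _ h₁ h₂
  · intro i j k l hij hb
    rw [bef_pull e he.injective] at hb ⊢
    exact h.2 _ _ _ _ (he hij) hb

/-- Relabelling turns paths into paths: only the coordinates in the image of `e` move. -/
theorem IsPath.push (he : Function.Injective e) {T : ι → Theta} {x y : ι → ℕ}
    {L : List (Letter β)}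
    (h : IsPath (fun i => T (e i)) (fun i => x (e i)) L (fun i => y (e i)))
    (hxy : ∀ i, i ∉ Set.range e → x i = y i) : IsPath T x (L.map (push e)) y := by
  induction L generalizing x with
  | nil =>
    have h' : (fun i => x (e i)) = fun i => y (e i) := h
    refine funext fun i => ?_
    by_cases hi : i ∈ Set.range e
    · obtain ⟨j, rfl⟩ := hi
      exact congrFun h' j
    · exact hxy i hi
  | cons b L ih =>
    refine ⟨h.1, h.2.1, ih ?_ ?_⟩
    · convert h.2.2 using 1
      funext i
      by_cases hi : i = b.1
      · subst hi; simp [GrayTheta.push]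
      · simp [GrayTheta.push, Function.update_of_ne hi, Function.update_of_ne (he.ne hi)]
    · intro i hi
      rw [Function.update_of_ne, hxy i hi]
      rintro rfl
      exact hi ⟨_, rfl⟩

theorem LLe.push (he : StrictMono e) {L L' : List (Letter β)} (h : LLe L L') :
    LLe (L.map (push e)) (L'.map (push e)) := by
  constructor
  · rintro i k v v' h₁ h₂
    obtain ⟨⟨i₁, k₁, w₁⟩, m₁, e₁⟩ := List.mem_map.1 h₁
    obtain ⟨⟨i₂, k₂, w₂⟩, m₂, e₂⟩ := List.mem_map.1 h₂
    simp only [GrayTheta.push, Prod.mk.injEq] at e₁ e₂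
    obtain ⟨rfl, rfl, rfl⟩ := e₁
    obtain ⟨e₃, rfl, rfl⟩ := e₂
    obtain rfl := he.injective e₃
    exact h.1 _ _ _ _ m₁ m₂
  · intro i j k l hij hb
    have h₁ := hb.mem_left
    have h₂ := hb.mem_right
    rw [List.map_map] at h₁ h₂
    obtain ⟨⟨i₁, k₁, w₁⟩, m₁, e₁⟩ := List.mem_map.1 h₁
    obtain ⟨⟨i₂, k₂, w₂⟩, m₂, e₂⟩ := List.mem_map.1 h₂
    simp only [GrayTheta.push, Letter.key, Function.comp, Prod.mk.injEq] at e₁ e₂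
    obtain ⟨rfl, rfl⟩ := e₁
    obtain ⟨rfl, rfl⟩ := e₂
    have := (bef_push e he.injective (σ := (i₁, k₁)) (τ := (i₂, k₂))).1 hb
    exact (bef_push e he.injective (σ := (i₁, k₁)) (τ := (i₂, k₂))).2
      (h.2 _ _ _ _ (he.lt_iff_lt.1 hij) this)

end Pull

/-! ### Cells of the free 2-categories `[n; q]` -/

namespace Theta

variable {κ : Theta}

/-- The part of a 1-cell before an intermediate vertex. -/
def Hom.fst {k l : Fin (κ.n + 1)} (f : κ.Hom k l) (m : Fin (κ.n + 1)) (h : k ≤ m) (h' : m ≤ l) :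
    κ.Hom k m := ⟨h, fun j h₁ h₂ => f.val j h₁ (h₂.trans_le h')⟩

/-- The part of a 1-cell after an intermediate vertex. -/
def Hom.snd {k l : Fin (κ.n + 1)} (f : κ.Hom k l) (m : Fin (κ.n + 1)) (h : k ≤ m) (h' : m ≤ l) :
    κ.Hom m l := ⟨h', fun j h₁ h₂ => f.val j (h.trans h₁) h₂⟩

theorem Hom.fst_comp_snd {k l : Fin (κ.n + 1)} (f : κ.Hom k l) (m : Fin (κ.n + 1)) (h : k ≤ m)
    (h' : m ≤ l) : (f.fst m h h').comp (f.snd m h h') = f := by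
  refine Hom.ext (funext fun j => funext fun h₁ => funext fun h₂ => ?_)
  simp only [Hom.comp, Hom.fst, Hom.snd]
  split_ifs <;> rfl

theorem Hom.eq_id {k : Fin (κ.n + 1)} (f : κ.Hom k k) : f = Hom.id k :=
  Hom.ext (funext fun _ => funext fun h₁ => funext fun h₂ => absurd h₂ (not_lt.mpr h₁))

theorem exists_succ {k l : Fin (κ.n + 1)} (h : k < l) :
    ∃ m : Fin (κ.n + 1), m.val = k.val + 1 ∧ k ≤ m ∧ m ≤ l := by
  refine ⟨⟨k.val + 1, ?_⟩, rfl, ?_, ?_⟩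
  · have := l.isLt; have : k.val < l.val := h; omega
  · simp [Fin.le_def]
  · have : k.val < l.val := h
    simp only [Fin.le_def]; omega

/-- Every 1-cell of `[n; q]` is a composite of edges. -/
theorem Hom.ind {l : Fin (κ.n + 1)} {P : ∀ {k}, κ.Hom k l → Prop} (id : P (Hom.id l))
    (cons : ∀ {k k' : Fin (κ.n + 1)} (e : κ.Hom k k') (f : κ.Hom k' l), k'.val = k.val + 1 →
      P f → P (e.comp f)) {k : Fin (κ.n + 1)} (f : κ.Hom k l) : P f := by
  induction hd : l.val - k.val generalizing k with
  | zero =>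
    have h := f.le
    have : k = l := le_antisymm h (by simp only [Fin.le_def]; omega)
    subst this
    rw [f.eq_id]
    exact id
  | succ d ih =>
    have hlt : k < l := by simp only [Fin.lt_def]; omega
    obtain ⟨m, hm, h₁, h₂⟩ := exists_succ hlt
    rw [← f.fst_comp_snd m h₁ h₂]
    exact cons _ _ hm (ih _ (by omega))

/-- Every 2-cell of `[n; q]` is a horizontal composite of 2-cells between edges. -/
theorem cell_ind {l : Fin (κ.n + 1)} {P : ∀ {k : Fin (κ.n + 1)}, κ.toTwoCat.Cell k l → Prop}
    (id : P (κ.toTwoCat.id₂ (κ.toTwoCat.id₁ l)))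
    (cons : ∀ {k k' : Fin (κ.n + 1)} (e : κ.toTwoCat.Cell k k') (f : κ.toTwoCat.Cell k' l),
      k'.val = k.val + 1 → P f → P (κ.toTwoCat.hcomp e f))
    {k : Fin (κ.n + 1)} (f : κ.toTwoCat.Cell k l) : P f := by
  induction hd : l.val - k.val generalizing k with
  | zero =>
    have h := f.1.1.le
    have : k = l := le_antisymm h (by simp only [Fin.le_def]; omega)
    subst this
    have : f = κ.toTwoCat.id₂ (κ.toTwoCat.id₁ k) :=
      Subtype.ext (Prod.ext (Hom.eq_id _) (Hom.eq_id _))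
    rw [this]
    exact id
  | succ d ih =>
    have hlt : k < l := by simp only [Fin.lt_def]; omega
    obtain ⟨m, hm, h₁, h₂⟩ := exists_succ hlt
    have : f = κ.toTwoCat.hcomp (x := k) (y := m) (z := l)
        ⟨(f.1.1.fst m h₁ h₂, f.1.2.fst m h₁ h₂), fun j h₃ h₄ => f.2 j _ _⟩
        ⟨(f.1.1.snd m h₁ h₂, f.1.2.snd m h₁ h₂), fun j h₃ h₄ => f.2 j _ _⟩ :=
      Subtype.ext (Prod.ext (f.1.1.fst_comp_snd m h₁ h₂).symm (f.1.2.fst_comp_snd m h₁ h₂).symm)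
    rw [this]
    exact cons _ _ hm (ih _ (by omega))

/-- The component of a 1-cell at `m`, as a natural number (with junk value `0`). -/
noncomputable def Hom.valN {k l : Fin (κ.n + 1)} (f : κ.Hom k l) (m : ℕ) : ℕ :=
  open Classical in
  if h : ∃ h : m < κ.n, k ≤ (⟨m, h⟩ : Fin κ.n).castSucc ∧ (⟨m, h⟩ : Fin κ.n).castSucc < l then
    (f.val ⟨m, h.1⟩ h.2.1 h.2.2).val else 0

theorem Hom.valN_eq {k l : Fin (κ.n + 1)} (f : κ.Hom k l) (m : Fin κ.n) (h₁ h₂) :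
    f.valN m.val = (f.val m h₁ h₂).val := by
  unfold Hom.valN
  rw [dif_pos ⟨m.isLt, h₁, h₂⟩]

/-- The word of a 1-cell of `[n; q]`, as a word in the coordinate `i`. -/
noncomputable def Hom.word {ι : Type} (i : ι) {k l : Fin (κ.n + 1)} (f : κ.Hom k l) :
    List (Letter ι) :=
  (List.range' k.val (l.val - k.val)).map (fun m => (i, m, f.valN m))

theorem Hom.word_id {ι : Type} (i : ι) (k : Fin (κ.n + 1)) : (Hom.id k).word i = [] := by
  simp [Hom.word]

theorem Hom.word_comp {ι : Type} (i : ι) {j k l : Fin (κ.n + 1)} (f : κ.Hom j k)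
    (g : κ.Hom k l) : (f.comp g).word i = f.word i ++ g.word i := by
  have h₁ : j.val ≤ k.val := f.le
  have h₂ : k.val ≤ l.val := g.le
  have hl := l.isLt
  have e : List.range' j.val (l.val - j.val) =
      List.range' j.val (k.val - j.val) ++ List.range' k.val (l.val - k.val) := by
    have e : k.val = j.val + (k.val - j.val) := by omega
    conv_rhs => rw [e, Nat.add_sub_cancel_left]
    rw [List.range'_append_1]
    congr 1
    omega
  unfold Hom.word
  rw [e, List.map_append]
  congr 1
  · refine List.map_congr_left fun m hm => ?_
    rw [List.mem_range'_1] at hm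
    have hmn : m < κ.n := by omega
    rw [(f.comp g).valN_eq ⟨m, hmn⟩ (Fin.le_def.2 (by simpa using hm.1))
      (Fin.lt_def.2 (by simp; omega)), f.valN_eq ⟨m, hmn⟩ (Fin.le_def.2 (by simpa using hm.1))
      (Fin.lt_def.2 (by simp; omega))]
    simp only [Hom.comp]
    rw [dif_pos]
  · refine List.map_congr_left fun m hm => ?_
    rw [List.mem_range'_1] at hm
    have hmn : m < κ.n := by omega
    rw [(f.comp g).valN_eq ⟨m, hmn⟩ (Fin.le_def.2 (by simp; omega))
      (Fin.lt_def.2 (by simp; omega)), g.valN_eq ⟨m, hmn⟩ (Fin.le_def.2 (by simp; omega))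
      (Fin.lt_def.2 (by simp; omega))]
    simp only [Hom.comp]
    rw [dif_neg (by simp [Fin.lt_def]; omega)]

theorem Hom.word_of_step {ι : Type} (i : ι) {k l : Fin (κ.n + 1)} (f : κ.Hom k l)
    (h : l.val = k.val + 1) : f.word i = [(i, k.val, f.valN k.val)] := by
  simp [Hom.word, h]

theorem Hom.word_injective {ι : Type} (i : ι) {k l : Fin (κ.n + 1)} {f g : κ.Hom k l}
    (h : f.word i = g.word i) : f = g := by
  refine Hom.ext (funext fun m => funext fun h₁ => funext fun h₂ => Fin.ext ?_)
  rw [← f.valN_eq, ← g.valN_eq]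
  have := List.map_inj_left.1 h m.val
  have h₁' : k.val ≤ m.val := h₁
  have h₂' : m.val < l.val := h₂
  have := this (by rw [List.mem_range'_1]; omega)
  simpa using this

theorem Hom.word_path {ι : Type} [LinearOrder ι] (i : ι) {k l : Fin (κ.n + 1)} (f : κ.Hom k l)
    {T : ι → Theta} (hT : T i = κ) {x y : ι → ℕ} (hx : x i = k.val) (hy : y i = l.val)
    (hxy : ∀ j, j ≠ i → x j = y j) : IsPath T x (f.word i) y := by
  induction f using Hom.ind generalizing x with
  | id =>
    rw [Hom.word_id]
    refine funext fun j => ?_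
    by_cases h : j = i
    · subst h; rw [hx, hy]
    · exact hxy j h
  | @cons k k' e f hk ih =>
    rw [Hom.word_comp, Hom.word_of_step i e hk]
    refine ⟨hx, ?_, ?_⟩
    · subst hT
      have hk'' : k.val < (T i).n := by have := k'.isLt; omega
      refine ⟨hk'', ?_⟩
      have h₁ : k ≤ (⟨k.val, hk''⟩ : Fin (T i).n).castSucc := Fin.le_def.2 (by simp)
      have h₂ : (⟨k.val, hk''⟩ : Fin (T i).n).castSucc < k' := Fin.lt_def.2 (by simp; omega)
      have := e.valN_eq ⟨k.val, hk''⟩ h₁ h₂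
      have := (e.val ⟨k.val, hk''⟩ h₁ h₂).isLt
      simp only at *
      omega
    · refine ih ?_ ?_
      · simp [hk]
      · intro j hj
        simp only [Function.update_of_ne hj]
        exact hxy j hj

theorem Hom.mem_word {ι : Type} {i : ι} {k l : Fin (κ.n + 1)} {f : κ.Hom k l} {a : Letter ι}
    (h : a ∈ f.word i) : a.1 = i ∧ a.2.2 = f.valN a.2.1 ∧ k.val ≤ a.2.1 ∧ a.2.1 < l.val := by
  obtain ⟨m, hm, rfl⟩ := List.mem_map.1 h
  rw [List.mem_range'_1] at hm
  refine ⟨rfl, rfl, hm.1, ?_⟩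
  simp only
  omega

theorem Hom.word_eq_map {ι : Type} (i : ι) {k l : Fin (κ.n + 1)} (f : κ.Hom k l) :
    f.word i = (f.word ()).map (push (fun _ => i)) := by
  simp [Hom.word, push]

theorem Hom.exists_word {ι : Type} [LinearOrder ι] (i : ι) {T : ι → Theta} (hT : T i = κ)
    {k l : Fin (κ.n + 1)} {x y : ι → ℕ} {L : List (Letter ι)} (hL : IsPath T x L y)
    (hx : x i = k.val) (hy : y i = l.val) (hi : ∀ a ∈ L, a.1 = i) :
    ∃ f : κ.Hom k l, f.word i = L := by
  induction L generalizing x k with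
  | nil =>
    have : x = y := hL
    subst this
    have : k = l := Fin.ext (hx.symm.trans hy)
    subst this
    exact ⟨Hom.id k, Hom.word_id i k⟩
  | cons a L ih =>
    obtain ⟨j, m, v⟩ := a
    have hj : j = i := hi (j, m, v) (by simp)
    subst hj
    obtain ⟨h₁, ⟨h₂, h₂'⟩, h₃⟩ := hL
    simp only at h₁ h₂ h₃ h₂'
    subst hT
    have hkm : k.val = m := hx.symm.trans h₁
    obtain ⟨f, hf⟩ := ih (k := ⟨m + 1, by omega⟩) h₃ (by simp) (fun a ha => hi a (by simp [ha]))
    subst hkm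
    let e : (T j).Hom k ⟨k.val + 1, by omega⟩ :=
      ⟨Fin.le_def.2 (by simp), fun r h₁ h₂ => ⟨v, by
        have : r = ⟨k.val, ‹_›⟩ := Fin.ext (by
          have h₁ : k.val ≤ r.val := h₁
          have h₂ : r.val < k.val + 1 := h₂
          simp only; omega)
        rw [this]; omega⟩⟩
    refine ⟨e.comp f, ?_⟩
    rw [Hom.word_comp, hf, Hom.word_of_step j e rfl]
    have := e.valN_eq ⟨k.val, h₂⟩ (Fin.le_def.2 (by simp)) (Fin.lt_def.2 (by simp))
    simp only at this
    rw [this]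
    rfl

end Theta

/-! ### Words of 1-cells of a Gray tensor product of free 2-categories -/

section GrayWords

variable {ι : Type} {T : ι → Theta}

/-- The vertex of a Gray tensor product, with natural numbers as coordinates. -/
def vpos (x : ∀ i, (T i).toTwoCat.Obj) (i : ι) : ℕ := Theta.pos (x i)

theorem vpos_injective {x y : ∀ i, (T i).toTwoCat.Obj} (h : vpos x = vpos y) : x = y :=
  funext fun i => Fin.ext (congrFun h i)

theorem vpos_le (x : ∀ i, (T i).toTwoCat.Obj) (i : ι) : vpos x i ≤ (T i).n :=
  Nat.le_of_lt_succ (Fin.isLt (n := (T i).n + 1) (x i))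

theorem exists_vpos {p : ι → ℕ} (h : ∀ i, p i ≤ (T i).n) :
    ∃ x : ∀ i, (T i).toTwoCat.Obj, vpos x = p :=
  ⟨fun i => (⟨p i, Nat.lt_succ_of_le (h i)⟩ : Fin ((T i).n + 1)), rfl⟩

/-- The letters of a formal composite. -/
noncomputable def Word.letters : ∀ {x y : ∀ i, (T i).toTwoCat.Obj},
    Word (fun i => (T i).toTwoCat) x y → List (Letter ι)
  | _, _, .id _ => []
  | _, _, .gen i f _ => Theta.Hom.word i f
  | _, _, .comp u v => u.letters ++ v.letters

theorem Word.Rel.letters {x y : ∀ i, (T i).toTwoCat.Obj}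
    {u v : Word (fun i => (T i).toTwoCat) x y} (h : Word.Rel _ u v) : u.letters = v.letters := by
  induction h with
  | refl => rfl
  | symm _ ih => exact ih.symm
  | trans _ _ ih ih' => exact ih.trans ih'
  | comp_congr _ _ ih ih' => exact congrArg₂ _ ih ih'
  | id_comp => rfl
  | comp_id => exact List.append_nil _
  | assoc => exact List.append_assoc _ _ _
  | gen_id i a h => exact Theta.Hom.word_id i _
  | gen_comp i f g h h' h'' => exact Theta.Hom.word_comp i f g

/-- The letters of a 1-cell of a Gray tensor product of free 2-categories. -/
noncomputable def GHom.letters {x y : ∀ i, (T i).toTwoCat.Obj}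
    (f : GHom (fun i => (T i).toTwoCat) x y) : List (Letter ι) :=
  Quotient.lift Word.letters (fun _ _ h => Word.Rel.letters h) f

variable {x y z : ∀ i, (T i).toTwoCat.Obj}

@[simp] theorem GHom.letters_id : (GHom.id (A := fun i => (T i).toTwoCat) x).letters = [] := rfl

@[simp] theorem GHom.letters_comp (f : GHom (fun i => (T i).toTwoCat) x y)
    (g : GHom (fun i => (T i).toTwoCat) y z) : (f.comp g).letters = f.letters ++ g.letters := by
  induction f using Quotient.ind
  induction g using Quotient.ind
  rfl

/-- An edge of `[n; q]`, i.e. a 1-cell from a vertex to the next one. -/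
def IsStep {κ : Theta} (a b : κ.toTwoCat.Obj) : Prop := Theta.pos b = Theta.pos a + 1

theorem letters_gen_of_step {i : ι} {a b : (T i).toTwoCat.Obj} (hab : IsStep a b)
    (f : (T i).toTwoCat.Hom a b) (h : Move (fun i => (T i).toTwoCat) i a b x y) :
    (GHom.gen i f h).letters = [(i, Theta.pos a, Theta.Hom.valN f (Theta.pos a))] :=
  Theta.Hom.word_of_step i f hab

/-- The vertex obtained by changing one coordinate. -/
theorem exists_move [LinearOrder ι] (x : ∀ i, (T i).toTwoCat.Obj) (i : ι)
    (b : (T i).toTwoCat.Obj) : ∃ y, Move (fun i => (T i).toTwoCat) i (x i) b x y :=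
  ⟨Function.update x i b, rfl, by simp, fun j hj => by simp [hj]⟩

theorem Move.vpos_eq [LinearOrder ι] {i : ι} {a b : (T i).toTwoCat.Obj}
    (h : Move (fun i => (T i).toTwoCat) i a b x y) :
    vpos y = Function.update (vpos x) i (Theta.pos b) := by
  funext j
  by_cases hj : j = i
  · subst hj; simp [vpos, h.2.1]
  · simp [vpos, hj, h.2.2 j hj]

theorem Move.target_eq {i : ι} {a b : (T i).toTwoCat.Obj}
    (h : Move (fun i => (T i).toTwoCat) i a b x y)
    (h' : Move (fun i => (T i).toTwoCat) i a b x z) : y = z := by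
  funext j
  by_cases hj : j = i
  · subst hj; rw [h.2.1, h'.2.1]
  · rw [← h.2.2 j hj, ← h'.2.2 j hj]

/-- Two atomic 1-cells with the same letter and the same source agree. -/
theorem gen_step_ext {x' : ∀ i, (T i).toTwoCat.Obj} {i i' : ι} {a b : (T i).toTwoCat.Obj}
    {a' b' : (T i').toTwoCat.Obj} (hab : IsStep a b) (hab' : IsStep a' b')
    {f : (T i).toTwoCat.Hom a b} {f' : (T i').toTwoCat.Hom a' b'}
    (h : Move (fun i => (T i).toTwoCat) i a b x y)
    (h' : Move (fun i => (T i).toTwoCat) i' a' b' x x')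
    (e : (GHom.gen i f h).letters = (GHom.gen i' f' h').letters) :
    i = i' ∧ HEq a a' ∧ HEq b b' ∧ HEq f f' ∧ y = x' := by
  have e₀ := e
  rw [letters_gen_of_step hab, letters_gen_of_step hab'] at e
  simp only [List.cons.injEq, Prod.mk.injEq, and_true] at e
  obtain ⟨rfl, e₁, e₂⟩ := e
  obtain rfl : a = a' := Fin.ext e₁
  obtain rfl : b = b' := Fin.ext (hab.trans hab'.symm)
  obtain rfl : f = f' := Theta.Hom.word_injective i e₀
  exact ⟨rfl, HEq.rfl, HEq.rfl, HEq.rfl, h.target_eq h'⟩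

variable [LinearOrder ι]

/-- Every 1-cell is a composite of atomic ones. -/
theorem GHom.ind {P : ∀ {x}, GHom (fun i => (T i).toTwoCat) x y → Prop} (id : P (GHom.id y))
    (cons : ∀ {x x'} (i : ι) {a b : (T i).toTwoCat.Obj} (_ : IsStep a b)
      (f : (T i).toTwoCat.Hom a b) (h : Move (fun i => (T i).toTwoCat) i a b x x')
      (g : GHom (fun i => (T i).toTwoCat) x' y), P g → P ((GHom.gen i f h).comp g))
    (f : GHom (fun i => (T i).toTwoCat) x y) : P f := by
  suffices H : ∀ {x z} (u : Word (fun i => (T i).toTwoCat) x z)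
      (g : GHom (fun i => (T i).toTwoCat) z y), P g →
      P (GHom.comp (Quotient.mk _ u : GHom (fun i => (T i).toTwoCat) x z) g) by
    induction f using Quotient.ind with
    | _ u =>
      have h0 := GHom.comp_id (Quotient.mk _ u : GHom (fun i => (T i).toTwoCat) x y)
      exact h0 ▸ H u _ id
  intro x z u
  induction u with
  | id x =>
    intro g hg
    have : GHom.comp (GHom.id x) g = g := GHom.id_comp g
    exact this.symm ▸ hg
  | comp u v ihu ihv =>
    intro g hg
    have h0 := GHom.assoc (Quotient.mk _ u : GHom (fun i => (T i).toTwoCat) _ _)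
      (Quotient.mk _ v : GHom (fun i => (T i).toTwoCat) _ _) g
    have h1 := ihu _ (ihv g hg)
    rw [← h0] at h1
    exact h1
  | @gen x z i a b f h =>
    intro g hg
    change P ((GHom.gen i f h).comp g)
    induction f using Theta.Hom.ind generalizing x with
    | id =>
      have hxz : x = z := by
        funext j
        by_cases hj : j = i
        · subst hj; rw [h.1, h.2.1]
        · exact h.2.2 j hj
      subst hxz
      have h0 := GHom.gen_id (A := fun i => (T i).toTwoCat) i b h
      change P ((GHom.gen i ((T i).toTwoCat.id₁ b) h).comp g)
      rw [h0, GHom.id_comp]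
      exact hg
    | @cons k k' e f hk ih =>
      obtain ⟨x', hx'⟩ := exists_move x i k'
      rw [show x i = k from h.1] at hx'
      have hx'' : Move (fun i => (T i).toTwoCat) i k' b x' z :=
        ⟨hx'.2.1, h.2.1, fun j hj => (hx'.2.2 j hj).symm.trans (h.2.2 j hj)⟩
      have h0 := GHom.gen_comp (A := fun i => (T i).toTwoCat) i e f hx' hx'' h
      change P ((GHom.gen i ((T i).toTwoCat.comp₁ e f) h).comp g)
      rw [h0, GHom.assoc]
      exact cons i hk e hx' _ (ih hx'')

/-- The letters of a 1-cell lead from its source to its target. -/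
theorem GHom.letters_path (f : GHom (fun i => (T i).toTwoCat) x y) :
    IsPath T (vpos x) f.letters (vpos y) := by
  induction f using GHom.ind with
  | id => rfl
  | cons i hab f h g ih =>
    rw [GHom.letters_comp]
    refine IsPath.append (Theta.Hom.word_path i f rfl ?_ ?_ ?_) ih
    · simp [vpos, h.1]; rfl
    · simp [vpos, h.2.1]; rfl
    · intro j hj; simp [vpos, h.2.2 j hj]

/-- A 1-cell with the empty word is an identity. -/
theorem GHom.eq_of_letters_nil {f : GHom (fun i => (T i).toTwoCat) x x} (h : f.letters = []) :
    f = GHom.id x := by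
  revert h
  suffices H : ∀ {x y} (f : GHom (fun i => (T i).toTwoCat) x y), f.letters = [] →
      ∀ e : x = y, HEq f (GHom.id (A := fun i => (T i).toTwoCat) x) from
    fun h => eq_of_heq (H f h rfl)
  intro x y f
  induction f using GHom.ind with
  | id => intro _ _; rfl
  | cons i hab f h g ih =>
    intro h'
    rw [GHom.letters_comp, letters_gen_of_step hab] at h'
    simp at h'

/-- A 1-cell is determined by its letters. -/
theorem GHom.letters_injective {f g : GHom (fun i => (T i).toTwoCat) x y}
    (h : f.letters = g.letters) : f = g := by
  induction f using GHom.ind with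
  | id => exact (GHom.eq_of_letters_nil h.symm).symm
  | @cons x x' i a b hab f hm f' ih =>
    revert h
    induction g using GHom.ind with
    | id =>
      intro h
      rw [GHom.letters_comp, letters_gen_of_step hab] at h
      simp at h
    | @cons x x'' i' a' b' hab' g hm' g' _ =>
      intro h
      simp only [GHom.letters_comp] at h
      have h1 := h
      rw [letters_gen_of_step hab, letters_gen_of_step hab'] at h1
      simp only [List.cons_append, List.nil_append, List.cons.injEq] at h1
      obtain ⟨rfl, ha, hb, hf, rfl⟩ := gen_step_ext hab hab' hm hm' (by
        rw [letters_gen_of_step hab, letters_gen_of_step hab', h1.1])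
      obtain rfl := eq_of_heq ha
      obtain rfl := eq_of_heq hb
      obtain rfl := eq_of_heq hf
      rw [ih h1.2]

/-- Every path is the word of a 1-cell. -/
theorem GHom.exists_letters {L : List (Letter ι)} (h : IsPath T (vpos x) L (vpos y)) :
    ∃ f : GHom (fun i => (T i).toTwoCat) x y, f.letters = L := by
  induction L generalizing x with
  | nil =>
    obtain rfl := vpos_injective (show vpos x = vpos y from h)
    exact ⟨GHom.id x, rfl⟩
  | cons c L ih =>
    obtain ⟨i, k, v⟩ := c
    obtain ⟨h₁, ⟨h₂, h₂'⟩, h₃⟩ := h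
    simp only at h₁ h₂ h₃ h₂'
    obtain ⟨b, hb⟩ : ∃ b : (T i).toTwoCat.Obj, Theta.pos b = k + 1 :=
      ⟨(⟨k + 1, by omega⟩ : Fin ((T i).n + 1)), rfl⟩
    obtain ⟨x', hx'⟩ := exists_move x i b
    have h₄ := hx'.vpos_eq
    rw [hb] at h₄
    rw [← h₄] at h₃
    obtain ⟨g, hg⟩ := ih h₃
    obtain ⟨f, hf⟩ := Theta.Hom.exists_word i (κ := T i) rfl (k := x i)
      (l := b) (L := [(i, k, v)]) (x := vpos x) (y := vpos x')
      ⟨h₁, ⟨h₂, h₂'⟩, h₄.symm⟩ rfl (by rw [h₄]; simp only [Function.update_self]; exact hb.symm)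
      (by simp)
    refine ⟨(GHom.gen i f hx').comp g, ?_⟩
    rw [GHom.letters_comp, hg]
    exact congrArg (fun K => K ++ L) hf

/-- A decomposition of the word of a 1-cell comes from a decomposition of the 1-cell. -/
theorem GHom.exists_split {f : GHom (fun i => (T i).toTwoCat) x y} {L M : List (Letter ι)}
    (h : f.letters = L ++ M) : ∃ (z : ∀ i, (T i).toTwoCat.Obj)
      (f₁ : GHom (fun i => (T i).toTwoCat) x z) (f₂ : GHom (fun i => (T i).toTwoCat) z y),
      f = f₁.comp f₂ ∧ f₁.letters = L ∧ f₂.letters = M := by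
  have hp := f.letters_path
  rw [h] at hp
  obtain ⟨p, h₁, h₂⟩ := isPath_append.1 hp
  obtain ⟨z, rfl⟩ := exists_vpos (T := T) (p := p) (fun i => (h₂.le i).trans (vpos_le y i))
  obtain ⟨f₁, hf₁⟩ := GHom.exists_letters h₁
  obtain ⟨f₂, hf₂⟩ := GHom.exists_letters h₂
  refine ⟨z, f₁, f₂, GHom.letters_injective ?_, hf₁, hf₂⟩
  rw [h, GHom.letters_comp, hf₁, hf₂]

end GrayWords

/-! ### Calculus of 2-cells in a Gray tensor product -/

namespace GCell

variable {ι : Type} [LinearOrder ι] {A : ι → TwoCat} {x y z w : ∀ i, (A i).Obj}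

/-- The identity 2-cell of a 1-cell. -/
def idc (f : GHom A x y) : GCell A x y := mk (.id f)

/-- The generating 2-cell given by a 2-cell of a factor. -/
def cellc (i : ι) {a b : (A i).Obj} (α : (A i).Cell a b) (h : Move A i a b x y) : GCell A x y :=
  mk (.cell i α h)

/-- The generating interchange 2-cell. -/
def gam {i j : ι} (hij : i < j) {a b : (A i).Obj} {c d : (A j).Obj}
    (f : (A i).Hom a b) (g : (A j).Hom c d) (fxy : Move A i a b x y) (fzw : Move A i a b z w)
    (gxz : Move A j c d x z) (gyw : Move A j c d y w) : GCell A x w :=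
  mk (.γ hij f g fxy fzw gxz gyw)

open Classical in
/-- Vertical composition, with junk value `α` if the boundaries do not match. -/
noncomputable def vc (α β : GCell A x y) : GCell A x y :=
  if e : tgt α = src β then vcomp α β e else α

theorem vc_eq {α β : GCell A x y} (e : tgt α = src β) : vc α β = vcomp α β e := dif_pos e

theorem vc_mk {f g g' h : GHom A x y} (s : Term A f g) (t : Term A g' h) (e : g = g') :
    vc (mk s) (mk t) = mk (.vcomp s t e) :=
  (vc_eq (α := mk s) (β := mk t) e).trans (vcomp_mk s t e)

@[simp] theorem src_idc (f : GHom A x y) : src (idc f) = f := rfl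
@[simp] theorem tgt_idc (f : GHom A x y) : tgt (idc f) = f := rfl
@[simp] theorem src_cellc (i : ι) {a b : (A i).Obj} (α : (A i).Cell a b) (h : Move A i a b x y) :
    src (cellc i α h) = GHom.gen i ((A i).src α) h := rfl
@[simp] theorem tgt_cellc (i : ι) {a b : (A i).Obj} (α : (A i).Cell a b) (h : Move A i a b x y) :
    tgt (cellc i α h) = GHom.gen i ((A i).tgt α) h := rfl

section
variable {i j : ι} (hij : i < j) {a b : (A i).Obj} {c d : (A j).Obj}
    (f : (A i).Hom a b) (g : (A j).Hom c d) (fxy : Move A i a b x y) (fzw : Move A i a b z w)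
    (gxz : Move A j c d x z) (gyw : Move A j c d y w)
@[simp] theorem src_gam :
    src (gam hij f g fxy fzw gxz gyw) = (GHom.gen j g gxz).comp (GHom.gen i f fzw) := rfl
@[simp] theorem tgt_gam :
    tgt (gam hij f g fxy fzw gxz gyw) = (GHom.gen i f fxy).comp (GHom.gen j g gyw) := rfl
end

@[simp] theorem src_hcomp (α : GCell A x y) (β : GCell A y z) :
    src (hcomp α β) = (src α).comp (src β) := (gray A).src_hcomp α β
@[simp] theorem tgt_hcomp (α : GCell A x y) (β : GCell A y z) :
    tgt (hcomp α β) = (tgt α).comp (tgt β) := (gray A).tgt_hcomp α β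

@[simp] theorem src_vc (α β : GCell A x y) : src (vc α β) = src α := by
  unfold vc
  split_ifs with h
  · exact (gray A).src_vcomp α β h
  · rfl

theorem tgt_vc {α β : GCell A x y} (e : tgt α = src β) : tgt (vc α β) = tgt β := by
  rw [vc_eq e]
  exact (gray A).tgt_vcomp α β e

theorem vc_assoc {α β γ : GCell A x y} (e : tgt α = src β) (e' : tgt β = src γ) :
    vc (vc α β) γ = vc α (vc β γ) := by
  have e₁ := (tgt_vc e).trans e'
  have e₂ := e.trans (src_vc β γ).symm
  rw [vc_eq e₁, vc_eq e₂]
  rw [vc_eq e] at e₁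
  rw [vc_eq e'] at e₂
  simp only [vc_eq e, vc_eq e']
  exact (gray A).vcomp_assoc α β γ e e₁ e' e₂

theorem id_vc {f : GHom A x y} {α : GCell A x y} (h : f = src α) : vc (idc f) α = α := by
  subst h
  exact (vc_eq (α := idc (src α)) (β := α) rfl).trans ((gray A).id_vcomp α rfl)

theorem vc_id {f : GHom A x y} {α : GCell A x y} (h : tgt α = f) : vc α (idc f) = α := by
  subst h
  exact (vc_eq (α := α) (β := idc (tgt α)) rfl).trans ((gray A).vcomp_id α rfl)

theorem hcomp_assoc (α : GCell A x y) (β : GCell A y z) (γ : GCell A z w) :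
    hcomp (hcomp α β) γ = hcomp α (hcomp β γ) := (gray A).hcomp_assoc α β γ

@[simp] theorem id_hcomp (α : GCell A x y) : hcomp (idc (GHom.id x)) α = α := (gray A).id_hcomp α
@[simp] theorem hcomp_id (α : GCell A x y) : hcomp α (idc (GHom.id y)) = α := (gray A).hcomp_id α

theorem idc_hcomp_idc (f : GHom A x y) (g : GHom A y z) :
    hcomp (idc f) (idc g) = idc (f.comp g) := (gray A).hcomp_id₂ f g

theorem vc_hcomp_vc {α α' : GCell A x y} {β β' : GCell A y z} (e : tgt α = src α')
    (e' : tgt β = src β') :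
    hcomp (vc α α') (vc β β') = vc (hcomp α β) (hcomp α' β') := by
  have e'' : tgt (hcomp α β) = src (hcomp α' β') := by rw [tgt_hcomp, src_hcomp, e, e']
  rw [vc_eq e, vc_eq e', vc_eq e'']
  exact (gray A).interchange α α' β β' e e' e''

theorem idc_hcomp_vc (f : GHom A x y) {β β' : GCell A y z} (e : tgt β = src β') :
    hcomp (idc f) (vc β β') = vc (hcomp (idc f) β) (hcomp (idc f) β') := by
  conv_lhs => rw [← vc_id (α := idc f) (f := f) rfl]
  exact vc_hcomp_vc rfl e

theorem vc_hcomp_idc (f : GHom A y z) {β β' : GCell A x y} (e : tgt β = src β') :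
    hcomp (vc β β') (idc f) = vc (hcomp β (idc f)) (hcomp β' (idc f)) := by
  conv_lhs => rw [← vc_id (α := idc f) (f := f) rfl]
  exact vc_hcomp_vc e rfl

/-- Horizontal composition in terms of whiskering, `α` first. -/
theorem exch {α : GCell A x y} {β : GCell A y z} {f : GHom A x y} {g : GHom A y z}
    (hf : tgt α = f) (hg : g = src β) : vc (hcomp α (idc g)) (hcomp (idc f) β) = hcomp α β := by
  rw [← vc_hcomp_vc (α' := idc f) (β := idc g) hf hg, vc_id hf, id_vc hg]

/-- Horizontal composition in terms of whiskering, `β` first. -/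
theorem exch' {α : GCell A x y} {β : GCell A y z} {f : GHom A x y} {g : GHom A y z}
    (hf : f = src α) (hg : tgt β = g) : vc (hcomp (idc f) β) (hcomp α (idc g)) = hcomp α β := by
  rw [← vc_hcomp_vc (α := idc f) (β' := idc g) hf hg, id_vc hf, vc_id hg]

theorem cellc_id (i : ι) {a b : (A i).Obj} (f : (A i).Hom a b) (h : Move A i a b x y) :
    cellc i ((A i).id₂ f) h = idc (GHom.gen i f h) := sound (.cell_id i f h)

theorem cellc_vcomp (i : ι) {a b : (A i).Obj} (α β : (A i).Cell a b) (e)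
    (h : Move A i a b x y) :
    cellc i ((A i).vcomp α β e) h = vc (cellc i α h) (cellc i β h) :=
  (sound (.cell_vcomp i α β e h (by rw [e]))).trans (vc_mk _ _ _).symm

theorem cellc_hcomp (i : ι) {a b c : (A i).Obj} (α : (A i).Cell a b) (β : (A i).Cell b c)
    (h : Move A i a b x y) (h' : Move A i b c y z) (h'' : Move A i a c x z) :
    cellc i ((A i).hcomp α β) h'' = hcomp (cellc i α h) (cellc i β h') :=
  sound (.cell_hcomp i α β h h' h'')

theorem gam_natural_left {i j : ι} (hij : i < j) {a b : (A i).Obj} {c d : (A j).Obj}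
    (α : (A i).Cell a b) (g : (A j).Hom c d) (fxy : Move A i a b x y) (fzw : Move A i a b z w)
    (gxz : Move A j c d x z) (gyw : Move A j c d y w) :
    vc (gam hij ((A i).src α) g fxy fzw gxz gyw) (hcomp (cellc i α fxy) (idc (.gen j g gyw))) =
      vc (hcomp (idc (.gen j g gxz)) (cellc i α fzw))
        (gam hij ((A i).tgt α) g fxy fzw gxz gyw) :=
  (vc_mk _ _ rfl).trans ((sound (.γ_natural_left hij α g fxy fzw gxz gyw)).trans
    (vc_mk _ _ rfl).symm)

theorem gam_natural_right {i j : ι} (hij : i < j) {a b : (A i).Obj} {c d : (A j).Obj}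
    (f : (A i).Hom a b) (β : (A j).Cell c d) (fxy : Move A i a b x y) (fzw : Move A i a b z w)
    (gxz : Move A j c d x z) (gyw : Move A j c d y w) :
    vc (gam hij f ((A j).src β) fxy fzw gxz gyw) (hcomp (idc (.gen i f fxy)) (cellc j β gyw)) =
      vc (hcomp (cellc j β gxz) (idc (.gen i f fzw)))
        (gam hij f ((A j).tgt β) fxy fzw gxz gyw) :=
  (vc_mk _ _ rfl).trans ((sound (.γ_natural_right hij f β fxy fzw gxz gyw)).trans
    (vc_mk _ _ rfl).symm)

theorem gam_comp_left {y' w' : ∀ i, (A i).Obj} {i j : ι} (hij : i < j) {a b b' : (A i).Obj}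
    {c d : (A j).Obj} (f : (A i).Hom a b) (f' : (A i).Hom b b') (g : (A j).Hom c d)
    (fxy : Move A i a b x y) (fyy' : Move A i b b' y y') (fxy' : Move A i a b' x y')
    (fzw : Move A i a b z w) (fww' : Move A i b b' w w') (fzw' : Move A i a b' z w')
    (gxz : Move A j c d x z) (gyw : Move A j c d y w) (gyw' : Move A j c d y' w') :
    gam hij ((A i).comp₁ f f') g fxy' fzw' gxz gyw' =
      vc (hcomp (gam hij f g fxy fzw gxz gyw) (idc (.gen i f' fww')))
        (hcomp (idc (.gen i f fxy)) (gam hij f' g fyy' fww' gyw gyw')) :=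
  (sound (.γ_comp_left hij f f' g fxy fyy' fxy' fzw fww' fzw' gxz gyw gyw')).trans
    (vc_mk _ _ _).symm

theorem gam_comp_right {z' w' : ∀ i, (A i).Obj} {i j : ι} (hij : i < j) {a b : (A i).Obj}
    {c d d' : (A j).Obj} (f : (A i).Hom a b) (g : (A j).Hom c d) (g' : (A j).Hom d d')
    (fxy : Move A i a b x y) (fzw : Move A i a b z w) (fzw' : Move A i a b z' w')
    (gxz : Move A j c d x z) (gzz' : Move A j d d' z z') (gxz' : Move A j c d' x z')
    (gyw : Move A j c d y w) (gww' : Move A j d d' w w') (gyw' : Move A j c d' y w') :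
    gam hij f ((A j).comp₁ g g') fxy fzw' gxz' gyw' =
      vc (hcomp (idc (.gen j g gxz)) (gam hij f g' fzw fzw' gzz' gww'))
        (hcomp (gam hij f g fxy fzw gxz gyw) (idc (.gen j g' gww'))) :=
  (sound (.γ_comp_right hij f g g' fxy fzw fzw' gxz gzz' gxz' gyw gww' gyw')).trans
    (vc_mk _ _ _).symm

/-- The two ways of reversing the order of three 1-cells of different factors agree. -/
theorem gam_cube {x₀₀₀ x₁₀₀ x₀₁₀ x₁₁₀ x₀₀₁ x₁₀₁ x₀₁₁ x₁₁₁ : ∀ i, (A i).Obj} {i j k : ι}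
    (hij : i < j) (hjk : j < k) (hik : i < k)
    {a a' : (A i).Obj} {b b' : (A j).Obj} {c c' : (A k).Obj}
    (f : (A i).Hom a a') (g : (A j).Hom b b') (h : (A k).Hom c c')
    (f₀₀ : Move A i a a' x₀₀₀ x₁₀₀) (f₁₀ : Move A i a a' x₀₁₀ x₁₁₀)
    (f₀₁ : Move A i a a' x₀₀₁ x₁₀₁) (f₁₁ : Move A i a a' x₀₁₁ x₁₁₁)
    (g₀₀ : Move A j b b' x₀₀₀ x₀₁₀) (g₁₀ : Move A j b b' x₁₀₀ x₁₁₀)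
    (g₀₁ : Move A j b b' x₀₀₁ x₀₁₁) (g₁₁ : Move A j b b' x₁₀₁ x₁₁₁)
    (h₀₀ : Move A k c c' x₀₀₀ x₀₀₁) (h₁₀ : Move A k c c' x₁₀₀ x₁₀₁)
    (h₀₁ : Move A k c c' x₀₁₀ x₀₁₁) (h₁₁ : Move A k c c' x₁₁₀ x₁₁₁) :
    vc (vc (hcomp (gam hjk g h g₀₀ g₀₁ h₀₀ h₀₁) (idc (.gen i f f₁₁)))
          (hcomp (idc (.gen j g g₀₀)) (gam hik f h f₁₀ f₁₁ h₀₁ h₁₁)))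
        (hcomp (gam hij f g f₀₀ f₁₀ g₀₀ g₁₀) (idc (.gen k h h₁₁))) =
      vc (vc (hcomp (idc (.gen k h h₀₀)) (gam hij f g f₀₁ f₁₁ g₀₁ g₁₁))
          (hcomp (gam hik f h f₀₀ f₀₁ h₀₀ h₁₀) (idc (.gen j g g₁₁))))
        (hcomp (idc (.gen i f f₀₀)) (gam hjk g h g₁₀ g₁₁ h₁₀ h₁₁)) := by
  refine Eq.trans ?_ ((sound (.cube hij hjk hik f g h f₀₀ f₁₀ f₀₁ f₁₁ g₀₀ g₁₀ g₀₁ g₁₁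
    h₀₀ h₁₀ h₀₁ h₁₁)).trans ?_)
  · refine Eq.trans ?_ (vc_mk _ _ _)
    exact congrArg (vc · (mk _)) (vc_mk _ _ _)
  · refine Eq.trans (vc_mk _ _ _).symm ?_
    exact congrArg (vc · (mk _)) (vc_mk _ _ _).symm

end GCell

/-! ### Crossing cells -/

section Crossing

variable {ι : Type} [LinearOrder ι] {T : ι → Theta} {x y z w : ∀ i, (T i).toTwoCat.Obj}

open GCell

/-- A *crossing cell*: the canonical 2-cell that pulls an atomic 1-cell of the `i`-th coordinate
in front of a 1-cell moving only coordinates `j > i`, and then changes its edge to `c`.  It is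
the composite of a 2-cell of the `i`-th factor and of interchange 2-cells. -/
inductive Cross (i : ι) {a b : (T i).toTwoCat.Obj} (c : (T i).toTwoCat.Hom a b) :
    ∀ {x y : ∀ i, (T i).toTwoCat.Obj}, GCell (fun i => (T i).toTwoCat) x y → Prop
  | base {x y : ∀ i, (T i).toTwoCat.Obj} (s : (T i).toTwoCat.Cell a b) (hs : (T i).toTwoCat.tgt s = c)
      (h : Move (fun i => (T i).toTwoCat) i a b x y) : Cross i c (cellc i s h)
  | step {x x₁ z z₁ y : ∀ i, (T i).toTwoCat.Obj} {j : ι} (hij : i < j) {d e : (T j).toTwoCat.Obj} (hde : IsStep d e)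
      (g : (T j).toTwoCat.Hom d e)
      (cx : Move (fun i => (T i).toTwoCat) i a b x z)
      (cx₁ : Move (fun i => (T i).toTwoCat) i a b x₁ z₁)
      (gx : Move (fun i => (T i).toTwoCat) j d e x x₁)
      (gz : Move (fun i => (T i).toTwoCat) j d e z z₁)
      (f' : GHom (fun i => (T i).toTwoCat) z₁ y) (X : GCell (fun i => (T i).toTwoCat) x₁ y)
      (hX : Cross i c X) (ht : tgt X = (GHom.gen i c cx₁).comp f') :
      Cross i c (vc (hcomp (idc (.gen j g gx)) X)
        (hcomp (gam hij c g cx cx₁ gx gz) (idc f')))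

theorem exists_square {i j : ι} (hij : i ≠ j) {a b : (T i).toTwoCat.Obj}
    {d e : (T j).toTwoCat.Obj} (g : Move (fun i => (T i).toTwoCat) j d e x y)
    (c : Move (fun i => (T i).toTwoCat) i a b y z) :
    ∃ w, Move (fun i => (T i).toTwoCat) i a b x w ∧ Move (fun i => (T i).toTwoCat) j d e w z := by
  refine ⟨Function.update x i b, ⟨(g.2.2 i hij).trans c.1, by simp, fun k hk => by simp [hk]⟩,
    ⟨?_, ?_, fun k hk => ?_⟩⟩
  · rw [Function.update_of_ne hij.symm]; exact g.1
  · rw [← c.2.2 j hij.symm]; exact g.2.1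
  · by_cases hki : k = i
    · subst hki; simp [c.2.1]
    · rw [Function.update_of_ne hki, g.2.2 k hk, c.2.2 k hki]

variable {i : ι} {a b : (T i).toTwoCat.Obj} {c : (T i).toTwoCat.Hom a b}
  {X : GCell (fun i => (T i).toTwoCat) x y}

/-- The shape of the boundary of a crossing cell. -/
theorem Cross.spec (hX : Cross i c X) (hab : IsStep a b) :
    ∃ (z : _) (h : Move (fun i => (T i).toTwoCat) i a b x z) (f' : GHom _ z y) (v : ℕ),
      tgt X = (GHom.gen i c h).comp f' ∧ (src X).letters = f'.letters ++ [(i, Theta.pos a, v)] ∧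
      ∀ l ∈ f'.letters, i < l.1 := by
  induction hX with
  | base s hs h =>
    refine ⟨_, h, GHom.id _, _, ?_, letters_gen_of_step hab _ h, by simp⟩
    rw [tgt_cellc, GHom.comp_id, hs]
  | step hij hde g cx cx₁ gx gz f' X hX ht ih =>
    obtain ⟨z', h', f'', v, h₁, h₂, h₃⟩ := ih
    obtain rfl := h'.target_eq cx₁
    have : f'' = f' := by
      rw [h₁] at ht
      have := congrArg GHom.letters ht
      simp only [GHom.letters_comp, List.append_cancel_left_eq] at this
      exact GHom.letters_injective this
    subst this
    refine ⟨_, cx, (GHom.gen (A := fun i => (T i).toTwoCat) _ g gz).comp f'', v, ?_, ?_, ?_⟩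
    · rw [tgt_vc (by simp [h₁, GHom.assoc]), tgt_hcomp, tgt_gam, GHom.assoc]; rfl
    · rw [src_vc, src_hcomp, src_idc, GHom.letters_comp, GHom.letters_comp, h₂,
        letters_gen_of_step hde, letters_gen_of_step hde]
      rfl
    · intro l hl
      rw [GHom.letters_comp, letters_gen_of_step hde] at hl
      rcases List.mem_append.1 hl with hl | hl
      · rw [List.mem_singleton] at hl
        subst hl
        exact hij
      · exact h₃ l hl

theorem comp_left_cancel {f : GHom (fun i => (T i).toTwoCat) x y}
    {g g' : GHom (fun i => (T i).toTwoCat) y z} (h : f.comp g = f.comp g') : g = g' := by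
  have := congrArg GHom.letters h
  simp only [GHom.letters_comp, List.append_cancel_left_eq] at this
  exact GHom.letters_injective this

/-- A 1-cell whose word begins with the word of `g` is a composite beginning with `g`. -/
theorem GHom.factor_left {f : GHom (fun i => (T i).toTwoCat) x y}
    {g : GHom (fun i => (T i).toTwoCat) x z} {M : List (Letter ι)}
    (h : f.letters = g.letters ++ M) :
    ∃ k : GHom (fun i => (T i).toTwoCat) z y, f = g.comp k ∧ k.letters = M := by
  have hp := f.letters_path
  rw [h] at hp
  obtain ⟨k, hk⟩ := GHom.exists_letters (g.letters_path.of_append_left hp)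
  exact ⟨k, GHom.letters_injective (by rw [h, GHom.letters_comp, hk]), hk⟩

/-- Two composites beginning with atomic 1-cells agree only if their factors agree. -/
theorem step_comp_cancel {x' x'' : ∀ i, (T i).toTwoCat.Obj} {i i' : ι}
    {a b : (T i).toTwoCat.Obj} {a' b' : (T i').toTwoCat.Obj} (hab : IsStep a b)
    (hab' : IsStep a' b') {f : (T i).toTwoCat.Hom a b} {f' : (T i').toTwoCat.Hom a' b'}
    {h : Move (fun i => (T i).toTwoCat) i a b x x'}
    {h' : Move (fun i => (T i).toTwoCat) i' a' b' x x''}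
    {g : GHom (fun i => (T i).toTwoCat) x' y} {g' : GHom (fun i => (T i).toTwoCat) x'' y}
    (e : (GHom.gen i f h).comp g = (GHom.gen i' f' h').comp g') :
    i = i' ∧ HEq a a' ∧ HEq b b' ∧ HEq f f' ∧ x' = x'' ∧ HEq g g' := by
  have e₁ := congrArg GHom.letters e
  rw [GHom.letters_comp, GHom.letters_comp, letters_gen_of_step hab,
    letters_gen_of_step hab'] at e₁
  simp only [List.cons_append, List.nil_append, List.cons.injEq] at e₁
  obtain ⟨rfl, ha, hb, hf, rfl⟩ := gen_step_ext hab hab' h h' (by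
    rw [letters_gen_of_step hab, letters_gen_of_step hab', e₁.1])
  obtain rfl := eq_of_heq ha
  obtain rfl := eq_of_heq hb
  obtain rfl := eq_of_heq hf
  exact ⟨rfl, HEq.rfl, HEq.rfl, HEq.rfl, rfl, heq_of_eq (comp_left_cancel e)⟩

/-- A crossing cell is determined by its source. -/
theorem Cross.unique (hab : IsStep a b) (hX : Cross i c X)
    {X' : GCell (fun i => (T i).toTwoCat) x y} (hX' : Cross i c X') (h : src X = src X') :
    X = X' := by
  induction hX with
  | base s hs hm =>
    revert h
    cases hX' with
    | base s' hs' hm' =>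
      intro h
      have h1 : (T i).toTwoCat.src s = (T i).toTwoCat.src s' :=
        Theta.Hom.word_injective i (congrArg GHom.letters h)
      have : s = s' := Subtype.ext (Prod.ext h1 (hs.trans hs'.symm))
      rw [this]
    | step hij hde g cx cx₁ gx gz f' X hX ht =>
      intro h
      have := congrArg GHom.letters h
      simp only [src_cellc, src_vc, src_hcomp, src_idc, GHom.letters_comp] at this
      rw [letters_gen_of_step hab, letters_gen_of_step hde] at this
      simp only [List.cons_append, List.cons.injEq, Prod.mk.injEq] at this
      exact absurd this.1.1 hij.ne
  | step hij hde g cx cx₁ gx gz f' X hX ht ih =>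
    revert h
    cases hX' with
    | base s' hs' hm' =>
      intro h
      have := congrArg GHom.letters h
      simp only [src_cellc, src_vc, src_hcomp, src_idc, GHom.letters_comp] at this
      rw [letters_gen_of_step hab, letters_gen_of_step hde] at this
      simp only [List.cons_append, List.cons.injEq, Prod.mk.injEq] at this
      exact absurd this.1.1 hij.ne'
    | step hij' hde' g' cx' cx₁' gx' gz' f'' X' hX' ht' =>
      intro h
      simp only [src_vc, src_hcomp, src_idc] at h
      obtain ⟨rfl, h₁, h₂, h₃, rfl, h₄⟩ := step_comp_cancel hde hde' h
      obtain rfl := eq_of_heq h₁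
      obtain rfl := eq_of_heq h₂
      obtain rfl := eq_of_heq h₃
      obtain rfl := ih hX' (eq_of_heq h₄)
      obtain rfl := cx.target_eq cx'
      obtain rfl := cx₁.target_eq cx₁'
      rw [ht] at ht'
      rw [comp_left_cancel ht']

/-- Existence of crossing cells. -/
theorem Cross.exists {s : (T i).toTwoCat.Cell a b} (hs : (T i).toTwoCat.tgt s = c)
    (hab : IsStep a b) (h : Move (fun i => (T i).toTwoCat) i a b y z)
    (f : GHom (fun i => (T i).toTwoCat) x y) (hf : ∀ l ∈ f.letters, i < l.1) :
    ∃ X : GCell (fun i => (T i).toTwoCat) x z, Cross i c X ∧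
      src X = f.comp (GHom.gen i ((T i).toTwoCat.src s) h) := by
  induction f using GHom.ind with
  | id => exact ⟨_, .base s hs h, by simp [GHom.id_comp]⟩
  | @cons x x₁ j d e hde g gx f' ih =>
    rw [GHom.letters_comp, letters_gen_of_step hde] at hf
    obtain ⟨X, hX, hsrc⟩ := ih (fun l hl => hf l (by simp [hl]))
    have hij : i < j := hf (j, Theta.pos d, Theta.Hom.valN g (Theta.pos d)) (by simp)
    obtain ⟨z₁, cx₁, f'', v, h₁, -, -⟩ := hX.spec hab
    obtain ⟨z', cx, gz⟩ := exists_square hij.ne gx cx₁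
    refine ⟨_, .step hij hde g cx cx₁ gx gz f'' X hX h₁, ?_⟩
    rw [src_vc, src_hcomp, src_idc, hsrc, GHom.assoc]

end Crossing

/-! ### Pasting identities -/

namespace GCell

variable {ι : Type} [LinearOrder ι] {A : ι → TwoCat} {x y z w xm zm x₂ : ∀ i, (A i).Obj}

/-- Pasting of two naturality squares, for a 2-cell on the first 1-cell. -/
theorem paste_natural {g₀ g : GHom A x xm} {c₁ : GHom A xm zm} {f : GHom A zm y} {c : GHom A x z}
    {g₀' : GHom A z zm} {σ : GCell A x xm} {X : GCell A xm y} {Γ Γ₀ : GCell A x zm}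
    {σ' : GCell A z zm} {p : GHom A xm y} (hσ : src σ = g₀) (hσ' : tgt σ = g)
    (hp : src X = p) (hX : tgt X = c₁.comp f)
    (hΓ : src Γ = g.comp c₁) (hΓ₀ : src Γ₀ = g₀.comp c₁) (hΓ₀' : tgt Γ₀ = c.comp g₀')
    (hs : src σ' = g₀')
    (nat : vc Γ₀ (hcomp (idc c) σ') = vc (hcomp σ (idc c₁)) Γ) :
    vc (hcomp σ (idc p)) (vc (hcomp (idc g) X) (hcomp Γ (idc f))) =
      vc (vc (hcomp (idc g₀) X) (hcomp Γ₀ (idc f))) (hcomp (idc c) (hcomp σ' (idc f))) := by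
  rw [← vc_assoc (by simp [*]) (by simp [*, GHom.assoc]), exch hσ' hp.symm, ← exch' hσ.symm hX,
    vc_assoc (by simp [*]) (by simp [*, GHom.assoc]),
    vc_assoc (by simp [*, GHom.assoc]) (by simp [*, GHom.assoc]),
    ← idc_hcomp_idc, ← hcomp_assoc, ← hcomp_assoc, ← vc_hcomp_idc _ (by simp [*]),
    ← vc_hcomp_idc _ (by simp [*]), nat]

/-- Pasting of a naturality square for `X`, for a 2-cell `σ` that does not involve the first
1-cell `g`. -/
theorem paste_step {g : GHom A x xm} {c₁ : GHom A xm zm} {f : GHom A zm y} {c : GHom A x z}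
    {g' : GHom A z zm} {σ X X' : GCell A xm y} {Γ : GCell A x zm} {n : GCell A zm y}
    (hσ : tgt σ = src X) (hX : tgt X = c₁.comp f) (hX' : tgt X' = c₁.comp (src n))
    (hn : tgt n = f) (hΓ : src Γ = g.comp c₁) (hΓ' : tgt Γ = c.comp g')
    (nat : vc σ X = vc X' (hcomp (idc c₁) n)) :
    vc (hcomp (idc g) σ) (vc (hcomp (idc g) X) (hcomp Γ (idc f))) =
      vc (vc (hcomp (idc g) X') (hcomp Γ (idc (src n)))) (hcomp (idc c) (hcomp (idc g') n)) := by
  rw [← vc_assoc (by simp [*]) (by simp [*, GHom.assoc]), ← idc_hcomp_vc _ hσ, nat,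
    idc_hcomp_vc _ (by simp [*]), ← hcomp_assoc, idc_hcomp_idc,
    vc_assoc (by simp [*, GHom.assoc]) (by simp [*, GHom.assoc]), exch' hΓ.symm hn,
    vc_assoc (by simp [*, GHom.assoc]) (by simp [*, GHom.assoc]), ← hcomp_assoc, idc_hcomp_idc,
    exch hΓ' rfl]

/-- Pasting of a cube, for a 2-cell `S` on the first two 1-cells: an interchange of the first two
1-cells to be crossed becomes the same interchange after the crossing. -/
theorem paste_cube {xn z' w' zn zn₂ : ∀ i, (A i).Obj} {p : GHom A x xm} {q : GHom A xm xn}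
    {q₁ : GHom A x z'} {p₁ : GHom A z' xn} {c₂ : GHom A xn zn₂} {f : GHom A zn₂ y}
    {c₁ : GHom A xm zn} {q' : GHom A zn zn₂} {c : GHom A x z}
    {c' : GHom A z' w'} {p₁' : GHom A w' zn₂} {q₁' : GHom A z w'}
    {S : GCell A x xn} {X : GCell A xn y} {Γq : GCell A xm zn₂} {Γp : GCell A x zn}
    {Γp₁ : GCell A z' zn₂} {Γq₁ : GCell A x w'} {S' : GCell A z zn₂} {r : GHom A xn y}
    (hr : src X = r)
    (hS : src S = q₁.comp p₁) (hS' : tgt S = p.comp q) (hX : tgt X = c₂.comp f)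
    (hq : src Γq = q.comp c₂) (hq' : tgt Γq = c₁.comp q')
    (hp : src Γp = p.comp c₁)
    (hp₁ : src Γp₁ = p₁.comp c₂) (hp₁' : tgt Γp₁ = c'.comp p₁')
    (hq₁ : src Γq₁ = q₁.comp c') (hq₁' : tgt Γq₁ = c.comp q₁')
    (hT : src S' = q₁'.comp p₁')
    (cube : vc (vc (hcomp S (idc c₂)) (hcomp (idc p) Γq)) (hcomp Γp (idc q')) =
      vc (vc (hcomp (idc q₁) Γp₁) (hcomp Γq₁ (idc p₁'))) (hcomp (idc c) S')) :
    vc (hcomp S (idc r))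
        (vc (hcomp (idc p) (vc (hcomp (idc q) X) (hcomp Γq (idc f))))
          (hcomp Γp (idc (q'.comp f)))) =
      vc (vc (hcomp (idc q₁) (vc (hcomp (idc p₁) X) (hcomp Γp₁ (idc f))))
          (hcomp Γq₁ (idc (p₁'.comp f)))) (hcomp (idc c) (hcomp S' (idc f))) := by
  have h₁ : vc (hcomp S (idc r)) (hcomp (idc p) (hcomp (idc q) X)) =
      vc (hcomp (idc q₁) (hcomp (idc p₁) X)) (hcomp (hcomp S (idc c₂)) (idc f)) := by
    rw [← hcomp_assoc, idc_hcomp_idc, exch hS' hr.symm, ← hcomp_assoc, idc_hcomp_idc, hcomp_assoc,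
      idc_hcomp_idc, exch' hS.symm hX]
  rw [idc_hcomp_vc _ (by simp [*, GHom.assoc]), idc_hcomp_vc _ (by simp [*, GHom.assoc]),
    ← vc_assoc (by simp [*, GHom.assoc])
      (by rw [tgt_vc (by simp [*, GHom.assoc])]; simp [*, GHom.assoc]),
    ← vc_assoc (by simp [*, GHom.assoc]) (by simp [*, GHom.assoc]), h₁,
    vc_assoc (by rw [tgt_vc (by simp [*, GHom.assoc])]; simp [*, GHom.assoc])
      (by simp [*, GHom.assoc]),
    vc_assoc (by simp [*, GHom.assoc]) (by simp [*, GHom.assoc]),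
    vc_assoc (by rw [tgt_vc (by simp [*, GHom.assoc])]; simp [*, GHom.assoc])
      (by simp [*, GHom.assoc]),
    vc_assoc (by simp [*, GHom.assoc]) (by simp [*, GHom.assoc])]
  congr 1
  rw [vc_assoc (by simp [*, GHom.assoc]) (by simp [*, GHom.assoc]),
    vc_assoc (by simp [*, GHom.assoc]) (by simp [*, GHom.assoc])] at cube
  rw [← idc_hcomp_idc, ← idc_hcomp_idc, ← hcomp_assoc, ← hcomp_assoc, ← hcomp_assoc,
    ← hcomp_assoc, ← hcomp_assoc,
    ← vc_hcomp_idc _ (by simp [*, GHom.assoc]), ← vc_hcomp_idc _ (by simp [*, GHom.assoc]),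
    ← vc_hcomp_idc _ (by simp [*, GHom.assoc]), ← vc_hcomp_idc _ (by simp [*, GHom.assoc]),
    cube]

/-- Prolonging a pasting by a 1-cell `q` at its end, which commutes with the first crossing. -/
theorem paste_extend {y' : ∀ i, (A i).Obj} {g : GHom A x xm} {c₁ : GHom A xm zm} {f : GHom A zm y}
    {σ : GCell A xm y'} {X : GCell A xm y} {Γ : GCell A x zm} {q : GHom A y y'}
    (hσ : tgt σ = (src X).comp q) (hX : tgt X = c₁.comp f) (hΓ : src Γ = g.comp c₁) :
    vc (hcomp (idc g) σ) (hcomp (vc (hcomp (idc g) X) (hcomp Γ (idc f))) (idc q)) =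
      vc (hcomp (idc g) (vc σ (hcomp X (idc q)))) (hcomp Γ (idc (f.comp q))) := by
  rw [vc_hcomp_idc _ (by simp [*, GHom.assoc]), ← vc_assoc (by simp [*, GHom.assoc])
    (by simp [*, GHom.assoc]), idc_hcomp_vc _ (by simp [*]), hcomp_assoc, hcomp_assoc,
    idc_hcomp_idc]

/-! The next three identities let a 2-cell be absorbed by a composite `(X ▷ f₂); (c ◁ β)`. -/

theorem absorb_right {c : GHom A x z} {f : GHom A z x₂} {X : GCell A x x₂} {τ : GCell A x₂ y}
    {β : GCell A z y} (hX : tgt X = c.comp f) (hβ : src β = f.comp (tgt τ)) :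
    vc (hcomp (idc (src X)) τ) (vc (hcomp X (idc (tgt τ))) (hcomp (idc c) β)) =
      vc (hcomp X (idc (src τ))) (hcomp (idc c) (vc (hcomp (idc f) τ) β)) := by
  rw [← vc_assoc (by simp) (by simp [*, GHom.assoc]), exch' rfl rfl, idc_hcomp_vc _ (by simp [*]),
    ← hcomp_assoc, idc_hcomp_idc, ← vc_assoc (by simp [*]) (by simp [*, GHom.assoc]), exch hX rfl]

theorem absorb_middle {c : GHom A x z} {f : GHom A z x₂} {σ X X' : GCell A x x₂}
    {n : GCell A z x₂} {f₂ : GHom A x₂ y} {β : GCell A z y} (hσ : tgt σ = src X)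
    (hX : tgt X = c.comp f) (hX' : tgt X' = c.comp (src n)) (hn : tgt n = f)
    (hβ : src β = f.comp f₂) (nat : vc σ X = vc X' (hcomp (idc c) n)) :
    vc (hcomp σ (idc f₂)) (vc (hcomp X (idc f₂)) (hcomp (idc c) β)) =
      vc (hcomp X' (idc f₂)) (hcomp (idc c) (vc (hcomp n (idc f₂)) β)) := by
  rw [← vc_assoc (by simp [*]) (by simp [*, GHom.assoc]), ← vc_hcomp_idc _ hσ, nat,
    vc_hcomp_idc _ (by simp [*]), idc_hcomp_vc _ (by simp [*]), hcomp_assoc,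
    vc_assoc (by simp [*, GHom.assoc]) (by simp [*])]

theorem absorb_left {y' : ∀ i, (A i).Obj} {c : GHom A x z} {σ : GCell A x y'} {X : GCell A x x₂}
    {q : GHom A x₂ y'} {r : GHom A y' y} {f : GHom A z x₂} {β : GCell A z y}
    (hσ : tgt σ = (src X).comp q) (hX : tgt X = c.comp f) (hβ : src β = f.comp (q.comp r)) :
    vc (hcomp σ (idc r)) (vc (hcomp X (idc (q.comp r))) (hcomp (idc c) β)) =
      vc (hcomp (vc σ (hcomp X (idc q))) (idc r)) (hcomp (idc c) β) := by
  rw [← vc_assoc (by simp [*, GHom.assoc]) (by simp [*, GHom.assoc]), ← idc_hcomp_idc,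
    ← hcomp_assoc, vc_hcomp_idc _ (by simp [*])]

end GCell

/-! ### Uniqueness of 2-cells in a Gray tensor product of free 2-categories -/

section Thin

variable {ι : Type} [LinearOrder ι] {T : ι → Theta} {x y z w : ∀ i, (T i).toTwoCat.Obj}

open GCell

/-- An atomic 2-cell: a 2-cell between edges of one factor, or the interchange of two edges. -/
inductive AtomCell : ∀ {x y : ∀ i, (T i).toTwoCat.Obj},
    GCell (fun i => (T i).toTwoCat) x y → Prop
  | cell {x y : ∀ i, (T i).toTwoCat.Obj} (i : ι) {a b : (T i).toTwoCat.Obj} (hab : IsStep a b)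
      (s : (T i).toTwoCat.Cell a b) (h : Move (fun i => (T i).toTwoCat) i a b x y) :
      AtomCell (cellc i s h)
  | gam {x y z w : ∀ i, (T i).toTwoCat.Obj} {i j : ι} (hij : i < j) {a b : (T i).toTwoCat.Obj}
      (hab : IsStep a b) {c d : (T j).toTwoCat.Obj} (hcd : IsStep c d)
      (f : (T i).toTwoCat.Hom a b) (g : (T j).toTwoCat.Hom c d)
      (fxy : Move (fun i => (T i).toTwoCat) i a b x y)
      (fzw : Move (fun i => (T i).toTwoCat) i a b z w)
      (gxz : Move (fun i => (T i).toTwoCat) j c d x z)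
      (gyw : Move (fun i => (T i).toTwoCat) j c d y w) :
      AtomCell (gam hij f g fxy fzw gxz gyw)

theorem AtomCell.letters_ne_nil {s : GCell (fun i => (T i).toTwoCat) x y} (hs : AtomCell s) :
    (tgt s).letters ≠ [] := by
  cases hs with
  | cell i hab s h => rw [tgt_cellc, letters_gen_of_step hab]; simp
  | gam hij hab hcd f g fxy fzw gxz gyw =>
    rw [tgt_gam, GHom.letters_comp, letters_gen_of_step hab]; simp

theorem GHom.eq_of_nil {f : GHom (fun i => (T i).toTwoCat) x y} (h : f.letters = []) : x = y := by
  have := f.letters_path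
  rw [h] at this
  exact vpos_injective this

variable {i : ι} {a b : (T i).toTwoCat.Obj} {c : (T i).toTwoCat.Hom a b}

/-- Naturality of crossing cells with respect to 2-cells in their source. -/
theorem Cross.absorb (hab : IsStep a b) {X : GCell (fun i => (T i).toTwoCat) x y}
    (hX : Cross i c X) {x₁ y₁ : ∀ i, (T i).toTwoCat.Obj}
    {s : GCell (fun i => (T i).toTwoCat) x₁ y₁} (hs : AtomCell s)
    (l : GHom (fun i => (T i).toTwoCat) x x₁) (r : GHom (fun i => (T i).toTwoCat) y₁ y)
    (hsrc : src X = l.comp ((tgt s).comp r))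
    (h : Move (fun i => (T i).toTwoCat) i a b x z) (f' : GHom (fun i => (T i).toTwoCat) z y)
    (ht : tgt X = (GHom.gen i c h).comp f') :
    ∃ (X' : GCell (fun i => (T i).toTwoCat) x y) (n : GCell (fun i => (T i).toTwoCat) z y),
      Cross i c X' ∧ tgt X' = (GHom.gen i c h).comp (src n) ∧ tgt n = f' ∧
      vc (hcomp (idc l) (hcomp s (idc r))) X = vc X' (hcomp (idc (GHom.gen i c h)) n) := by
  induction hX generalizing z x₁ y₁ with
  | @base x y s₀ hs₀ h₀ =>
    -- Nothing is crossed, so `s` ends at the moving edge, and it is composed with `s₀`.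
    have e := congrArg GHom.letters hsrc
    simp only [GHom.letters_comp, src_cellc] at e
    rw [letters_gen_of_step hab] at e
    have hl : l.letters = [] := by
      rcases hll : l.letters with _ | ⟨p, L⟩
      · rfl
      · rw [hll] at e
        have := hs.letters_ne_nil
        simp at e
        exact absurd e.2.2.1 this
    obtain rfl := GHom.eq_of_nil hl
    obtain rfl := GHom.eq_of_letters_nil hl
    cases hs with
    | gam hij hab hcd f g fxy fzw gxz gyw =>
      simp only [GHom.letters_id, tgt_gam, GHom.letters_comp] at e
      rw [letters_gen_of_step hab, letters_gen_of_step hcd] at e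
      simp at e
    | cell i' hab' s₁ h₁ =>
      rw [tgt_cellc, letters_gen_of_step hab'] at e
      have hr : r.letters = [] := by
        have := congrArg List.length e
        simpa using this
      obtain rfl := GHom.eq_of_nil hr
      obtain rfl := GHom.eq_of_letters_nil hr
      simp only [src_cellc, tgt_cellc, GHom.comp_id, GHom.id_comp] at hsrc
      obtain ⟨rfl, ha, hb, hf, -⟩ := gen_step_ext hab hab' h₀ h₁ (congrArg GHom.letters hsrc)
      obtain rfl := eq_of_heq ha
      obtain rfl := eq_of_heq hb
      have hf := eq_of_heq hf
      obtain rfl := h.target_eq h₀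
      have hf' : f' = GHom.id _ := by
        rw [tgt_cellc, hs₀] at ht
        refine GHom.eq_of_letters_nil ?_
        have := congrArg GHom.letters ht
        simpa using this
      subst hf'
      refine ⟨cellc i ((T i).toTwoCat.vcomp s₁ s₀ hf.symm) h, idc (GHom.id _), .base _ ?_ _, ?_,
        rfl, ?_⟩
      · rw [← hs₀]; rfl
      · rw [tgt_cellc, src_idc, GHom.comp_id, ← hs₀]; rfl
      · rw [id_hcomp, hcomp_id, hcomp_id, vc_id]
        · exact (cellc_vcomp i s₁ s₀ hf.symm h).symm
        · rw [tgt_cellc, ← hs₀]; rfl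
  | @step x xm zm zn y j hij d e hde g cx cx₁ gx gz f₁' X₁ hX₁ ht₁ ih =>
    obtain rfl := h.target_eq cx
    simp only [src_vc, src_hcomp, src_idc] at hsrc
    have hf' : f' = (GHom.gen (A := fun i => (T i).toTwoCat) _ g gz).comp f₁' := by
      rw [tgt_vc (by simp [ht₁, GHom.assoc]), tgt_hcomp, tgt_gam, tgt_idc, GHom.assoc] at ht
      exact (comp_left_cancel ht).symm
    subst hf'
    rcases hll : l.letters with _ | ⟨p, L⟩
    · obtain rfl := GHom.eq_of_nil hll
      obtain rfl := GHom.eq_of_letters_nil hll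
      rw [GHom.id_comp] at hsrc
      cases hs with
      | cell i' hab' s₁ h₁ =>
        -- `s` ends at the first edge that is crossed: naturality of the interchange.
        rw [tgt_cellc] at hsrc
        obtain ⟨rfl, ha, hb, hf, rfl, hr⟩ := step_comp_cancel hde hab' hsrc
        obtain rfl := eq_of_heq ha
        obtain rfl := eq_of_heq hb
        obtain rfl := eq_of_heq hf
        obtain rfl := eq_of_heq hr
        refine ⟨vc (hcomp (idc (.gen j ((T j).toTwoCat.src s₁) gx)) X₁)
            (hcomp (gam hij c ((T j).toTwoCat.src s₁) cx cx₁ gx gz) (idc f₁')),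
          hcomp (cellc j s₁ gz) (idc f₁'),
          .step hij hde _ cx cx₁ gx gz f₁' X₁ hX₁ ht₁, ?_, ?_, ?_⟩
        · rw [tgt_vc (by simp [ht₁, GHom.assoc])]
          simp [GHom.assoc]
        · simp
        · rw [id_hcomp]
          exact paste_natural (σ := cellc j s₁ gx) rfl rfl rfl ht₁ rfl rfl rfl rfl
            (gam_natural_right hij c s₁ cx cx₁ gx gz)
      | gam hpq hp hq f₂ g₂ fxy fzw gxz gyw =>
        -- `s` interchanges the first two edges that are crossed: the cube relation.
        rw [tgt_gam, GHom.assoc] at hsrc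
        obtain ⟨rfl, ha, hb, hf, rfl, hr⟩ := step_comp_cancel hde hp hsrc
        obtain rfl := eq_of_heq ha
        obtain rfl := eq_of_heq hb
        obtain rfl := eq_of_heq hf
        have hr := eq_of_heq hr
        cases hX₁ with
        | base s₃ hs₃ h₃ =>
          have e := congrArg GHom.letters hr
          rw [src_cellc, GHom.letters_comp, letters_gen_of_step hab, letters_gen_of_step hq] at e
          simp only [List.cons_append, List.nil_append, List.cons.injEq, Prod.mk.injEq] at e
          obtain ⟨⟨rfl, -⟩, -⟩ := e
          exact absurd (hij.trans hpq) (lt_irrefl _)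
        | @step _ xn z2 zn2 _ k hik d' e' hde' g' cx' cx₁' gx' gz' f₂' X₂ hX₂ ht₂ =>
          simp only [src_vc, src_hcomp, src_idc] at hr
          obtain ⟨rfl, ha, hb, hf, rfl, hr₂⟩ := step_comp_cancel hde' hq hr
          obtain rfl := eq_of_heq ha
          obtain rfl := eq_of_heq hb
          obtain rfl := eq_of_heq hf
          obtain rfl := eq_of_heq hr₂
          obtain rfl := cx'.target_eq cx₁
          have hf₁ : f₁' = (GHom.gen (A := fun i => (T i).toTwoCat) _ g' gz').comp f₂' := by
            rw [tgt_vc (by simp [ht₂, GHom.assoc]), tgt_hcomp, tgt_gam, tgt_idc, GHom.assoc] at ht₁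
            exact (comp_left_cancel ht₁).symm
          subst hf₁
          obtain ⟨w', cz, gw⟩ := exists_square hij.ne fzw cx₁'
          obtain ⟨z'', cx'', gw'⟩ := exists_square hik.ne gxz cz
          obtain rfl := h.target_eq cx''
          have hcube := gam_cube hij hpq hik c g g' h cx' cz cx₁' gx gz fzw gw gxz gw' gx' gz'
          refine ⟨_, hcomp (gam hpq g g' gz gw gw' gz') (idc f₂'),
            .step hik hde' g' h cz gxz gw'
              ((GHom.gen (A := fun i => (T i).toTwoCat) j g gw).comp f₂') _ (.step hij hde g cz cx₁' fzw gw f₂' X₂ hX₂ ht₂) ?_,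
            ?_, ?_, ?_⟩
          · rw [tgt_vc (by simp [ht₂, GHom.assoc])]
            simp [GHom.assoc]
          · rw [tgt_vc]
            · simp [GHom.assoc]
            · rw [tgt_hcomp, tgt_vc (by simp [ht₂, GHom.assoc])]
              simp [GHom.assoc]
          · simp [GHom.assoc]
          · rw [id_hcomp]
            exact paste_cube rfl (src_gam ..) (tgt_gam ..) ht₂ (src_gam ..) (tgt_gam ..)
              (src_gam ..) (src_gam ..) (tgt_gam ..) (src_gam ..) (tgt_gam ..) (src_gam ..) hcube
    -- `s` does not involve the first edge that is crossed: induction.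
    · have e := congrArg GHom.letters hsrc
      rw [GHom.letters_comp, GHom.letters_comp, hll] at e
      have hl : l.letters = (GHom.gen j g gx).letters ++ L := by
        rw [letters_gen_of_step hde] at e ⊢
        simp only [List.cons_append, List.cons.injEq] at e
        rw [hll, e.1]
        rfl
      obtain ⟨l', rfl, -⟩ := GHom.factor_left hl
      rw [GHom.assoc] at hsrc
      have hsrc := comp_left_cancel hsrc
      obtain ⟨X', n, hX', h₁, h₂, h₃⟩ := ih hs l' r hsrc cx₁ f₁' ht₁
      refine ⟨_, hcomp (idc (GHom.gen (A := fun i => (T i).toTwoCat) j g gz)) n,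
        .step hij hde g h cx₁ gx gz (src n) X' hX' h₁, ?_, ?_, ?_⟩
      · rw [tgt_vc (by simp [h₁, GHom.assoc])]
        simp [GHom.assoc]
      · simp [h₂]
      · rw [← idc_hcomp_idc, hcomp_assoc]
        exact paste_step (by simp [hsrc]) ht₁ h₁ h₂ rfl rfl h₃

/-- A crossing cell preceded by the interchange of its moving edge with one more edge is again a
crossing cell. -/
theorem Cross.extend (hab : IsStep a b) {X : GCell (fun i => (T i).toTwoCat) x y}
    (hX : Cross i c X) {x₀ x₁ y' : ∀ i, (T i).toTwoCat.Obj} {j : ι} (hij : i < j)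
    {d e : (T j).toTwoCat.Obj} (hde : IsStep d e) (c₀ : (T i).toTwoCat.Hom a b)
    (g : (T j).toTwoCat.Hom d e) (l : GHom (fun i => (T i).toTwoCat) x x₀)
    (cx : Move (fun i => (T i).toTwoCat) i a b x₀ y)
    (cx₁ : Move (fun i => (T i).toTwoCat) i a b x₁ y')
    (gx : Move (fun i => (T i).toTwoCat) j d e x₀ x₁)
    (gy : Move (fun i => (T i).toTwoCat) j d e y y')
    (hsrc : src X = l.comp (GHom.gen i c₀ cx)) :
    Cross i c (vc (hcomp (idc l) (gam hij c₀ g cx cx₁ gx gy)) (hcomp X (idc (GHom.gen j g gy)))) := by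
  induction hX generalizing x₀ x₁ y' with
  | @base x y s hs h =>
    have hl : l.letters = [] := by
      have e := congrArg GHom.letters hsrc
      rw [src_cellc, GHom.letters_comp, letters_gen_of_step hab, letters_gen_of_step hab] at e
      have := congrArg List.length e
      simpa using this
    obtain rfl := GHom.eq_of_nil hl
    obtain rfl := GHom.eq_of_letters_nil hl
    rw [GHom.id_comp, src_cellc] at hsrc
    have hc₀ : (T i).toTwoCat.src s = c₀ :=
      Theta.Hom.word_injective i (congrArg GHom.letters hsrc)
    subst hc₀
    have nat := gam_natural_left hij s g cx cx₁ gx gy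
    rw [id_hcomp, nat]
    have hst := Cross.step (c := c) hij hde g cx cx₁ gx gy (GHom.id _) (cellc i s cx₁)
      (.base s hs cx₁) (by rw [tgt_cellc, GHom.comp_id, hs])
    rw [hcomp_id] at hst
    rw [hs]
    exact hst
  | @step x xm zm zn y k hik d' e' hde' g' cx' cx₁' gx' gz' f' X₁ hX₁ ht₁ ih =>
    simp only [src_vc, src_hcomp, src_idc] at hsrc
    obtain ⟨L, hL⟩ : ∃ L, l.letters = (GHom.gen k g' gx').letters ++ L := by
      have e := congrArg GHom.letters hsrc
      rw [GHom.letters_comp, GHom.letters_comp, letters_gen_of_step hab] at e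
      rw [letters_gen_of_step hde'] at e ⊢
      rcases hll : l.letters with _ | ⟨p, L⟩
      · rw [hll] at e
        simp only [List.cons_append, List.nil_append, List.cons.injEq, Prod.mk.injEq] at e
        exact absurd e.1.1 hik.ne'
      · rw [hll] at e
        simp only [List.cons_append, List.nil_append, List.cons.injEq] at e
        exact ⟨L, by rw [← e.1]; rfl⟩
    obtain ⟨l', rfl, -⟩ := GHom.factor_left hL
    rw [GHom.assoc] at hsrc
    have hsrc := comp_left_cancel hsrc
    have hY := ih l' cx cx₁ gx gy hsrc
    have hst := Cross.step hik hde' g' cx' cx₁' gx' gz' (f'.comp (GHom.gen j g gy)) _ hY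
      (by rw [tgt_vc (by simp [hsrc, GHom.assoc])]; simp [ht₁, GHom.assoc])
    rw [← idc_hcomp_idc, hcomp_assoc, paste_extend (by simp [hsrc, GHom.assoc]) ht₁ rfl]
    exact hst

end Thin

/-! The two composites in the formulas for interchange cells of composites are defined. -/

namespace GCell

variable {ι : Type} [LinearOrder ι] {A : ι → TwoCat} {x y y' z w w' z' : ∀ i, (A i).Obj} {i j : ι}
  (hij : i < j) {a b b' : (A i).Obj} {c d d' : (A j).Obj}

theorem gam_comp_left_boundary (f : (A i).Hom a b) (f' : (A i).Hom b b') (g : (A j).Hom c d)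
    (fxy : Move A i a b x y) (fyy' : Move A i b b' y y') (fzw : Move A i a b z w)
    (fww' : Move A i b b' w w') (gxz : Move A j c d x z) (gyw : Move A j c d y w)
    (gyw' : Move A j c d y' w') :
    tgt (hcomp (gam hij f g fxy fzw gxz gyw) (idc (.gen i f' fww'))) =
      src (hcomp (idc (.gen i f fxy)) (gam hij f' g fyy' fww' gyw gyw')) := by
  simp [GHom.assoc]

theorem gam_comp_right_boundary (f : (A i).Hom a b) (g : (A j).Hom c d) (g' : (A j).Hom d d')
    (fxy : Move A i a b x y) (fzw : Move A i a b z w) (fzw' : Move A i a b z' w')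
    (gxz : Move A j c d x z) (gzz' : Move A j d d' z z')
    (gyw : Move A j c d y w) (gww' : Move A j d d' w w') :
    tgt (hcomp (idc (.gen j g gxz)) (gam hij f g' fzw fzw' gzz' gww')) =
      src (hcomp (gam hij f g fxy fzw gxz gyw) (idc (.gen j g' gww'))) := by
  simp [GHom.assoc]

end GCell

section Thin

variable {ι : Type} [LinearOrder ι] {T : ι → Theta} {x y z w : ∀ i, (T i).toTwoCat.Obj}

open GCell

theorem GHom.target_eq_of_letters {f : GHom (fun i => (T i).toTwoCat) x y}
    {g : GHom (fun i => (T i).toTwoCat) x z} (h : f.letters = g.letters) : y = z :=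
  vpos_injective (IsPath.unique (h ▸ f.letters_path) g.letters_path)

theorem Move.eq_of_id {ι : Type} {A : ι → TwoCat} {i : ι} {a : (A i).Obj} {x y : ∀ i, (A i).Obj}
    (h : Move A i a a x y) : x = y := by
  funext j
  by_cases hj : j = i
  · subst hj
    rw [h.1, h.2.1]
  · exact h.2.2 j hj

theorem Move.split {i : ι} {a b : (T i).toTwoCat.Obj} (c : (T i).toTwoCat.Obj)
    (h : Move (fun i => (T i).toTwoCat) i a b x y) :
    Move (fun i => (T i).toTwoCat) i a c x (Function.update x i c) ∧
      Move (fun i => (T i).toTwoCat) i c b (Function.update x i c) y :=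
  ⟨⟨h.1, by simp, fun j hj => by simp [hj]⟩, by simp, h.2.1, fun j hj => by simp [hj, h.2.2 j hj]⟩

theorem Move.update {i j : ι} (hij : i ≠ j) {c d : (T j).toTwoCat.Obj} (a : (T i).toTwoCat.Obj)
    (h : Move (fun i => (T i).toTwoCat) j c d x z) :
    Move (fun i => (T i).toTwoCat) j c d (Function.update x i a) (Function.update z i a) := by
  refine ⟨by rw [Function.update_of_ne hij.symm, h.1], by rw [Function.update_of_ne hij.symm, h.2.1],
    fun k hk => ?_⟩
  by_cases hki : k = i
  · subst hki; simp
  · simp [hki, h.2.2 k hk]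

/-- `α` is the composite of a crossing cell that pulls the atomic 1-cell `c` to the front, and of
a 2-cell with target `g` after this atomic 1-cell. -/
def Factors {i : ι} {a b : (T i).toTwoCat.Obj} (c : (T i).toTwoCat.Hom a b)
    (h : Move (fun i => (T i).toTwoCat) i a b x z) (g : GHom (fun i => (T i).toTwoCat) z y)
    (α : GCell (fun i => (T i).toTwoCat) x y) : Prop :=
  ∃ (x₂ : ∀ i, (T i).toTwoCat.Obj) (X : GCell (fun i => (T i).toTwoCat) x x₂)
    (f' : GHom (fun i => (T i).toTwoCat) z x₂) (f₂ : GHom (fun i => (T i).toTwoCat) x₂ y)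
    (α' : GCell (fun i => (T i).toTwoCat) z y), Cross i c X ∧
    tgt X = (GHom.gen i c h).comp f' ∧ src α' = f'.comp f₂ ∧ tgt α' = g ∧
    α = vc (hcomp X (idc f₂)) (hcomp (idc (GHom.gen i c h)) α')

/-- A 2-cell whose target begins with an atomic 1-cell factors through the crossing cell that
pulls this atomic 1-cell to the front. -/
def FactorsThroughCross (α : GCell (fun i => (T i).toTwoCat) x y) : Prop :=
  ((tgt α).letters = [] → α = idc (tgt α)) ∧
  ∀ (i : ι) (a b : (T i).toTwoCat.Obj) (_ : IsStep a b) (c : (T i).toTwoCat.Hom a b)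
    (z : ∀ i, (T i).toTwoCat.Obj) (h : Move (fun i => (T i).toTwoCat) i a b x z)
    (g : GHom (fun i => (T i).toTwoCat) z y), tgt α = (GHom.gen i c h).comp g →
    Factors c h g α

/-- Composing with (whiskerings of) `s` preserves `FactorsThroughCross`. -/
def PreservesFactors (s : GCell (fun i => (T i).toTwoCat) x y) : Prop :=
  ∀ (x' y' : ∀ i, (T i).toTwoCat.Obj) (l : GHom (fun i => (T i).toTwoCat) x' x)
    (r : GHom (fun i => (T i).toTwoCat) y y') (β : GCell (fun i => (T i).toTwoCat) x' y'),
    l.comp ((tgt s).comp r) = src β → FactorsThroughCross β →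
    FactorsThroughCross (vc (hcomp (idc l) (hcomp s (idc r))) β)

theorem factors_idc (f : GHom (fun i => (T i).toTwoCat) x y) : FactorsThroughCross (idc f) := by
  refine ⟨fun _ => rfl, fun i a b hab c z h g e => ?_⟩
  refine ⟨_, cellc i ((T i).toTwoCat.id₂ c) h, GHom.id z, g, idc g,
    .base (c := c) ((T i).toTwoCat.id₂ c) rfl h, ?_, ?_, rfl, ?_⟩
  · rw [GHom.comp_id]; rfl
  · rw [GHom.id_comp]; rfl
  · have := cellc_id (A := fun i => (T i).toTwoCat) i c h
    change f = _ at e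
    rw [this, idc_hcomp_idc, ← e]
    exact (vc_id (α := idc f) rfl).symm

theorem preserves_idc (f : GHom (fun i => (T i).toTwoCat) x y) : PreservesFactors (idc f) := by
  intro x' y' l r β h hβ
  rw [idc_hcomp_idc, idc_hcomp_idc, id_vc (by simpa using h)]
  exact hβ

theorem PreservesFactors.vc {s t : GCell (fun i => (T i).toTwoCat) x y} (hs : PreservesFactors s)
    (ht : PreservesFactors t) (e : tgt s = src t) : PreservesFactors (vc s t) := by
  intro x' y' l r β h hβ
  rw [tgt_vc e] at h
  rw [vc_hcomp_idc _ e, idc_hcomp_vc _ (by simp [e]), vc_assoc (by simp [e]) (by simp [h])]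
  exact hs _ _ l r _ (by simp [e]) (ht _ _ l r β h hβ)

theorem PreservesFactors.hcomp {s : GCell (fun i => (T i).toTwoCat) x y}
    {t : GCell (fun i => (T i).toTwoCat) y z} (hs : PreservesFactors s)
    (ht : PreservesFactors t) : PreservesFactors (hcomp s t) := by
  rw [← exch rfl rfl]
  refine PreservesFactors.vc ?_ ?_ (by simp)
  · intro x' y' l r β h hβ
    rw [GCell.hcomp_assoc, idc_hcomp_idc]
    exact hs _ _ l _ β (by rw [← h]; simp [GHom.assoc]) hβ
  · intro x' y' l r β h hβ
    rw [GCell.hcomp_assoc, ← GCell.hcomp_assoc (idc l), idc_hcomp_idc]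
    exact ht _ _ _ r β (by rw [← h]; simp [GHom.assoc]) hβ

section

variable {x' y' x₂ : ∀ i, (T i).toTwoCat.Obj} {s : GCell (fun i => (T i).toTwoCat) x y}
  {l : GHom (fun i => (T i).toTwoCat) x' x} {r : GHom (fun i => (T i).toTwoCat) y y'}
  {i : ι} {a b : (T i).toTwoCat.Obj} {c : (T i).toTwoCat.Hom a b}
  {h : Move (fun i => (T i).toTwoCat) i a b x' z} {X : GCell (fun i => (T i).toTwoCat) x' x₂}
  {f' : GHom (fun i => (T i).toTwoCat) z x₂} {f₂ : GHom (fun i => (T i).toTwoCat) x₂ y'}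
  {β' : GCell (fun i => (T i).toTwoCat) z y'}

/-- A 2-cell `s` after the crossing cell `X` can be absorbed, since it commutes with `X`. -/
theorem Cross.factors_right (hX : Cross i c X) (ht : tgt X = (GHom.gen i c h).comp f')
    (hs' : src β' = f'.comp f₂) (hβ : l.comp ((tgt s).comp r) = (src X).comp f₂)
    {L : List (Letter ι)} (hb : l.letters = (src X).letters ++ L) :
    Factors c h (tgt β') (vc (GCell.hcomp (idc l) (GCell.hcomp s (idc r)))
      (vc (GCell.hcomp X (idc f₂)) (GCell.hcomp (idc (GHom.gen i c h)) β'))) := by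
  obtain ⟨q, rfl, -⟩ := GHom.factor_left hb
  rw [GHom.assoc] at hβ
  have hf₂ := comp_left_cancel hβ
  subst hf₂
  have := absorb_right (X := X) (τ := GCell.hcomp (idc q) (GCell.hcomp s (idc r))) (β := β')
    ht (by rw [hs']; simp)
  rw [tgt_hcomp, tgt_hcomp, tgt_idc, tgt_idc, ← GCell.hcomp_assoc (idc (src X)),
    idc_hcomp_idc] at this
  exact ⟨x₂, X, f', _, _, hX, ht, by simp, by rw [tgt_vc (by simp [hs'])], this⟩

/-- A 2-cell `s` in the source of `X` can be absorbed, by naturality of crossing cells. -/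
theorem Cross.factors_middle (hX : Cross i c X) (hab : IsStep a b) (hs : AtomCell s)
    (ht : tgt X = (GHom.gen i c h).comp f')
    (hs' : src β' = f'.comp f₂) (hβ : l.comp ((tgt s).comp r) = (src X).comp f₂)
    {L : List (Letter ι)} (hb : (src X).letters = l.letters ++ ((tgt s).letters ++ L)) :
    Factors c h (tgt β') (vc (GCell.hcomp (idc l) (GCell.hcomp s (idc r)))
      (vc (GCell.hcomp X (idc f₂)) (GCell.hcomp (idc (GHom.gen i c h)) β'))) := by
  rw [← List.append_assoc, ← GHom.letters_comp] at hb
  obtain ⟨r', hr', -⟩ := GHom.factor_left hb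
  rw [hr', GHom.assoc, GHom.assoc] at hβ
  have hr := comp_left_cancel (comp_left_cancel hβ)
  subst hr
  rw [GHom.assoc] at hr'
  obtain ⟨X', n, hX', h₁, h₂, h₃⟩ := hX.absorb hab hs l r' hr' h f' ht
  refine ⟨x₂, X', src n, f₂, vc (GCell.hcomp n (idc f₂)) β', hX', h₁, by simp,
    by rw [tgt_vc (by simp [h₂, hs'])], ?_⟩
  rw [← absorb_middle (by simp [hr']) ht h₁ h₂ hs' h₃, GCell.hcomp_assoc, GCell.hcomp_assoc,
    idc_hcomp_idc]

end

/-- An atomic 2-cell `s` before a crossing cell `X` takes place in the source of `X`, or after `X`,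
or it is an interchange of the moving edge with one more edge, and then the composite is a longer
crossing cell. -/
theorem AtomCell.preserves {s : GCell (fun i => (T i).toTwoCat) x y} (hs : AtomCell s) :
    PreservesFactors s := by
  intro x' y' l r β hβ ⟨hβ₁, hβ₂⟩
  have htgt : tgt (vc (GCell.hcomp (idc l) (GCell.hcomp s (idc r))) β) = tgt β :=
    tgt_vc (by simp [hβ])
  refine ⟨fun h => ?_, fun i a b hab c z h g e => ?_⟩
  · rw [htgt] at h
    have h1 := hβ₁ h
    rw [h1, src_idc] at hβ
    rw [← hβ] at h
    simp only [GHom.letters_comp, List.append_eq_nil_iff] at h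
    exact absurd h.2.1 hs.letters_ne_nil
  · rw [htgt] at e
    obtain ⟨x₂, X, f', f₂, β', hX, ht, hs', rfl, rfl⟩ := hβ₂ i a b hab c z h g e
    rw [src_vc, src_hcomp, src_idc] at hβ
    obtain ⟨_, _, F, v, -, hXl, -⟩ := hX.spec hab
    have hl := congrArg GHom.letters hβ
    simp only [GHom.letters_comp] at hl
    rcases List.append_eq_append_iff.1 hl with ⟨as, h₁, h₂⟩ | ⟨bs, h₁, h₂⟩
    · rcases List.append_eq_append_iff.1 h₂ with ⟨cs, h₃, h₄⟩ | ⟨ds, h₃, h₄⟩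
      · exact hX.factors_middle hab hs ht hs' hβ (by rw [h₁, h₃])
      · rcases as with _ | ⟨d₁, as⟩
        · exact hX.factors_right ht hs' hβ (L := []) (by rw [h₁]; simp)
        rcases ds with _ | ⟨d₂, ds⟩
        · exact hX.factors_middle hab hs ht hs' hβ (L := []) (by rw [h₁, h₃]; simp)
        cases hs with
        | cell i' hab' s' h' =>
          rw [tgt_cellc, letters_gen_of_step hab'] at h₃
          simp at h₃
        | gam hij hab' hcd c₀ g₀ fxy fzw gxz gyw =>
          -- The target of `s` begins with the last letter of the source of `X`.
          rw [tgt_gam, GHom.letters_comp, letters_gen_of_step hab', letters_gen_of_step hcd] at h₃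
          obtain rfl : as = [] := by
            rcases as with _ | ⟨d, as⟩
            · rfl
            · simp at h₃
          simp only [List.cons_append, List.nil_append, List.cons.injEq] at h₃
          obtain ⟨rfl, rfl, h₃⟩ := h₃
          obtain rfl : ds = [] := by simpa using h₃.symm
          rw [hXl] at h₁
          obtain ⟨-, h₅⟩ := List.append_inj' h₁ rfl
          simp only [List.cons.injEq, Prod.mk.injEq, and_true] at h₅
          obtain ⟨rfl, h₅, -⟩ := h₅
          obtain rfl := Fin.ext h₅
          obtain rfl := Fin.ext (hab.trans hab'.symm)
          have h₆ : (src X).letters = (l.comp (GHom.gen _ c₀ fxy)).letters := by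
            rw [GHom.letters_comp, letters_gen_of_step hab', hXl, ← h₁]
          obtain rfl := GHom.target_eq_of_letters h₆
          have h₇ := GHom.letters_injective h₆
          rw [h₇, tgt_gam, GHom.assoc, GHom.assoc] at hβ
          have h₈ := comp_left_cancel (comp_left_cancel hβ)
          subst h₈
          have hX' := hX.extend hab hij hcd c₀ g₀ l fxy fzw gxz gyw h₇
          refine ⟨_, _, f'.comp (GHom.gen _ g₀ gyw), r, β', hX', ?_, ?_, rfl, ?_⟩
          · rw [tgt_vc (by simp [h₇, GHom.assoc])]
            simp [ht, GHom.assoc]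
          · rw [hs', GHom.assoc]
          · rw [← absorb_left (by simp [h₇, GHom.assoc]) ht hs', GCell.hcomp_assoc]
    · exact hX.factors_right ht hs' hβ h₁

/-- Every cell of a factor is a horizontal composite of cells between edges. -/
theorem preserves_cellc (i : ι) {a b : (T i).toTwoCat.Obj} (s : (T i).toTwoCat.Cell a b)
    (h : Move (fun i => (T i).toTwoCat) i a b x y) : PreservesFactors (cellc i s h) := by
  induction s using Theta.cell_ind generalizing x with
  | id =>
    obtain rfl := h.eq_of_id
    have h₀ := cellc_id (A := fun i => (T i).toTwoCat) i ((T i).toTwoCat.id₁ b) h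
    exact h₀ ▸ preserves_idc _
  | @cons k k' e f hk ih =>
    obtain ⟨h₁, h₂⟩ := h.split k'
    have := cellc_hcomp (A := fun i => (T i).toTwoCat) i e f h₁ h₂ h
    rw [this]
    exact PreservesFactors.hcomp (AtomCell.cell i hk e h₁).preserves (ih h₂)

/-- Interchange of an edge with an arbitrary 1-cell of another factor. -/
theorem preserves_gam_of_step {i j : ι} (hij : i < j) {a b : (T i).toTwoCat.Obj}
    (hab : IsStep a b) {c d : (T j).toTwoCat.Obj} (f : (T i).toTwoCat.Hom a b)
    (g : (T j).toTwoCat.Hom c d) (fxy : Move (fun i => (T i).toTwoCat) i a b x y)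
    (fzw : Move (fun i => (T i).toTwoCat) i a b z w)
    (gxz : Move (fun i => (T i).toTwoCat) j c d x z)
    (gyw : Move (fun i => (T i).toTwoCat) j c d y w) :
    PreservesFactors (gam hij f g fxy fzw gxz gyw) := by
  induction g using Theta.Hom.ind generalizing x y with
  | id =>
    obtain rfl := gxz.eq_of_id
    obtain rfl := gyw.eq_of_id
    have h₀ : gam hij f (Theta.Hom.id d) fxy fzw gxz gyw = idc (GHom.gen i f fxy) :=
      sound (.γ_id_right (A := fun i => (T i).toTwoCat) hij d f fxy gxz gyw)
    exact h₀ ▸ preserves_idc (GHom.gen i f fxy)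
  | @cons k k' e g hk ih =>
    obtain ⟨h₁, h₂⟩ := gxz.split k'
    obtain ⟨h₃, h₄⟩ := gyw.split k'
    have h₅ := fxy.update hij.ne' k'
    have h₆ := gam_comp_right (A := fun i => (T i).toTwoCat) hij f e g fxy h₅ fzw h₁ h₂ gxz h₃ h₄
      gyw
    exact h₆ ▸ PreservesFactors.vc (PreservesFactors.hcomp (preserves_idc _) (ih h₅ h₂ h₄))
      (PreservesFactors.hcomp (AtomCell.gam hij hab hk f e fxy h₅ h₁ h₃).preserves
        (preserves_idc _)) (gam_comp_right_boundary hij f e g fxy h₅ fzw h₁ h₂ h₃ h₄)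

theorem preserves_gam {i j : ι} (hij : i < j) {a b : (T i).toTwoCat.Obj}
    {c d : (T j).toTwoCat.Obj} (f : (T i).toTwoCat.Hom a b) (g : (T j).toTwoCat.Hom c d)
    (fxy : Move (fun i => (T i).toTwoCat) i a b x y)
    (fzw : Move (fun i => (T i).toTwoCat) i a b z w)
    (gxz : Move (fun i => (T i).toTwoCat) j c d x z)
    (gyw : Move (fun i => (T i).toTwoCat) j c d y w) :
    PreservesFactors (gam hij f g fxy fzw gxz gyw) := by
  induction f using Theta.Hom.ind generalizing x z with
  | id =>
    obtain rfl := fxy.eq_of_id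
    obtain rfl := fzw.eq_of_id
    have h₀ : gam hij (Theta.Hom.id b) g fxy fzw gxz gyw = idc (GHom.gen j g gxz) :=
      sound (.γ_id_left (A := fun i => (T i).toTwoCat) hij b g fxy fzw gxz)
    exact h₀ ▸ preserves_idc (GHom.gen j g gxz)
  | @cons k k' e f hk ih =>
    obtain ⟨h₁, h₂⟩ := fxy.split k'
    obtain ⟨h₃, h₄⟩ := fzw.split k'
    have h₅ := gxz.update hij.ne k'
    have h₆ := gam_comp_left (A := fun i => (T i).toTwoCat) hij e f g h₁ h₂ fxy h₃ h₄ fzw gxz h₅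
      gyw
    exact h₆ ▸ PreservesFactors.vc
      (PreservesFactors.hcomp (preserves_gam_of_step hij hk e g h₁ h₃ gxz h₅) (preserves_idc _))
      (PreservesFactors.hcomp (preserves_idc _) (ih h₂ h₄ h₅))
      (gam_comp_left_boundary hij e f g h₁ h₂ h₃ h₄ gxz h₅ gyw)

/-- Every 2-cell is a composite of whiskered atomic 2-cells, and crossing cells absorb these. -/
theorem factorsThroughCross (α : GCell (fun i => (T i).toTwoCat) x y) :
    FactorsThroughCross α := by
  have key : ∀ {x y : ∀ i, (T i).toTwoCat.Obj} {f g : GHom (fun i => (T i).toTwoCat) x y}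
      (s : Term (fun i => (T i).toTwoCat) f g), PreservesFactors (mk s) := by
    intro x y f g s
    induction s with
    | id f => exact preserves_idc f
    | vcomp s t e ih ih' =>
      rw [← vc_mk s t e]
      exact ih.vc ih' e
    | hcomp s t ih ih' => exact PreservesFactors.hcomp ih ih'
    | cell i α h => exact preserves_cellc i α h
    | γ hij f g fxy fzw gxz gyw => exact preserves_gam hij f g fxy fzw gxz gyw
  induction α using GCell.ind with
  | _ f g s =>
    have := key s _ _ (GHom.id x) (GHom.id y) (idc g)
      (by rw [GHom.id_comp, GHom.comp_id]; rfl) (factors_idc g)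
    rwa [id_hcomp, hcomp_id, vc_id (α := mk s) (f := g) rfl] at this

/-- A list splits uniquely at its first entry that does not satisfy `P`. -/
theorem append_cons_inj {α : Type} {P : α → Prop} {F F' L L' : List α} {p p' : α}
    (hF : ∀ a ∈ F, P a) (hF' : ∀ a ∈ F', P a) (hp : ¬ P p) (hp' : ¬ P p')
    (h : F ++ p :: L = F' ++ p' :: L') : F = F' ∧ p = p' ∧ L = L' := by
  induction F generalizing F' with
  | nil =>
    rcases F' with _ | ⟨a, F'⟩
    · simpa using h
    · simp only [List.nil_append, List.cons_append, List.cons.injEq] at h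
      exact absurd (h.1 ▸ hF' a (by simp)) hp
  | cons b F ih =>
    rcases F' with _ | ⟨a, F'⟩
    · simp only [List.nil_append, List.cons_append, List.cons.injEq] at h
      exact absurd (h.1 ▸ hF b (by simp)) hp'
    · simp only [List.cons_append, List.cons.injEq] at h
      obtain ⟨h₁, h₂, h₃⟩ := ih (fun a ha => hF a (by simp [ha])) (fun a ha => hF' a (by simp [ha]))
        h.2
      exact ⟨by rw [h.1, h₁], h₂, h₃⟩

/-- A Gray tensor product of free 2-categories has at most one 2-cell between two 1-cells. -/
theorem GCell.thin {α β : GCell (fun i => (T i).toTwoCat) x y} (hs : src α = src β)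
    (ht : tgt α = tgt β) : α = β := by
  generalize hf : tgt β = f at ht
  induction f using GHom.ind with
  | id => rw [(factorsThroughCross α).1 (by rw [ht]; rfl),
      (factorsThroughCross β).1 (by rw [hf]; rfl), hf, ht]
  | @cons x x' i a b hab c h g ih =>
    obtain ⟨x₁, X₁, f₁, g₁, α', hX₁, h₁, k₁, l₁, rfl⟩ :=
      (factorsThroughCross α).2 i a b hab c _ h g ht
    obtain ⟨x₂, X₂, f₂, g₂, β', hX₂, h₂, k₂, l₂, rfl⟩ :=
      (factorsThroughCross β).2 i a b hab c _ h g hf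
    rw [src_vc, src_vc, src_hcomp, src_hcomp, src_idc, src_idc] at hs
    obtain ⟨_, _, F₁, v₁, -, e₁, m₁⟩ := hX₁.spec hab
    obtain ⟨_, _, F₂, v₂, -, e₂, m₂⟩ := hX₂.spec hab
    have e := congrArg GHom.letters hs
    rw [GHom.letters_comp, GHom.letters_comp, e₁, e₂, List.append_assoc, List.append_assoc] at e
    -- The letter `(i, _, _)` ending the source of the crossing cell is the first one that does
    -- not move a coordinate `> i`.
    obtain ⟨e₃, e₄, e₅⟩ := append_cons_inj (P := fun l => i < l.1) m₁ m₂ (by simp) (by simp) e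
    have e₆ : (src X₁).letters = (src X₂).letters := by rw [e₁, e₂, e₃, e₄]
    obtain rfl := GHom.target_eq_of_letters e₆
    obtain rfl := hX₁.unique hab hX₂ (GHom.letters_injective e₆)
    obtain rfl := GHom.letters_injective e₅
    obtain rfl := comp_left_cancel (h₁.symm.trans h₂)
    rw [ih (α := α') (β := β') (by rw [k₁, k₂]) l₂ l₁]

end Thin

/-! ### Existence of 2-cells -/

theorem bef_fst_eq {ι : Type} {L : List (Letter ι)} {i : ι} (h : ∀ a ∈ L, a.1 = i) {σ τ : ι × ℕ}
    (hb : Bef L σ τ) : σ.1 = i ∧ τ.1 = i := by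
  have aux : ∀ ρ : ι × ℕ, ρ ∈ L.map Letter.key → ρ.1 = i := fun ρ hρ => by
    obtain ⟨a, ha, rfl⟩ := List.mem_map.1 hρ
    exact h a ha
  exact ⟨aux _ hb.mem_left, aux _ hb.mem_right⟩

/-- A 2-cell of `[n; q]` increases the numbers of the edges. -/
theorem Theta.lle_word {ι : Type} [LinearOrder ι] (i : ι) {κ : Theta} {a b : κ.toTwoCat.Obj}
    (α : κ.toTwoCat.Cell a b) :
    LLe (Hom.word i (κ.toTwoCat.src α)) (Hom.word i (κ.toTwoCat.tgt α)) := by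
  refine ⟨fun i' k v v' hv hv' => ?_, fun i' j' k l hij hb => ?_⟩
  · obtain ⟨rfl, h₁, h₂, h₃⟩ := Hom.mem_word hv
    obtain ⟨-, h₄, -⟩ := Hom.mem_word hv'
    simp only at h₁ h₂ h₃ h₄
    have hk : k < κ.n := h₃.trans_le (Nat.le_of_lt_succ b.isLt)
    have e₁ := Hom.valN_eq (κ.toTwoCat.src α) ⟨k, hk⟩ h₂ h₃
    have e₂ := Hom.valN_eq (κ.toTwoCat.tgt α) ⟨k, hk⟩ h₂ h₃
    rw [h₁, h₄]
    simp only at e₁ e₂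
    rw [e₁, e₂]
    exact α.2 ⟨k, hk⟩ h₂ h₃
  · obtain ⟨e₁, e₂⟩ := bef_fst_eq (fun a ha => (Hom.mem_word ha).1) hb
    exact absurd (e₁.trans e₂.symm) hij.ne

section Exists

variable {ι : Type} [LinearOrder ι] {T : ι → Theta} {x y z w : ∀ i, (T i).toTwoCat.Obj}

open GCell

/-- A 2-cell increases the word of a 1-cell. -/
theorem GCell.lle (α : GCell (fun i => (T i).toTwoCat) x y) :
    LLe (src α).letters (tgt α).letters := by
  have key : ∀ {x y : ∀ i, (T i).toTwoCat.Obj} {f g : GHom (fun i => (T i).toTwoCat) x y}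
      (_ : Term (fun i => (T i).toTwoCat) f g), LLe f.letters g.letters := by
    intro x y f g s
    induction s with
    | id f => exact f.letters_path.lle_refl
    | vcomp s t e ih ih' =>
      subst e
      exact LLe.trans (GHom.letters_path _) (GHom.letters_path _) ih ih'
    | hcomp s t ih ih' =>
      rw [GHom.letters_comp, GHom.letters_comp]
      exact LLe.append (GHom.letters_path _) (GHom.letters_path _) (GHom.letters_path _)
        (GHom.letters_path _) ih ih'
    | cell i α h => exact Theta.lle_word i α
    | @γ x y z w i j hij a b c d f g fxy fzw gxz gyw =>
      rw [GHom.letters_comp, GHom.letters_comp]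
      refine ⟨fun i' k v v' hv hv' => ?_, fun i' j' k l hij' hb => ?_⟩
      · rw [List.mem_append] at hv hv'
        rcases hv with hv | hv <;> rcases hv' with hv' | hv'
        · exact absurd ((Theta.Hom.mem_word hv').1.symm.trans (Theta.Hom.mem_word hv).1) hij.ne
        · exact ((Theta.Hom.mem_word hv).2.1.trans (Theta.Hom.mem_word hv').2.1.symm).le
        · exact ((Theta.Hom.mem_word hv).2.1.trans (Theta.Hom.mem_word hv').2.1.symm).le
        · exact absurd ((Theta.Hom.mem_word hv).1.symm.trans (Theta.Hom.mem_word hv').1) hij.ne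
      · rcases bef_append.1 hb with hb | ⟨h₁, h₂⟩ | hb
        · obtain ⟨e₁, e₂⟩ := bef_fst_eq (fun a ha => (Theta.Hom.mem_word ha).1) hb
          exact absurd (e₁.trans e₂.symm) hij'.ne
        · obtain ⟨p, hp, e₁⟩ := List.mem_map.1 h₁
          obtain ⟨q, hq, e₂⟩ := List.mem_map.1 h₂
          have e₃ := (Theta.Hom.mem_word hp).1
          have e₄ := (Theta.Hom.mem_word hq).1
          have e₅ : p.1 = i' := congrArg Prod.fst e₁
          have e₆ : q.1 = j' := congrArg Prod.fst e₂
          rw [← e₅, ← e₆, e₃, e₄] at hij'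
          exact absurd hij' hij.asymm
        · obtain ⟨e₁, e₂⟩ := bef_fst_eq (fun a ha => (Theta.Hom.mem_word ha).1) hb
          exact absurd (e₁.trans e₂.symm) hij'.ne
  induction α using GCell.ind with
  | _ f g s => exact key s

/-- A 1-cell with only one letter is an edge of one factor. -/
theorem GHom.eq_gen_of_letters {f : GHom (fun i => (T i).toTwoCat) x y} {i : ι} {k v : ℕ}
    (h : f.letters = [(i, k, v)]) : ∃ (a b : (T i).toTwoCat.Obj) (_ : IsStep a b)
      (c : (T i).toTwoCat.Hom a b) (hm : Move (fun i => (T i).toTwoCat) i a b x y),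
      f = GHom.gen i c hm ∧ Theta.pos a = k ∧ Theta.Hom.valN c k = v := by
  revert h
  induction f using GHom.ind with
  | id => intro h; simp at h
  | @cons x x' i' a b hab c hm g ih =>
    intro h
    rw [GHom.letters_comp, letters_gen_of_step hab] at h
    simp only [List.cons_append, List.nil_append, List.cons.injEq, Prod.mk.injEq] at h
    obtain ⟨⟨rfl, rfl, h₁⟩, h₂⟩ := h
    obtain rfl := GHom.eq_of_nil h₂
    obtain rfl := GHom.eq_of_letters_nil h₂
    exact ⟨a, b, hab, c, hm, GHom.comp_id _, rfl, h₁⟩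

/-- There is a 2-cell between two parallel 1-cells if their words are comparable. -/
theorem GCell.exists_of_lle {f g : GHom (fun i => (T i).toTwoCat) x y}
    (h : LLe f.letters g.letters) :
    ∃ α : GCell (fun i => (T i).toTwoCat) x y, src α = f ∧ tgt α = g := by
  induction g using GHom.ind with
  | id =>
    have := f.letters_path.eq_nil
    exact ⟨idc f, rfl, (GHom.eq_of_letters_nil this)⟩
  | @cons x x' i a b hab c hm g ih =>
    have hf := f.letters_path
    have hg := ((GHom.gen i c hm).comp g).letters_path
    have hgn := hg.nodup
    have hmem : (i, Theta.pos a) ∈ f.letters.map Letter.key := by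
      rw [hf.mem_keys_iff, ← hg.mem_keys_iff, GHom.letters_comp, letters_gen_of_step hab]
      simp [Letter.key]
    rw [GHom.letters_comp, letters_gen_of_step hab] at h hgn
    have hxi : vpos x i = Theta.pos a := congrArg Theta.pos hm.1
    obtain ⟨v, hv⟩ := mem_keys.1 hmem
    obtain ⟨L₁, L₂, hL⟩ := List.append_of_mem hv
    have hfn := hf.nodup
    -- The first letter of `g` moves `i`.  The letters before it in `f` must give way to it, so they
    -- move later coordinates, and a crossing cell pulls it to the front.
    have hL₁ : ∀ p ∈ L₁, i < p.1 := by
      intro p hp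
      have hb : Bef f.letters (Letter.key p) (i, Theta.pos a) :=
        bef_iff.2 ⟨L₁, _, hL, List.mem_map_of_mem hp, by simp [Letter.key]⟩
      rcases lt_trichotomy p.1 i with hlt | heq | hgt
      · have hb' := h.2 p.1 i p.2.1 _ hlt hb
        rcases bef_cons.1 hb' with ⟨e, -⟩ | hb''
        · exact absurd (congrArg Prod.fst e) hlt.ne
        · simp only [List.cons_append, List.map_cons, List.nodup_cons] at hgn
          exact absurd hb''.mem_right hgn.1
      · obtain ⟨h₁, h₂⟩ := hf.mem_keys_iff.1 hb.mem_left
        change vpos x p.1 ≤ p.2.1 at h₁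
        change p.2.1 < vpos y p.1 at h₂
        obtain ⟨j, k, u⟩ := p
        simp only at heq h₁ h₂
        subst heq
        rw [hxi] at h₁
        rcases h₁.eq_or_lt with h₃ | h₃
        · exact absurd (by rw [h₃]; rfl) (hb.ne hfn)
        · exact absurd hb (Bef.asymm hfn (hf.bef_of_lt h₃ hxi.le h₂))
      · exact hgt
    obtain ⟨z, f₁, f₂, rfl, hf₁, hf₂⟩ := GHom.exists_split hL
    have hf₂' : f₂.letters = [(i, Theta.pos a, v)] ++ L₂ := hf₂
    obtain ⟨w, f₃, f₄, rfl, hf₃, hf₄⟩ := GHom.exists_split hf₂'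
    obtain ⟨a', b', hab', c', hm', rfl, ha', hv'⟩ := GHom.eq_gen_of_letters hf₃
    obtain rfl : a' = a := Fin.ext ha'
    obtain rfl : b' = b := Fin.ext (hab'.trans hab.symm)
    have hle : v ≤ Theta.Hom.valN c (Theta.pos a') :=
      h.1 i _ _ _ hv (by simp)
    have hs : Theta.Hom.Le c' c := by
      intro m h₁ h₂
      have hm₀ : m.val = Theta.pos a' := by
        have h₃ : Theta.pos a' ≤ m.val := h₁
        have h₄ : m.val < Theta.pos b' := h₂
        rw [hab] at h₄
        omega
      rw [← hm₀] at hle hv'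
      rw [← hv', Theta.Hom.valN_eq c' m h₁ h₂, Theta.Hom.valN_eq c m h₁ h₂] at hle
      exact hle
    obtain ⟨X, hX, hsrc⟩ := Cross.exists (c := c) (s := ⟨(c', c), hs⟩) rfl hab' hm' f₁
      (by rw [hf₁]; exact hL₁)
    change src X = f₁.comp (GHom.gen i c' hm') at hsrc
    obtain ⟨x₁, hm₁, f', v', ht, hl, -⟩ := hX.spec hab'
    obtain rfl := hm₁.target_eq hm
    have hf' : f'.letters = L₁ := by
      rw [hsrc, GHom.letters_comp, hf₁] at hl
      exact ((List.append_inj' hl (by rw [hf₃]; rfl)).1).symm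
    rw [hL] at h hfn
    -- The other letters remain in order, and the induction hypothesis applies to them.
    have hlle : LLe (f'.comp f₄).letters g.letters := by
      rw [GHom.letters_comp, hf', hf₄]
      refine ⟨fun i' k u u' hu hu' => h.1 i' k u u' ?_ ?_, fun i' j' k l hij hb => ?_⟩
      · rw [List.mem_append] at hu
        rcases hu with hu | hu <;> simp [hu]
      · simp [hu']
      · have hb₁ : Bef (L₁ ++ (i, Theta.pos a', v) :: L₂) (i', k) (j', l) :=
          List.Sublist.trans hb (by
            rw [List.map_append, List.map_append]
            exact List.Sublist.append (List.Sublist.refl _) (by simp))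
        rcases bef_cons.1 (h.2 i' j' k l hij hb₁) with ⟨e, -⟩ | hb₂
        · have := hb.mem_left
          rw [List.map_append, List.map_cons, List.nodup_middle, List.nodup_cons] at hfn
          rw [List.map_append, e] at this
          exact absurd this hfn.1
        · exact hb₂
    obtain ⟨α', hα₁, hα₂⟩ := ih hlle
    refine ⟨vc (hcomp X (idc f₄)) (hcomp (idc (GHom.gen i c hm₁)) α'), ?_, ?_⟩
    · rw [src_vc, src_hcomp, src_idc, hsrc, GHom.assoc]
    · rw [tgt_vc (by simp [ht, hα₁, GHom.assoc]), tgt_hcomp, hα₂]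
      rfl

end Exists

/-! ### Functors out of a free 2-category as families of words -/

/-- A presentation of the 2-category `C` by words: vertices are points of a box, 1-cells are
paths in this box, and there is a (unique) 2-cell between parallel 1-cells if and only if their
words are comparable.  Both the 2-categories `[n; q]` and their Gray tensor products are of this
form. -/
structure PathModel {ι : Type} [LinearOrder ι] (T : ι → Theta) (C : TwoCat) where
  pos : C.Obj → ι → ℕ
  pos_injective : ∀ {x y}, pos x = pos y → x = y
  pos_le : ∀ x i, pos x i ≤ (T i).n
  exists_pos : ∀ p : ι → ℕ, (∀ i, p i ≤ (T i).n) → ∃ x, pos x = p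
  word : ∀ {x y}, C.Hom x y → List (Letter ι)
  word_id : ∀ x, word (C.id₁ x) = []
  word_comp : ∀ {x y z} (f : C.Hom x y) (g : C.Hom y z), word (C.comp₁ f g) = word f ++ word g
  word_injective : ∀ {x y} {f g : C.Hom x y}, word f = word g → f = g
  path : ∀ {x y} (f : C.Hom x y), IsPath T (pos x) (word f) (pos y)
  exists_word : ∀ {x y} {L}, IsPath T (pos x) L (pos y) → ∃ f : C.Hom x y, word f = L
  lle : ∀ {x y} (α : C.Cell x y), LLe (word (C.src α)) (word (C.tgt α))
  exists_cell : ∀ {x y} {f g : C.Hom x y}, LLe (word f) (word g) →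
    ∃ α : C.Cell x y, C.src α = f ∧ C.tgt α = g
  thin : ∀ {x y} {α β : C.Cell x y}, C.src α = C.src β → C.tgt α = C.tgt β → α = β

/-- The words of the 1-cells of a Gray tensor product of free 2-categories. -/
noncomputable def grayModel {ι : Type} [LinearOrder ι] (T : ι → Theta) :
    PathModel T (gray (fun i => (T i).toTwoCat)) where
  pos := vpos
  pos_injective := vpos_injective
  pos_le := vpos_le
  exists_pos _ := exists_vpos
  word := GHom.letters
  word_id _ := rfl
  word_comp := GHom.letters_comp
  word_injective := GHom.letters_injective
  path := GHom.letters_path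
  exists_word := GHom.exists_letters
  lle := GCell.lle
  exists_cell := GCell.exists_of_lle
  thin := GCell.thin

/-- The words of the 1-cells of a free 2-category; there is only one coordinate. -/
noncomputable def Theta.model (κ : Theta) : PathModel (fun _ : Unit => κ) κ.toTwoCat where
  pos x _ := Theta.pos x
  pos_injective h := Fin.ext (congrFun h ())
  pos_le x _ := Nat.le_of_lt_succ (Fin.isLt (n := κ.n + 1) x)
  exists_pos p h := ⟨(⟨p (), Nat.lt_succ_of_le (h ())⟩ : Fin (κ.n + 1)), rfl⟩
  word f := Hom.word () f
  word_id _ := Hom.word_id () _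
  word_comp f g := Hom.word_comp () f g
  word_injective h := Hom.word_injective () h
  path f := Hom.word_path () f rfl rfl rfl (by simp)
  exists_word h := Hom.exists_word () rfl h rfl rfl (by simp)
  lle := Theta.lle_word ()
  exists_cell := by
    intro x y f g h
    refine ⟨⟨(f, g), fun m h₁ h₂ => ?_⟩, rfl, rfl⟩
    have hk : ∀ f : κ.Hom x y, ((), m.val, Hom.valN f m.val) ∈ Hom.word () f := fun f => by
      have h₃ : ((), m.val) ∈ (Hom.word () f).map Letter.key := by
        rw [(Hom.word_path () f (T := fun _ => κ) (x := fun _ => x.val) (y := fun _ => y.val)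
          rfl rfl rfl (by simp)).mem_keys_iff]
        exact ⟨h₁, h₂⟩
      obtain ⟨v, hv⟩ := mem_keys.1 h₃
      have := (Hom.mem_word hv).2.1
      simp only at this
      rwa [this] at hv
    have := h.1 _ _ _ _ (hk f) (hk g)
    rw [Hom.valN_eq f m h₁ h₂, Hom.valN_eq g m h₁ h₂] at this
    exact this
  thin h h' := Subtype.ext (Prod.ext h h')

namespace Theta

variable {κ : Theta}

/-- The `k`-th vertex of `[n; q]`; the last one if `k > n`. -/
def vert (κ : Theta) (k : ℕ) : κ.toTwoCat.Obj :=
  (⟨min k κ.n, Nat.lt_succ_of_le (min_le_right _ _)⟩ : Fin (κ.n + 1))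

theorem pos_le (x : κ.toTwoCat.Obj) : pos x ≤ κ.n :=
  Nat.le_of_lt_succ (Fin.isLt (n := κ.n + 1) x)

theorem pos_vert {k : ℕ} (h : k ≤ κ.n) : pos (κ.vert k) = k := min_eq_left h

theorem vert_pos (x : κ.toTwoCat.Obj) : κ.vert (pos x) = x := Fin.ext (min_eq_left (pos_le x))

theorem vert_of_le {k : ℕ} (h : κ.n ≤ k) : κ.vert k = κ.vert κ.n := by
  exact Fin.ext ((min_eq_right h).trans (min_self _).symm)

/-- The edge number `v` from `k` to `k + 1`; the last one if `v` is too large. -/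
def edge (κ : Theta) (k v : ℕ) : κ.toTwoCat.Hom (κ.vert k) (κ.vert (k + 1)) :=
  (⟨Fin.le_def.2 (min_le_min_right _ (Nat.le_succ k)),
    fun m _ _ => ⟨min v (κ.q m), Nat.lt_succ_of_le (min_le_right _ _)⟩⟩ : κ.Hom _ _)

/-- The 2-cell from one edge to a later one. -/
def edgeCell (κ : Theta) (k : ℕ) {v v' : ℕ} (h : v ≤ v') :
    κ.toTwoCat.Cell (κ.vert k) (κ.vert (k + 1)) :=
  ⟨(κ.edge k v, κ.edge k v'), fun _ _ _ => Fin.le_def.2 (min_le_min_right _ h)⟩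

/-- The word of a 1-cell of `[n; q]`. -/
noncomputable def eword {x y : κ.toTwoCat.Obj} (f : κ.toTwoCat.Hom x y) : List (Letter Unit) :=
  Hom.word () f

theorem eword_id (x : κ.toTwoCat.Obj) : eword (κ.toTwoCat.id₁ x) = [] := Hom.word_id () _

theorem eword_comp {x y z : κ.toTwoCat.Obj} (f : κ.toTwoCat.Hom x y) (g : κ.toTwoCat.Hom y z) :
    eword (κ.toTwoCat.comp₁ f g) = eword f ++ eword g := Hom.word_comp () f g

theorem eword_injective {x y : κ.toTwoCat.Obj} {f g : κ.toTwoCat.Hom x y}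
    (h : eword f = eword g) : f = g := Hom.word_injective () h

theorem eword_path {x y : κ.toTwoCat.Obj} (f : κ.toTwoCat.Hom x y) :
    IsPath (fun _ : Unit => κ) (fun _ => pos x) (eword f) (fun _ => pos y) :=
  Hom.word_path () f rfl rfl rfl (by simp)

theorem eword_edge {k : ℕ} (h : k < κ.n) (v : ℕ) :
    eword (κ.edge k v) = [((), k, min v (κ.q ⟨k, h⟩))] := by
  have h₁ : pos (κ.vert k) = k := pos_vert h.le
  have h₂ : pos (κ.vert (k + 1)) = k + 1 := pos_vert h
  have h₃ := Hom.valN_eq (κ.edge k v) ⟨k, h⟩ (Fin.le_def.2 h₁.le)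
    (Fin.lt_def.2 ((Nat.lt_succ_self k).trans_eq h₂.symm))
  have h₄ := Hom.word_of_step () (κ.edge k v) (h₂.trans (congrArg (· + 1) h₁.symm))
  refine h₄.trans ?_
  change [((), pos (κ.vert k), Hom.valN (κ.edge k v) (pos (κ.vert k)))] = _
  rw [h₁]
  exact congrArg (fun n => [((), k, n)]) h₃

theorem exists_vert_of_step {x y : κ.toTwoCat.Obj} (h : IsStep x y) :
    ∃ k < κ.n, κ.vert k = x ∧ κ.vert (k + 1) = y :=
  ⟨pos x, Nat.lt_of_succ_le (h.symm.trans_le (pos_le y)), vert_pos x,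
    (congrArg κ.vert h.symm).trans (vert_pos y)⟩

theorem exists_edge {k : ℕ} (hk : k < κ.n) (e : κ.toTwoCat.Hom (κ.vert k) (κ.vert (k + 1))) :
    ∃ v, κ.Ok k v ∧ κ.edge k v = e := by
  have h₁ : pos (κ.vert k) = k := pos_vert hk.le
  have h₂ : pos (κ.vert (k + 1)) = k + 1 := pos_vert hk
  have h₃ : eword e = [((), pos (κ.vert k), Hom.valN e (pos (κ.vert k)))] :=
    Hom.word_of_step () e (h₂.trans (congrArg (· + 1) h₁.symm))
  rw [h₁] at h₃
  have h₄ := (eword_path e).ok (a := ((), k, Hom.valN e k)) (by rw [h₃]; exact List.mem_singleton_self _)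
  refine ⟨_, h₄, eword_injective ?_⟩
  rw [h₃, eword_edge hk, min_eq_left h₄.2]

/-- Every 1-cell is a composite of edges. -/
theorem edge_ind {l : κ.toTwoCat.Obj} {P : ∀ {k : κ.toTwoCat.Obj}, κ.toTwoCat.Hom k l → Prop}
    (id : P (κ.toTwoCat.id₁ l))
    (cons : ∀ (k v : ℕ) (f : κ.toTwoCat.Hom (κ.vert (k + 1)) l), κ.Ok k v → P f →
      P (κ.toTwoCat.comp₁ (κ.edge k v) f)) {k : κ.toTwoCat.Obj} (f : κ.toTwoCat.Hom k l) : P f := by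
  induction f using Hom.ind with
  | id => exact id
  | cons e f hk ih =>
    obtain ⟨n, hn, rfl, rfl⟩ := exists_vert_of_step hk
    obtain ⟨v, hok, rfl⟩ := exists_edge hn e
    exact cons n v f hok ih

/-- Every 2-cell is a horizontal composite of 2-cells between edges. -/
theorem edgeCell_ind {l : κ.toTwoCat.Obj}
    {P : ∀ {k : κ.toTwoCat.Obj}, κ.toTwoCat.Cell k l → Prop}
    (id : P (κ.toTwoCat.id₂ (κ.toTwoCat.id₁ l)))
    (cons : ∀ (k v v' : ℕ) (h : v ≤ v') (α : κ.toTwoCat.Cell (κ.vert (k + 1)) l), κ.Ok k v' → P α →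
      P (κ.toTwoCat.hcomp (κ.edgeCell k h) α)) {k : κ.toTwoCat.Obj} (α : κ.toTwoCat.Cell k l) :
    P α := by
  induction α using cell_ind with
  | id => exact id
  | cons e f hk ih =>
    obtain ⟨n, hn, rfl, rfl⟩ := exists_vert_of_step hk
    obtain ⟨v, hok, hv⟩ := exists_edge hn (κ.toTwoCat.src e)
    obtain ⟨v', hok', hv'⟩ := exists_edge hn (κ.toTwoCat.tgt e)
    have hle : v ≤ v' := by
      have h := (lle_word () e).1
      change ∀ i k v v', (i, k, v) ∈ eword (κ.toTwoCat.src e) →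
        (i, k, v') ∈ eword (κ.toTwoCat.tgt e) → v ≤ v' at h
      rw [← hv, ← hv', eword_edge hn, eword_edge hn, min_eq_left hok.2, min_eq_left hok'.2] at h
      exact h () n v v' (List.mem_singleton_self _) (List.mem_singleton_self _)
    obtain rfl : κ.edgeCell n hle = e := Subtype.ext (Prod.ext hv hv')
    exact cons n v v' hle f hok' ih

end Theta

namespace PathModel

variable {ι : Type} [LinearOrder ι] {T : ι → Theta} {C : TwoCat} (M : PathModel T C) {κ : Theta}

/-- The position of the image of the `k`-th vertex. -/
def posN (F : TwoFunctor κ.toTwoCat C) (k : ℕ) : ι → ℕ := M.pos (F.obj (κ.vert k))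

/-- The word of the image of the edge number `v` from `k` to `k + 1`, and the empty word if there
are no such edges. -/
def lett (F : TwoFunctor κ.toTwoCat C) (k v : ℕ) : List (Letter ι) := M.word (F.map (κ.edge k v))

variable (F : TwoFunctor κ.toTwoCat C)

theorem posN_val (x : κ.toTwoCat.Obj) : M.posN F (Theta.pos x) = M.pos (F.obj x) := by
  unfold posN
  rw [Theta.vert_pos]

theorem posN_le (k : ℕ) (i : ι) : M.posN F k i ≤ (T i).n := M.pos_le _ _

theorem posN_of_le {k : ℕ} (h : κ.n ≤ k) : M.posN F k = M.posN F κ.n := by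
  unfold posN
  rw [Theta.vert_of_le h]

theorem lett_path (k v : ℕ) : IsPath T (M.posN F k) (M.lett F k v) (M.posN F (k + 1)) :=
  M.path _

theorem lett_lle (k : ℕ) {v v' : ℕ} (h : v ≤ v') : LLe (M.lett F k v) (M.lett F k v') := by
  have := M.lle (F.cell (κ.edgeCell k h))
  rwa [F.src_cell, F.tgt_cell] at this

theorem lett_of_le {k : ℕ} (h : κ.n ≤ k) (v : ℕ) : M.lett F k v = [] := by
  have := M.lett_path F k v
  rw [M.posN_of_le F h, M.posN_of_le F (h.trans (Nat.le_succ k))] at this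
  exact this.eq_nil

/-- By definition of `Theta.edge`, numbers that are too large denote the last edge. -/
theorem lett_min {k : ℕ} (h : k < κ.n) (v : ℕ) :
    M.lett F k (min v (κ.q ⟨k, h⟩)) = M.lett F k v := by
  have : κ.edge k (min v (κ.q ⟨k, h⟩)) = κ.edge k v := by
    refine Theta.eword_injective ?_
    rw [Theta.eword_edge h, Theta.eword_edge h, min_assoc, min_self]
  unfold lett
  rw [this]

/-- A functor out of a free 2-category replaces every letter by the word of its image. -/
theorem word_map {x y : κ.toTwoCat.Obj} (f : κ.toTwoCat.Hom x y) :
    M.word (F.map f) = (Theta.eword f).flatMap (fun a => M.lett F a.2.1 a.2.2) := by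
  induction f using Theta.edge_ind with
  | id => rw [Theta.eword_id, F.map_id, M.word_id, List.flatMap_nil]
  | cons k v f hok ih =>
    rw [F.map_comp, M.word_comp, ih, Theta.eword_comp, List.flatMap_append,
      Theta.eword_edge hok.1]
    simp only [List.flatMap_cons, List.flatMap_nil, List.append_nil, lett_min]
    rfl

/-- A functor out of a free 2-category is determined by the images of the vertices and edges. -/
theorem ext {F G : TwoFunctor κ.toTwoCat C} (h : ∀ k ≤ κ.n, M.posN F k = M.posN G k)
    (h' : ∀ k v, κ.Ok k v → M.lett F k v = M.lett G k v) : F = G := by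
  have hobj : F.obj = G.obj := by
    funext x
    refine M.pos_injective ?_
    rw [← posN_val, ← posN_val, h _ (Theta.pos_le x)]
  have hw : ∀ {x y : κ.toTwoCat.Obj} (f : κ.toTwoCat.Hom x y),
      M.word (F.map f) = M.word (G.map f) := by
    intro x y f
    rw [word_map, word_map]
    exact List.flatMap_congr fun a ha => h' _ _ ((Theta.eword_path f).ok ha)
  obtain ⟨Fo, Fm, Fc, hs, ht, h₁, h₂, h₃, h₄, h₅⟩ := F
  obtain ⟨Go, Gm, Gc, ks, kt, k₁, k₂, k₃, k₄, k₅⟩ := G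
  simp only at hobj
  subst hobj
  have hm : @Fm = @Gm := by
    funext k l f
    exact M.word_injective (hw f)
  subst hm
  have hc : @Fc = @Gc := by
    funext k l α
    exact M.thin ((hs α).trans (ks α).symm) ((ht α).trans (kt α).symm)
  subst hc
  rfl

/-- A family of paths that is increasing in the number of the edge defines a functor. -/
theorem exists_functor (P : ℕ → ι → ℕ) (E : ℕ → ℕ → List (Letter ι))
    (hP : ∀ k ≤ κ.n, ∀ i, P k i ≤ (T i).n)
    (hE : ∀ k v, κ.Ok k v → IsPath T (P k) (E k v) (P (k + 1)))
    (hle : ∀ k v v', κ.Ok k v' → v ≤ v' → LLe (E k v) (E k v')) :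
    ∃ F : TwoFunctor κ.toTwoCat C, (∀ k ≤ κ.n, M.posN F k = P k) ∧
      ∀ k v, κ.Ok k v → M.lett F k v = E k v := by
  choose o ho using fun x : κ.toTwoCat.Obj => M.exists_pos (P (Theta.pos x))
    (hP _ (Theta.pos_le x))
  let W {x y : κ.toTwoCat.Obj} (f : κ.toTwoCat.Hom x y) : List (Letter ι) :=
    (Theta.eword f).flatMap (fun a => E a.2.1 a.2.2)
  have hWid : ∀ x, W (κ.toTwoCat.id₁ x) = [] := fun x => by simp only [W, Theta.eword_id]; rfl
  have hWcomp : ∀ {x y z : κ.toTwoCat.Obj} (f : κ.toTwoCat.Hom x y) (g : κ.toTwoCat.Hom y z),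
      W (κ.toTwoCat.comp₁ f g) = W f ++ W g := fun f g => by
    simp only [W, Theta.eword_comp, List.flatMap_append]
  have hWedge : ∀ {k v}, κ.Ok k v → W (κ.edge k v) = E k v := fun {k v} hok => by
    simp only [W, Theta.eword_edge hok.1, List.flatMap_cons, List.flatMap_nil, List.append_nil]
    rw [min_eq_left hok.2]
  have hvert : ∀ {k v}, κ.Ok k v → M.pos (o (κ.vert k)) = P k ∧
      M.pos (o (κ.vert (k + 1))) = P (k + 1) := fun {k v} hok => by
    rw [ho, ho, Theta.pos_vert hok.1.le, Theta.pos_vert hok.1]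
    exact ⟨rfl, rfl⟩
  have hW : ∀ {x y : κ.toTwoCat.Obj} (f : κ.toTwoCat.Hom x y),
      IsPath T (M.pos (o x)) (W f) (M.pos (o y)) := by
    intro x y f
    induction f using Theta.edge_ind with
    | id => rw [hWid]; rfl
    | cons k v f hok ih =>
      rw [hWcomp, hWedge hok]
      refine IsPath.append ?_ ih
      rw [(hvert hok).1, (hvert hok).2]
      exact hE k v hok
  choose m hm using fun (x y : κ.toTwoCat.Obj) (f : κ.toTwoCat.Hom x y) => M.exists_word (hW f)
  have hcell : ∀ {x y : κ.toTwoCat.Obj} (α : κ.toTwoCat.Cell x y),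
      LLe (M.word (m x y (κ.toTwoCat.src α))) (M.word (m x y (κ.toTwoCat.tgt α))) := by
    intro k l α
    rw [hm, hm]
    induction α using Theta.edgeCell_ind with
    | id => exact (hW _).lle_refl
    | cons k v v' h α hok ih =>
      have hok' : κ.Ok k v := ⟨hok.1, h.trans hok.2⟩
      rw [κ.toTwoCat.src_hcomp, κ.toTwoCat.tgt_hcomp, hWcomp, hWcomp]
      refine LLe.append (hW _) (hW _) (hW _) (hW _) ?_ ih
      change LLe (W (κ.edge k v)) (W (κ.edge k v'))
      rw [hWedge hok', hWedge hok]
      exact hle k v v' hok h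
  choose c hc hc' using fun (k l : κ.toTwoCat.Obj) (α : κ.toTwoCat.Cell k l) =>
    M.exists_cell (hcell α)
  have hcomp : ∀ {x y z : κ.toTwoCat.Obj} (f : κ.toTwoCat.Hom x y) (g : κ.toTwoCat.Hom y z),
      m x z (κ.toTwoCat.comp₁ f g) = C.comp₁ (m x y f) (m y z g) := fun f g =>
    M.word_injective (by rw [M.word_comp, hm, hm, hm, hWcomp])
  let G : TwoFunctor κ.toTwoCat C :=
    { obj := o
      map := fun {k l} f => m k l f
      cell := fun {k l} α => c k l α
      src_cell := fun α => hc _ _ α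
      tgt_cell := fun α => hc' _ _ α
      map_id := fun x => M.word_injective (by rw [hm, M.word_id, hWid])
      map_comp := fun f g => hcomp f g
      cell_id := fun f => M.thin (by rw [hc, C.src_id₂, κ.toTwoCat.src_id₂])
        (by rw [hc', C.tgt_id₂, κ.toTwoCat.tgt_id₂])
      cell_vcomp := fun α β e e' => M.thin
        (by rw [hc, C.src_vcomp, hc, κ.toTwoCat.src_vcomp])
        (by rw [hc', C.tgt_vcomp, hc', κ.toTwoCat.tgt_vcomp])
      cell_hcomp := fun α β => M.thin
        (by rw [hc, C.src_hcomp, hc, hc, κ.toTwoCat.src_hcomp, hcomp])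
        (by rw [hc', C.tgt_hcomp, hc', hc', κ.toTwoCat.tgt_hcomp, hcomp]) }
  refine ⟨G, fun k hk => ?_, fun k v hok => ?_⟩
  · exact (ho (κ.vert k)).trans (by rw [Theta.pos_vert hk])
  · exact (hm _ _ _).trans (hWedge hok)

end PathModel

/-! ### Colourings and slices of words -/

/-- A decomposition of the linearly ordered set `ι` into consecutive blocks `β u`, given by the
map `col` that assigns to an element (its colour, i.e.) the index of its block. -/
structure Coloring (ι U : Type) (β : U → Type) [LinearOrder ι] [LinearOrder U]
    [∀ u, LinearOrder (β u)] where
  col : ι → U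
  e : ∀ u, β u → ι
  strictMono : ∀ u, StrictMono (e u)
  mem_range : ∀ {u i}, i ∈ Set.range (e u) ↔ col i = u
  lt_of_col_lt : ∀ {i j}, col i < col j → i < j

/-- The letters number `a, …, b - 1` of a word. -/
def slice {α : Type} (L : List α) (a b : ℕ) : List α := (L.take b).drop a

theorem take_append_slice {α : Type} (L : List α) {a b : ℕ} (h : a ≤ b) :
    L.take a ++ slice L a b = L.take b := by
  have := List.take_append_drop a (L.take b)
  rwa [List.take_take, min_eq_left h] at this

theorem slice_self {α : Type} (L : List α) (a : ℕ) : slice L a a = [] :=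
  List.drop_eq_nil_of_le (List.length_take_le _ _)

/-- The last marked position at or before `j`, relative to the offset `c`. -/
noncomputable def lastCut (P : ℕ → Prop) (c j : ℕ) : ℕ :=
  open Classical in Nat.findGreatest P (j - c)

section LastCut

variable {P : ℕ → Prop} {c : ℕ}

theorem lastCut_le (m : ℕ) : lastCut P c (c + m) ≤ m := by
  classical
  unfold lastCut
  rw [Nat.add_sub_cancel_left]
  exact Nat.findGreatest_le _

theorem lastCut_of_cut {m : ℕ} (h : P m) : lastCut P c (c + m) = m := by
  classical
  unfold lastCut
  rw [Nat.add_sub_cancel_left]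
  exact le_antisymm (Nat.findGreatest_le _) (Nat.le_findGreatest le_rfl h)

theorem lastCut_succ (m : ℕ) :
    lastCut P c (c + m + 1) = lastCut P c (c + m) ∨ lastCut P c (c + m + 1) = m + 1 := by
  classical
  unfold lastCut
  rw [add_assoc, Nat.add_sub_cancel_left, Nat.add_sub_cancel_left, Nat.findGreatest_succ]
  split_ifs
  · exact .inr rfl
  · exact .inl rfl

theorem lastCut_mono : Monotone (lastCut P c) := by
  classical
  exact fun _ _ h => Nat.findGreatest_mono_right _ (Nat.sub_le_sub_right h c)

theorem lastCut_spec (j : ℕ) : lastCut P c j = 0 ∨ P (lastCut P c j) := by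
  classical
  by_cases h : lastCut P c j = 0
  · exact .inl h
  · exact .inr (Nat.findGreatest_of_ne_zero rfl h)

end LastCut

/-- The path with the colours `C`, with all edges number `v`. -/
def colorPath {U : Type} [DecidableEq U] (v : ℕ) : (U → ℕ) → List U → List (Letter U)
  | _, [] => []
  | d, u :: C => (u, d u, v) :: colorPath v (Function.update d u (d u + 1)) C

section ColorPath

variable {U : Type} [LinearOrder U] {v : ℕ} {d : U → ℕ}

theorem colorPath_append (C₁ C₂ : List U) :
    colorPath v d (C₁ ++ C₂) = colorPath v d C₁ ++ colorPath v (fun u => d u + C₁.count u) C₂ := by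
  induction C₁ generalizing d with
  | nil => rfl
  | cons c C ih =>
    simp only [List.cons_append, colorPath, ih]
    congr 3
    funext u
    by_cases h : u = c
    · subst h; simp; omega
    · rw [Function.update_of_ne h, List.count_cons_of_ne (Ne.symm h)]

theorem colorPath_map_fst (C : List U) : (colorPath v d C).map Prod.fst = C := by
  induction C generalizing d with
  | nil => rfl
  | cons c C ih => simp [colorPath, ih]

theorem mem_colorPath {C : List U} {a : Letter U} (h : a ∈ colorPath v d C) : a.2.2 = v := by
  induction C generalizing d with
  | nil => simp [colorPath] at h
  | cons c C ih =>
    rcases List.mem_cons.1 h with rfl | h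
    · rfl
    · exact ih h

theorem colorPath_path {N Q : ℕ} (hv : v ≤ Q) {C : List U} (h : ∀ u, d u + C.count u ≤ N) :
    IsPath (fun _ => ⟨N, fun _ => Q⟩) d (colorPath v d C) (fun u => d u + C.count u) := by
  induction C generalizing d with
  | nil => rfl
  | cons c C ih =>
    refine ⟨rfl, ⟨?_, hv⟩, ?_⟩
    · have := h c
      rw [List.count_cons_self] at this
      change d c < N
      omega
    · have e : ∀ u, Function.update d c (d c + 1) u + C.count u = d u + (c :: C).count u := by
        intro u
        by_cases hu : u = c
        · subst hu; simp; omega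
        · rw [Function.update_of_ne hu, List.count_cons_of_ne (Ne.symm hu)]
      have := ih (d := Function.update d c (d c + 1)) (fun u => by rw [e]; exact h u)
      simp only [e] at this
      exact this

end ColorPath

namespace Coloring

variable {ι U : Type} {β : U → Type} [LinearOrder ι] [LinearOrder U] [∀ u, LinearOrder (β u)]
  (c : Coloring ι U β)

/-- The sequence of the colours of the letters of a word. -/
def colors (L : List (Letter ι)) : List U := L.map (fun a => c.col a.1)

@[simp] theorem colors_append (L M : List (Letter ι)) :
    c.colors (L ++ M) = c.colors L ++ c.colors M := List.map_append

@[simp] theorem colors_nil : c.colors [] = [] := rfl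

@[simp] theorem colors_cons (a : Letter ι) (L : List (Letter ι)) :
    c.colors (a :: L) = c.col a.1 :: c.colors L := rfl

theorem col_e (u : U) (i : β u) : c.col (c.e u i) = u := c.mem_range.1 ⟨i, rfl⟩

theorem pull_singleton (a : Letter ι) : ∃ i, c.e (c.col a.1) i = a.1 ∧
    pull (c.e (c.col a.1)) [a] = [(i, a.2)] := by
  obtain ⟨i, hi⟩ := c.mem_range.2 (rfl : c.col a.1 = c.col a.1)
  refine ⟨i, hi, ?_⟩
  have := pull_cons_of_eq (c.e (c.col a.1)) (c.strictMono _).injective i a.2 []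
  rwa [hi] at this

theorem pull_singleton_of_ne {a : Letter ι} {u : U} (h : c.col a.1 ≠ u) :
    pull (c.e u) [a] = [] := pull_cons_of_notMem (c.e u) (fun h' => h (c.mem_range.1 h')) []

theorem length_pull (u : U) (L : List (Letter ι)) :
    (pull (c.e u) L).length = (c.colors L).count u := by
  induction L with
  | nil => rfl
  | cons a L ih =>
    rw [← List.singleton_append, pull_append, List.length_append, ih, colors_append,
      List.count_append]
    congr 1
    by_cases h : c.col a.1 = u
    · subst h
      obtain ⟨i, -, h⟩ := c.pull_singleton a
      rw [h]
      simp [colors]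
    · rw [c.pull_singleton_of_ne h]
      simp [colors, h]

/-- A monochromatic word is recovered from its part of this colour. -/
theorem push_pull {u : U} {L : List (Letter ι)} (h : ∀ a ∈ L, c.col a.1 = u) :
    (pull (c.e u) L).map (push (c.e u)) = L := by
  classical
  rw [map_pull _ (c.strictMono u).injective]
  exact List.filter_eq_self.2 fun a ha => by simpa using c.mem_range.2 (h a ha)

theorem pull_eq_nil {u : U} {L : List (Letter ι)} (h : ∀ a ∈ L, c.col a.1 ≠ u) :
    pull (c.e u) L = [] := by
  rw [← List.length_eq_zero_iff, c.length_pull]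
  refine List.count_eq_zero.2 fun h' => ?_
  obtain ⟨a, ha, ha'⟩ := List.mem_map.1 h'
  exact h a ha ha'

/-- A word is empty if its parts of all colours are. -/
theorem eq_nil_of_pull {L : List (Letter ι)} (h : ∀ u, pull (c.e u) L = []) : L = [] := by
  rcases L with _ | ⟨a, L⟩
  · rfl
  · have h₁ := c.length_pull (c.col a.1) (a :: L)
    rw [h, colors_cons, List.count_cons_self] at h₁
    simp at h₁

/-- A word `W` inside a long word `A ++ W ++ B` is recovered from its sequence of colours and from
the parts of the long word of the various colours, cut into slices at marked positions, if the
marked positions of colour `u` include the end points of `W` and all places of `W` where a letter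
of a different colour follows: every slice is put at the place of its last letter, and it is
contiguous in `W`. -/
theorem flatMap_colorPath (A W B : List (Letter ι)) (v : ℕ) (c₀ : U → ℕ) (t : U → ℕ → ℕ)
    (ht_le : ∀ u m, t u (c₀ u + m) ≤ m)
    (ht_succ : ∀ u m, t u (c₀ u + m + 1) = t u (c₀ u + m) ∨ t u (c₀ u + m + 1) = m + 1)
    (hcut : ∀ u W₁ W₂, W = W₁ ++ W₂ → (W₁ = [] ∨ (c.colors W₂).head? ≠ some u) →
      t u (c₀ u + (pull (c.e u) (A ++ W₁)).length) = (pull (c.e u) (A ++ W₁)).length) :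
    (colorPath v (fun u => c₀ u + (pull (c.e u) A).length) (c.colors W)).flatMap
      (fun a => (slice (pull (c.e a.1) (A ++ (W ++ B))) (t a.1 a.2.1) (t a.1 (a.2.1 + 1))).map
        (push (c.e a.1))) = W := by
  set E : Letter U → List (Letter ι) := fun a =>
    (slice (pull (c.e a.1) (A ++ (W ++ B))) (t a.1 a.2.1) (t a.1 (a.2.1 + 1))).map
      (push (c.e a.1)) with hE
  -- `pend` consists of the letters that belong to a slice that is not yet complete.
  have key : ∀ W₁ W₂, W = W₁ ++ W₂ → ∃ pend,
      (colorPath v (fun u => c₀ u + (pull (c.e u) A).length) (c.colors W₁)).flatMap E ++ pend = W₁ ∧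
      (∀ a ∈ pend, ∀ b ∈ pend, c.col a.1 = c.col b.1) ∧
      ∀ u, pull (c.e u) pend = (pull (c.e u) (A ++ W₁)).drop
        (t u (c₀ u + (pull (c.e u) (A ++ W₁)).length)) := by
    intro W₁
    induction W₁ using List.reverseRecOn with
    | nil =>
      intro W₂ hW
      refine ⟨[], rfl, by simp, fun u => ?_⟩
      rw [hcut u [] W₂ hW (.inl rfl), List.drop_length]
      rfl
    | append_singleton W₁ a ih =>
      intro W₂ hW
      rw [List.append_assoc] at hW
      obtain ⟨pend, h₁, h₂, h₃⟩ := ih _ hW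
      set u := c.col a.1 with hu
      obtain ⟨i, -, hpa⟩ : ∃ i, c.e u i = a.1 ∧ pull (c.e u) [a] = [(i, a.2)] := c.pull_singleton a
      have hpend : ∀ b ∈ pend, c.col b.1 = u := by
        intro b hb
        by_contra hne
        have h₄ := h₃ (c.col b.1)
        rw [hcut _ W₁ _ hW (.inr (by simpa [← hu] using Ne.symm hne)), List.drop_length] at h₄
        have h₅ := c.length_pull (c.col b.1) pend
        rw [h₄] at h₅
        have h₆ : c.col b.1 ∈ c.colors pend :=
          List.mem_map_of_mem (f := fun a : Letter ι => c.col a.1) hb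
        exact (List.count_pos_iff.2 h₆).ne h₅
      have hmono : ∀ b ∈ pend ++ [a], c.col b.1 = u := by
        intro b hb
        rcases List.mem_append.1 hb with hb | hb
        · exact hpend b hb
        · rw [List.mem_singleton.1 hb]
      set X := pull (c.e u) (A ++ W₁) with hX
      have hXa : pull (c.e u) (A ++ (W₁ ++ [a])) = X ++ [(i, a.2)] := by
        rw [← List.append_assoc, pull_append, hpa]
      have hXW : pull (c.e u) (A ++ (W ++ B)) = X ++ [(i, a.2)] ++ pull (c.e u) (W₂ ++ B) := by
        rw [← hXa, ← pull_append, hW]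
        simp
      have hlen : (X ++ [(i, a.2)]).length = X.length + 1 := by simp
      have hcol : colorPath v (fun u => c₀ u + (pull (c.e u) A).length) (c.colors (W₁ ++ [a])) =
          colorPath v (fun u => c₀ u + (pull (c.e u) A).length) (c.colors W₁) ++
            [(u, c₀ u + X.length, v)] := by
        rw [colors_append, colorPath_append]
        congr 1
        simp only [colors_cons, colors_nil, colorPath, ← hu, hX, pull_append, List.length_append,
          c.length_pull u W₁, add_assoc]
      have hne : ∀ w, w ≠ u → pull (c.e w) (A ++ (W₁ ++ [a])) = pull (c.e w) (A ++ W₁) := by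
        intro w hw
        rw [← List.append_assoc, pull_append, c.pull_singleton_of_ne (hu ▸ Ne.symm hw),
          List.append_nil]
      have hne' : ∀ w, w ≠ u → pull (c.e w) pend = [] := fun w hw =>
        c.pull_eq_nil fun b hb => by rw [hpend b hb]; exact hw.symm
      rcases ht_succ u X.length with hs | hs
      · refine ⟨pend ++ [a], ?_, fun b hb b' hb' => (hmono b hb).trans (hmono b' hb').symm,
          fun w => ?_⟩
        · rw [hcol, List.flatMap_append, List.append_assoc, ← List.append_assoc _ pend]
          have : List.flatMap E [(u, c₀ u + X.length, v)] = [] := by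
            simp only [List.flatMap_cons, List.flatMap_nil, List.append_nil, hE]
            rw [hs, slice_self]
            rfl
          rw [this, List.nil_append, ← List.append_assoc, h₁]
        · by_cases hw : w = u
          · subst hw
            rw [pull_append, hpa, h₃, hXa, hlen, ← add_assoc, hs, ← hX,
              List.drop_append_of_le_length (ht_le _ _)]
          · rw [hne w hw, ← h₃, pull_append, c.pull_singleton_of_ne (hu ▸ Ne.symm hw),
              List.append_nil]
      · refine ⟨[], ?_, by simp, fun w => ?_⟩
        · rw [hcol, List.flatMap_append, List.append_nil]
          have : List.flatMap E [(u, c₀ u + X.length, v)] = pend ++ [a] := by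
            simp only [List.flatMap_cons, List.flatMap_nil, List.append_nil, hE]
            rw [hs, slice, hXW, ← hlen, List.take_left, List.drop_append_of_le_length (ht_le _ _),
              hX, ← h₃, ← hpa, ← pull_append, c.push_pull hmono]
          rw [this, ← List.append_assoc, h₁]
        · by_cases hw : w = u
          · subst hw
            rw [hXa, hlen, ← add_assoc, hs, ← hlen, List.drop_length]
            rfl
          · rw [hne w hw, ← h₃, hne' w hw]
            rfl
  obtain ⟨pend, h₁, -, h₂⟩ := key W [] (by simp)
  have : pend = [] := c.eq_nil_of_pull fun u => by
    rw [h₂, hcut u W [] (by simp) (.inr (by simp)), List.drop_length]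
  rw [this, List.append_nil] at h₁
  exact h₁

end Coloring

namespace PathModel

variable {ι : Type} [LinearOrder ι] {T : ι → Theta} {C : TwoCat} (M : PathModel T C)

/-- A family of long paths, cut into slices at positions that do not depend on the path, defines a
functor. -/
theorem exists_slice_functor {N Q : ℕ} {x y : ι → ℕ} (V : ℕ → List (Letter ι)) (t : ℕ → ℕ)
    (P : ℕ → ι → ℕ) (ht : Monotone t) (hV : ∀ v, IsPath T x (V v) y)
    (hle : ∀ v v', v ≤ v' → LLe (V v) (V v')) (hy : ∀ i, y i ≤ (T i).n)
    (hP : ∀ j v, IsPath T x ((V v).take (t j)) (P j)) :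
    ∃ F : TwoFunctor (Theta.toTwoCat ⟨N, fun _ => Q⟩) C, (∀ j ≤ N, M.posN F j = P j) ∧
      ∀ j v, Theta.Ok ⟨N, fun _ => Q⟩ j v →
        M.lett F j v = slice (V v) (t j) (t (j + 1)) := by
  have hsplit : ∀ j v, V v = (V v).take (t j) ++
      (slice (V v) (t j) (t (j + 1)) ++ (V v).drop (t (j + 1))) := fun j v => by
    rw [← List.append_assoc, take_append_slice _ (ht (Nat.le_succ j)), List.take_append_drop]
  have hpath : ∀ j v, IsPath T (P j) (slice (V v) (t j) (t (j + 1))) (P (j + 1)) := fun j v =>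
    (hP j v).of_append_left (by
      rw [take_append_slice _ (ht (Nat.le_succ j))]
      exact hP _ v)
  refine M.exists_functor (κ := ⟨N, fun _ => Q⟩) P (fun j v => slice (V v) (t j) (t (j + 1))) ?_
    (fun j v _ => hpath j v) (fun j v v' _ h => ?_)
  · intro j _ i
    have h₁ := hP j 0
    have h₂ := hV 0
    rw [← List.take_append_drop (t j) (V 0)] at h₂
    exact ((h₁.of_append_left h₂).le i).trans (hy i)
  · have h₁ := hle v v' h
    rw [hsplit j v, hsplit j v'] at h₁
    refine LLe.middle h₁ (hpath j v) (hpath j v') ?_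
    rw [← hsplit]
    exact (hV v').nodup

end PathModel

/-! ### Pure pairs of words -/

theorem bef_iff_cons {ι : Type} {L : List (Letter ι)} {σ τ : ι × ℕ} :
    Bef L σ τ ↔ ∃ L₁ a L₂, L = L₁ ++ a :: L₂ ∧ σ ∈ L₁.map Letter.key ∧ a.key = τ := by
  constructor
  · intro h
    obtain ⟨L₁, L₂, rfl, h₁, h₂⟩ := bef_iff.1 h
    obtain ⟨a, ha, rfl⟩ := List.mem_map.1 h₂
    obtain ⟨A, B, rfl⟩ := List.append_of_mem ha
    exact ⟨L₁ ++ A, a, B, by simp, by rw [List.map_append]; exact List.mem_append_left _ h₁, rfl⟩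
  · rintro ⟨L₁, a, L₂, rfl, h₁, rfl⟩
    exact bef_iff.2 ⟨_, _, rfl, h₁, by simp⟩

/-- The length of a path is the increase of the sum of the coordinates. -/
theorem IsPath.sum_eq {β : Type} [LinearOrder β] [Fintype β] {T : β → Theta} {x y : β → ℕ}
    {L : List (Letter β)} (h : IsPath T x L y) : ∑ i, y i = ∑ i, x i + L.length := by
  induction L generalizing x with
  | nil => obtain rfl : x = y := h; rfl
  | cons a L ih =>
    rw [ih h.2.2, List.length_cons, Finset.sum_update_of_mem (Finset.mem_univ _), ← h.1,
      ← Finset.add_sum_erase _ _ (Finset.mem_univ a.1), Finset.sdiff_singleton_eq_erase]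
    omega

theorem IsPath.eq_of_keys {ι : Type} [LinearOrder ι] {T : ι → Theta} {x y y' : ι → ℕ}
    {L L' : List (Letter ι)} (h : IsPath T x L y) (h' : IsPath T x L' y')
    (e : ∀ σ, σ ∈ L.map Letter.key ↔ σ ∈ L'.map Letter.key) : y = y' := by
  funext i
  have h₁ := h.le i
  have h₂ := h'.le i
  by_contra hne
  rcases lt_or_gt_of_ne hne with hlt | hlt
  · have := (h.mem_keys_iff (σ := (i, y i))).1 ((e _).2 (h'.mem_keys_iff.2 ⟨h₁, hlt⟩))
    exact lt_irrefl _ this.2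
  · have := (h'.mem_keys_iff (σ := (i, y' i))).1 ((e _).1 (h.mem_keys_iff.2 ⟨h₂, hlt⟩))
    exact lt_irrefl _ this.2

theorem exists_mem_not_mem {α : Type} {A B : List α} (hA : A.Nodup) (h : B.length < A.length) :
    ∃ a ∈ A, a ∉ B := by
  by_contra! hc
  exact absurd (hA.subperm hc).length_le (not_le.2 h)

theorem mem_of_subset_of_length {α : Type} {A B : List α} (hA : A.Nodup) (h : A ⊆ B)
    (hl : B.length ≤ A.length) {b : α} (hb : b ∈ B) : b ∈ A :=
  ((hA.subperm h).perm_of_length_le hl).mem_iff.2 hb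

section ColorPath

variable {U : Type} [LinearOrder U] {v : ℕ} {d : U → ℕ}

theorem mem_keys_colorPath {C : List U} {u : U} {j : ℕ} :
    (u, j) ∈ (colorPath v d C).map Letter.key ↔ d u ≤ j ∧ j < d u + C.count u := by
  induction C generalizing d with
  | nil => simp [colorPath]
  | cons c C ih =>
    simp only [colorPath, List.map_cons, List.mem_cons, ih, Letter.key, Prod.mk.injEq]
    by_cases h : u = c
    · subst h
      rw [Function.update_self, List.count_cons_self]
      constructor
      · rintro (⟨-, rfl⟩ | h) <;> omega
      · intro h
        by_cases hj : j = d u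
        · exact .inl ⟨rfl, hj⟩
        · exact .inr (by omega)
    · rw [Function.update_of_ne h, List.count_cons_of_ne (Ne.symm h)]
      simp [h]

/-- Order in a path of colours: the letter number `l` of colour `w` comes after the letter number
`j` of colour `u` if enough letters of colour `u` come before it. -/
theorem bef_colorPath {C : List U} {u w : U} {j l : ℕ} :
    Bef (colorPath v d C) (u, j) (w, l) ↔ ∃ C₁ C₂, C = C₁ ++ w :: C₂ ∧ l = d w + C₁.count w ∧
      d u ≤ j ∧ j < d u + C₁.count u := by
  rw [bef_iff_cons]
  constructor
  · rintro ⟨L₁, a, L₂, h, h₁, h₂⟩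
    have hC : C = L₁.map Prod.fst ++ a.1 :: L₂.map Prod.fst := by
      rw [← colorPath_map_fst (v := v) (d := d) C, h]
      simp
    have hl : (colorPath v d (L₁.map Prod.fst)).length = L₁.length := by
      have := congrArg List.length (colorPath_map_fst (v := v) (d := d) (L₁.map Prod.fst))
      simpa using this
    rw [hC, colorPath_append] at h
    obtain ⟨h₃, h₄⟩ := List.append_inj h hl
    simp only [colorPath, List.cons.injEq] at h₄
    obtain ⟨h₄, -⟩ := h₄
    rw [← h₄] at h₂
    simp only [Letter.key, Prod.mk.injEq] at h₂
    obtain ⟨h₂, h₅⟩ := h₂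
    rw [← h₃, mem_keys_colorPath] at h₁
    refine ⟨_, _, hC.trans (by rw [h₂]), ?_, h₁⟩
    rw [← h₅, h₂]
  · rintro ⟨C₁, C₂, rfl, rfl, h⟩
    refine ⟨_, _, _, colorPath_append C₁ (w :: C₂), mem_keys_colorPath.2 h, rfl⟩

/-- The occurrence number `s` of `w` in a list, counted from `0`. -/
theorem exists_split_count {C : List U} {w : U} {s : ℕ} (h : s < C.count w) :
    ∃ C₁ C₂, C = C₁ ++ w :: C₂ ∧ C₁.count w = s := by
  induction C generalizing s with
  | nil => simp at h
  | cons c C ih =>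
    by_cases hc : c = w
    · subst hc
      rcases s with _ | s
      · exact ⟨[], C, rfl, rfl⟩
      · rw [List.count_cons_self] at h
        obtain ⟨C₁, C₂, rfl, h₁⟩ := ih (Nat.lt_of_succ_lt_succ h)
        exact ⟨c :: C₁, C₂, rfl, by rw [List.count_cons_self, h₁]⟩
    · rw [List.count_cons_of_ne hc] at h
      obtain ⟨C₁, C₂, rfl, h₁⟩ := ih h
      exact ⟨c :: C₁, C₂, rfl, by rw [List.count_cons_of_ne hc, h₁]⟩

end ColorPath

namespace Coloring

variable {ι U : Type} {β : U → Type} [LinearOrder ι] [LinearOrder U] [∀ u, LinearOrder (β u)]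
  (c : Coloring ι U β) {T : ι → Theta} {x y : ι → ℕ}

theorem mem_keys_pull {u : U} {L : List (Letter ι)} {i : β u} {k : ℕ} :
    (i, k) ∈ (pull (c.e u) L).map Letter.key ↔ (c.e u i, k) ∈ L.map Letter.key := by
  rw [mem_keys, mem_keys]
  simp only [mem_pull _ (c.strictMono u).injective]
  rfl

theorem nodup_pull {u : U} {L : List (Letter ι)} (h : (L.map Letter.key).Nodup) :
    ((pull (c.e u) L).map Letter.key).Nodup := by
  have h₁ : (((pull (c.e u) L).map (push (c.e u))).map Letter.key).Nodup := by
    classical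
    rw [map_pull _ (c.strictMono u).injective]
    exact h.sublist (List.filter_sublist.map _)
  rw [List.map_map] at h₁
  refine List.Nodup.of_map (fun p => (c.e u p.1, p.2)) ?_
  rw [List.map_map]
  exact h₁

/-- Parallel paths have the same number of letters of every colour. -/
theorem count_colors_eq [∀ u, Fintype (β u)] {L L' : List (Letter ι)} (h : IsPath T x L y)
    (h' : IsPath T x L' y) (u : U) : (c.colors L).count u = (c.colors L').count u := by
  rw [← c.length_pull, ← c.length_pull]
  have h₁ := (h.pull (c.e u) (c.strictMono u).injective).sum_eq
  have h₂ := (h'.pull (c.e u) (c.strictMono u).injective).sum_eq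
  omega

/-- The purity condition for two of the underlying shuffles: two steps of the same colour keep
their order in `L'`, or all steps between them in `L` have their colour. -/
def PurePair (L L' : List (Letter ι)) : Prop :=
  ∀ σ τ, Bef L σ τ → c.col σ.1 = c.col τ.1 → Bef L' σ τ ∨
    ∀ μ, Bef L σ μ → Bef L μ τ → c.col μ.1 = c.col σ.1

/-- If letters of the same colour change their order only inside monochromatic intervals, then
the sequence of colours behaves like a shuffle of undistinguishable letters. -/
theorem lle_colorPath [∀ u, Fintype (β u)] {W W' : List (Letter ι)} (h : IsPath T x W y)
    (h' : IsPath T x W' y) (hle : LLe W W') (hp : c.PurePair W W') {v v' : ℕ} (hv : v ≤ v')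
    (d : U → ℕ) : LLe (colorPath v d (c.colors W)) (colorPath v' d (c.colors W')) := by
  refine ⟨fun i k a a' ha ha' => ?_, fun u w j l huw hb => ?_⟩
  · rw [show a = v from mem_colorPath ha, show a' = v' from mem_colorPath ha']
    exact hv
  obtain ⟨C₁, C₂, hC, hl, hj, hj'⟩ := bef_colorPath.1 hb
  obtain ⟨W₁, R, rfl, rfl, hR⟩ := List.map_eq_append_iff.1 hC
  obtain ⟨τ, W₂, rfl, rfl, rfl⟩ := List.map_eq_cons_iff.1 hR
  change l = d _ + (c.colors W₁).count _ at hl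
  change j < d _ + (c.colors W₁).count _ at hj'
  have hcw : (c.colors W₁).count (c.col τ.1) < (c.colors W').count (c.col τ.1) := by
    rw [← c.count_colors_eq h h', colors_append, List.count_append, colors_cons,
      List.count_cons_self]
    omega
  obtain ⟨C₁', C₂', hC', hs⟩ := exists_split_count hcw
  obtain ⟨W₁', R', rfl, rfl, hR'⟩ := List.map_eq_append_iff.1 hC'
  obtain ⟨τ', W₂', rfl, hτ', rfl⟩ := List.map_eq_cons_iff.1 hR'
  change (c.colors W₁').count _ = _ at hs
  refine bef_colorPath.2 ⟨_, _, hC', by change l = d _ + (c.colors W₁').count _; omega, hj, ?_⟩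
  change j < d u + (c.colors W₁').count u
  by_contra hlt
  have hn := h.nodup
  have hn' := h'.nodup
  have hn₁ : (W₁.map Letter.key).Nodup := by
    rw [List.map_append] at hn
    exact (List.nodup_append.1 hn).1
  have hn₁' : (W₁'.map Letter.key).Nodup := by
    rw [List.map_append] at hn'
    exact (List.nodup_append.1 hn').1
  have hsame : ∀ σ, σ ∈ (W₁ ++ τ :: W₂).map Letter.key ↔ σ ∈ (W₁' ++ τ' :: W₂').map Letter.key :=
    fun σ => by rw [h.mem_keys_iff, h'.mem_keys_iff]
  -- `σ` is a letter of colour `u` that comes before `τ` in `W`, but after `τ'` in `W'`.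
  obtain ⟨σ, hσ, hσ'⟩ := exists_mem_not_mem (B := (pull (c.e u) W₁').map Letter.key)
    (c.nodup_pull (u := u) hn₁)
    (by rw [List.length_map, List.length_map, c.length_pull, c.length_pull]; omega)
  obtain ⟨i, m⟩ := σ
  rw [c.mem_keys_pull] at hσ hσ'
  have hσc : c.col (c.e u i) = u := c.col_e u i
  generalize c.e u i = i₀ at hσ hσ' hσc
  have hτ'k : Letter.key τ' = (τ'.1, τ'.2.1) := rfl
  have hσne : (i₀, m) ≠ τ'.key := fun e => by
    have : c.col i₀ = c.col τ'.1 := congrArg (fun p => c.col p.1) e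
    rw [hσc, hτ'] at this
    exact huw.ne this
  have hσW : (i₀, m) ∈ (W₁ ++ τ :: W₂).map Letter.key := by
    rw [List.map_append]; exact List.mem_append_left _ hσ
  have hb₁ : Bef (W₁' ++ τ' :: W₂') τ'.key (i₀, m) := by
    have := (hsame _).1 hσW
    rw [List.map_append, List.mem_append] at this
    rcases this with this | this
    · exact absurd this hσ'
    · rw [List.map_cons, List.mem_cons] at this
      rcases this with this | this
      · exact absurd this hσne
      · exact bef_iff.2 ⟨W₁' ++ [τ'], W₂', by simp, by simp, this⟩
  have hlt' : i₀ < τ'.1 := c.lt_of_col_lt (by rw [hσc, hτ']; exact huw)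
  have hnot : ¬ Bef (W₁ ++ τ :: W₂) (i₀, m) τ'.key := fun hb' =>
    hb₁.asymm hn' (hle.2 _ _ _ _ hlt' hb')
  have hτ'W : τ'.key ∈ (W₁ ++ τ :: W₂).map Letter.key := (hsame _).2 (by simp)
  have hτ'W₁ : τ'.key ∈ W₁.map Letter.key := by
    rw [List.map_append, List.mem_append] at hτ'W
    rcases hτ'W with h₁ | h₁
    · exact h₁
    · exact absurd (bef_iff.2 ⟨_, _, rfl, hσ, h₁⟩) hnot
  -- `τ''` is a letter of the same colour as `τ'` whose order with respect to `τ'` changes.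
  obtain ⟨τ'', h₁, h₂⟩ : ∃ τ'' ∈ (pull (c.e (c.col τ.1)) W₁').map Letter.key,
      τ'' ∉ (pull (c.e (c.col τ.1)) W₁).map Letter.key := by
    by_contra! hc
    obtain ⟨i', hi'⟩ := c.mem_range.2 hτ'
    have h₁ : (i', τ'.2.1) ∈ (pull (c.e (c.col τ.1)) W₁').map Letter.key := by
      refine mem_of_subset_of_length (c.nodup_pull hn₁') hc ?_ ?_
      · rw [List.length_map, List.length_map, c.length_pull, c.length_pull, hs]
      · rw [c.mem_keys_pull, hi']
        exact hτ'W₁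
    rw [c.mem_keys_pull, hi'] at h₁
    rw [List.map_append, List.nodup_append] at hn'
    exact hn'.2.2 _ h₁ τ'.key (by simp) rfl
  obtain ⟨i', m'⟩ := τ''
  rw [c.mem_keys_pull] at h₁ h₂
  have hc'' : c.col (c.e (c.col τ.1) i') = c.col τ.1 := c.col_e _ i'
  generalize c.e (c.col τ.1) i' = i₁ at h₁ h₂ hc''
  have hτ''W : (i₁, m') ∈ (τ :: W₂).map Letter.key := by
    have := (hsame (i₁, m')).2 (by rw [List.map_append]; exact List.mem_append_left _ h₁)
    rw [List.map_append, List.mem_append] at this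
    exact this.resolve_left h₂
  have hb₂ : Bef (W₁ ++ τ :: W₂) τ'.key (i₁, m') := bef_iff.2 ⟨_, _, rfl, hτ'W₁, hτ''W⟩
  have hb₃ : Bef (W₁' ++ τ' :: W₂') (i₁, m') τ'.key := bef_iff_cons.2 ⟨_, _, _, rfl, h₁, rfl⟩
  rcases hp _ _ hb₂ (hτ'.trans hc''.symm) with hb₄ | hb₄
  · exact hb₄.asymm hn' hb₃
  · rcases bef_total hσW hτ'W hσne with hb₅ | hb₅
    · exact hnot hb₅
    · have := hb₄ _ hb₅ (bef_iff.2 ⟨_, _, rfl, hσ, hτ''W⟩)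
      change c.col i₀ = c.col τ'.1 at this
      rw [hσc, hτ'] at this
      exact huw.ne this

/-- If a letter of a different colour follows in `W` after the first `r` letters of colour `u`,
then the set of the first `r` letters of colour `u` is the same in `W'`. -/
theorem take_pull_keys {W₁ W₂ W' : List (Letter ι)} {u : U} (h : IsPath T x (W₁ ++ W₂) y)
    (h' : IsPath T x W' y) (hp : c.PurePair (W₁ ++ W₂) W')
    (hcut : W₁ = [] ∨ (c.colors W₂).head? ≠ some u) (σ : β u × ℕ) :
    σ ∈ (pull (c.e u) W₁).map Letter.key ↔
      σ ∈ ((pull (c.e u) W').take (pull (c.e u) W₁).length).map Letter.key := by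
  have hn := h.nodup
  have hn' := c.nodup_pull (u := u) h'.nodup
  have hn₁ : (W₁.map Letter.key).Nodup := by
    rw [List.map_append] at hn
    exact (List.nodup_append.1 hn).1
  set r := (pull (c.e u) W₁).length with hr
  have hnt : (((pull (c.e u) W').take r).map Letter.key).Nodup :=
    hn'.sublist ((List.take_sublist _ _).map _)
  -- The first `r` letters precede the others also in `W'`.
  have hbef : ∀ σ ∈ (pull (c.e u) W₁).map Letter.key, ∀ τ ∈ (pull (c.e u) W₂).map Letter.key,
      Bef (pull (c.e u) W') σ τ := by
    rintro ⟨i, m⟩ hσ ⟨j, l⟩ hτ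
    rw [c.mem_keys_pull] at hσ hτ
    rw [bef_pull _ (c.strictMono u).injective]
    rcases W₂ with _ | ⟨μ, W₂⟩
    · simp at hτ
    rcases hcut with rfl | hcut
    · simp at hσ
    have hμ : c.col μ.1 ≠ u := by simpa using hcut
    rcases hp _ _ (bef_iff.2 ⟨_, _, rfl, hσ, hτ⟩) ((c.col_e u i).trans (c.col_e u j).symm)
      with hb | hb
    · exact hb
    · have hτ' : (c.e u j, l) ∈ W₂.map Letter.key := by
        rw [List.map_cons, List.mem_cons] at hτ
        refine hτ.resolve_left fun e => hμ ?_
        have : c.e u j = μ.1 := congrArg Prod.fst e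
        rw [← this, c.col_e]
      have := hb μ.key (bef_iff.2 ⟨_, _, rfl, hσ, by simp⟩)
        (bef_iff.2 ⟨W₁ ++ [μ], W₂, by simp, by simp, hτ'⟩)
      exact absurd (this.trans (c.col_e u i)) hμ
  have hkeys : ∀ σ, σ ∈ (pull (c.e u) W').map Letter.key ↔
      σ ∈ (pull (c.e u) W₁).map Letter.key ∨ σ ∈ (pull (c.e u) W₂).map Letter.key := by
    rintro ⟨i, m⟩
    rw [c.mem_keys_pull, c.mem_keys_pull, c.mem_keys_pull, h'.mem_keys_iff, ← h.mem_keys_iff,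
      List.map_append, List.mem_append]
  have hsub : (pull (c.e u) W₁).map Letter.key ⊆ ((pull (c.e u) W').take r).map Letter.key := by
    intro σ hσ
    by_contra hσ'
    have hσd : σ ∈ ((pull (c.e u) W').drop r).map Letter.key := by
      have := (hkeys σ).2 (.inl hσ)
      rw [← List.take_append_drop r (pull (c.e u) W'), List.map_append, List.mem_append] at this
      exact this.resolve_left hσ'
    have hsub' : ((pull (c.e u) W').take r).map Letter.key ⊆ (pull (c.e u) W₁).map Letter.key := by
      intro τ hτ
      by_contra hτ'
      have hτW : τ ∈ (pull (c.e u) W').map Letter.key :=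
        List.map_subset _ (List.take_subset _ _) hτ
      have h₁ := hbef σ hσ τ (((hkeys τ).1 hτW).resolve_left hτ')
      have h₂ : Bef (pull (c.e u) W') τ σ :=
        bef_iff.2 ⟨_, _, (List.take_append_drop r _).symm, hτ, hσd⟩
      exact h₁.asymm hn' h₂
    refine hσ' (mem_of_subset_of_length hnt hsub' ?_ hσ)
    have : 0 < ((pull (c.e u) W').drop r).length := by
      obtain ⟨a, ha, -⟩ := List.mem_map.1 hσd
      exact List.length_pos_of_mem ha
    rw [List.length_drop] at this
    rw [List.length_map, List.length_map, List.length_take, ← hr]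
    omega
  refine ⟨fun h => hsub h, fun h => mem_of_subset_of_length (c.nodup_pull hn₁) hsub ?_ h⟩
  rw [List.length_map, List.length_map]
  exact List.length_take_le _ _

end Coloring

/-! ### The canonical factorization -/

section Cut

variable {U : Type} [DecidableEq U]

/-- For a family of sequences of colours `K k v`, `k < N`, the number `m` is a cut of colour `u`
if `m` is the number of colours `u` in an initial segment of some `K 0 v ++ ⋯ ++ K (N - 1) v` that
ends at the beginning of one of the `K k v`, or in which it is not followed by `u` in `K k v`. -/
def IsCut (K : ℕ → ℕ → List U) (N : ℕ) (u : U) (m : ℕ) : Prop :=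
  ∃ k < N, ∃ v C₁ C₂, K k v = C₁ ++ C₂ ∧ (C₁ = [] ∨ C₂.head? ≠ some u) ∧
    m = ((List.range k).flatMap (fun l => K l v) ++ C₁).count u

end Cut

namespace PathModel

variable {ι : Type} [LinearOrder ι] {T : ι → Theta} {C : TwoCat} (M : PathModel T C) {κ : Theta}
  (F : TwoFunctor κ.toTwoCat C)

/-- The word of the image of the path from `0` to `k` along the edges number `v`. -/
def pre (k v : ℕ) : List (Letter ι) := (List.range k).flatMap (fun l => M.lett F l v)

theorem pre_succ (k v : ℕ) : M.pre F (k + 1) v = M.pre F k v ++ M.lett F k v := by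
  simp [pre, List.range_succ]

theorem pre_path (k v : ℕ) : IsPath T (M.posN F 0) (M.pre F k v) (M.posN F k) := by
  induction k with
  | zero => rfl
  | succ k ih => rw [pre_succ]; exact ih.append (M.lett_path F k v)

theorem pre_lle (k : ℕ) {v v' : ℕ} (h : v ≤ v') : LLe (M.pre F k v) (M.pre F k v') := by
  induction k with
  | zero => exact (M.pre_path F 0 v).lle_refl
  | succ k ih =>
    rw [pre_succ, pre_succ]
    exact LLe.append (M.pre_path F k v) (M.pre_path F k v') (M.lett_path F k v)
      (M.lett_path F k v') ih (M.lett_lle F k h)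

theorem exists_pre_eq {k n : ℕ} (h : k ≤ n) (v : ℕ) : ∃ B, M.pre F n v = M.pre F k v ++ B := by
  induction n, h using Nat.le_induction with
  | base => exact ⟨[], by simp⟩
  | succ n _ ih =>
    obtain ⟨B, hB⟩ := ih
    exact ⟨B ++ M.lett F n v, by rw [pre_succ, hB, List.append_assoc]⟩

variable {U : Type} {β : U → Type} [LinearOrder U] [∀ u, LinearOrder (β u)]
  (c : Coloring ι U β)

theorem colors_pre (k v : ℕ) :
    c.colors (M.pre F k v) = (List.range k).flatMap (fun l => c.colors (M.lett F l v)) :=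
  List.map_flatMap

/-- The cuts of a functor: the places at which its part of colour `u` has to be cut. -/
def Cut (u : U) (m : ℕ) : Prop := IsCut (fun k v => c.colors (M.lett F k v)) κ.n u m

/-- The number of letters of colour `u` in an initial segment of a path through the image is a cut
if the image of an edge begins there, or a letter of a colour other than `u`, or nothing, follows. -/
theorem cut_of_append {k v : ℕ} (hk : k < κ.n) {u : U} {W₁ W₂ : List (Letter ι)}
    (h : M.lett F k v = W₁ ++ W₂) (h' : W₁ = [] ∨ (c.colors W₂).head? ≠ some u) :
    M.Cut F c u (pull (c.e u) (M.pre F k v ++ W₁)).length := by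
  refine ⟨k, hk, v, c.colors W₁, c.colors W₂, ?_, ?_, ?_⟩
  · change c.colors (M.lett F k v) = _
    rw [h, c.colors_append]
  · exact h'.imp_left fun h => by rw [h, c.colors_nil]
  · rw [c.length_pull, c.colors_append, colors_pre]

/-- The condition on the images of all edges under which a functor has a canonical
factorization. -/
def Pure : Prop := ∀ k v v', c.PurePair (M.lett F k v) (M.lett F k v')

variable [∀ u, Fintype (β u)]

/-- The total degree of colour `u` of the image of the `k`-th vertex. -/
def deg (k : ℕ) (u : U) : ℕ := ∑ i, M.posN F k (c.e u i)

theorem deg_eq_pre (k v : ℕ) (u : U) :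
    M.deg F c k u = M.deg F c 0 u + (pull (c.e u) (M.pre F k v)).length :=
  ((M.pre_path F k v).pull (c.e u) (c.strictMono u).injective).sum_eq

theorem deg_succ (k v : ℕ) (u : U) :
    M.deg F c (k + 1) u = M.deg F c k u + (c.colors (M.lett F k v)).count u := by
  rw [← c.length_pull]
  exact ((M.lett_path F k v).pull (c.e u) (c.strictMono u).injective).sum_eq

/-- The length of the part of colour `u` that lies before the `j`-th vertex. -/
noncomputable def cutAt (u : U) (j : ℕ) : ℕ := lastCut (M.Cut F c u) (M.deg F c 0 u) j

/-- The vertex that is reached after the first `m` letters of colour `u`, along the edges number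
`0`. -/
noncomputable def endAt (u : U) (m : ℕ) (i : β u) : ℕ :=
  M.posN F 0 (c.e u i) + cnt i ((pull (c.e u) (M.pre F κ.n 0)).take m)

/-- The images of the vertices are at cuts. -/
theorem cutAt_deg {k : ℕ} (hk : k ≤ κ.n) (v : ℕ) (u : U) :
    M.cutAt F c u (M.deg F c k u) = (pull (c.e u) (M.pre F k v)).length := by
  unfold cutAt
  rw [M.deg_eq_pre F c k v u]
  rcases hk.lt_or_eq with hk | rfl
  · refine lastCut_of_cut ?_
    have := M.cut_of_append F c (u := u) hk (v := v) (List.nil_append _).symm (.inl rfl)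
    rwa [List.append_nil] at this
  · rcases Nat.eq_zero_or_pos κ.n with h | h
    · rw [h]
      exact Nat.le_zero.1 (lastCut_le _)
    · refine lastCut_of_cut ?_
      obtain ⟨n, hn⟩ := Nat.exists_eq_succ_of_ne_zero h.ne'
      rw [hn, Nat.succ_eq_add_one, pre_succ]
      exact M.cut_of_append F c (by omega) (List.append_nil _).symm (.inr (by simp))

variable {F c}

/-- At a cut, the initial segments of the parts of a given colour end at the same vertex. -/
theorem Cut.exists_path (hp : M.Pure F c) {u : U} {m : ℕ} (h : M.Cut F c u m) :
    ∃ P, ∀ v, IsPath (fun i => T (c.e u i)) (fun i => M.posN F 0 (c.e u i))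
      ((pull (c.e u) (M.pre F κ.n v)).take m) P := by
  have he := (c.strictMono u).injective
  obtain ⟨k, hk, v, C₁, C₂, hC, hcut, rfl⟩ := h
  obtain ⟨W₁, W₂, hW, rfl, rfl⟩ := List.map_eq_append_iff.1 hC
  change W₁.map _ = [] ∨ (c.colors W₂).head? ≠ some u at hcut
  rw [List.map_eq_nil_iff] at hcut
  change ∃ P, ∀ v', IsPath _ _
    ((pull (c.e u) (M.pre F κ.n v')).take ((_ ++ c.colors W₁).count u)) P
  rw [← M.colors_pre F c k v, ← c.colors_append, ← c.length_pull, pull_append, List.length_append]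
  have hl := M.lett_path F k v
  rw [hW] at hl
  obtain ⟨P, hP, -⟩ := isPath_append.1 hl
  refine ⟨fun i => P (c.e u i), fun v' => ?_⟩
  have hlen : (pull (c.e u) (M.pre F k v)).length = (pull (c.e u) (M.pre F k v')).length := by
    have h₁ := M.deg_eq_pre F c k v u
    have h₂ := M.deg_eq_pre F c k v' u
    omega
  obtain ⟨B, hB⟩ := M.exists_pre_eq F (Nat.succ_le_of_lt hk) v'
  have hle : (pull (c.e u) W₁).length ≤ (pull (c.e u) (M.lett F k v')).length := by
    rw [c.length_pull u (M.lett F k v'), c.count_colors_eq (M.lett_path F k v') (M.lett_path F k v),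
      hW, c.colors_append, List.count_append, c.length_pull]
    omega
  rw [hB, pre_succ, pull_append, pull_append, List.append_assoc, hlen, List.take_length_add_append,
    List.take_append_of_le_length hle]
  refine ((M.pre_path F k v').pull (c.e u) he).append ?_
  have h₁ := (M.lett_path F k v').pull (c.e u) he
  rw [← List.take_append_drop (pull (c.e u) W₁).length (pull (c.e u) (M.lett F k v'))] at h₁
  obtain ⟨P', hP', -⟩ := isPath_append.1 h₁
  have hkeys := c.take_pull_keys hl (M.lett_path F k v') (hW ▸ hp k v v') hcut
  rwa [(hP.pull (c.e u) he).eq_of_keys hP' hkeys]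

/-- By purity, the vertex reached at a cut does not depend on the number `v` of the edges, although
the letters before the cut may come in different orders. -/
theorem cutAt_path (hp : M.Pure F c) (u : U) (j v : ℕ) :
    IsPath (fun i => T (c.e u i)) (fun i => M.posN F 0 (c.e u i))
      ((pull (c.e u) (M.pre F κ.n v)).take (M.cutAt F c u j))
      (M.endAt F c u (M.cutAt F c u j)) := by
  rcases lastCut_spec (P := M.Cut F c u) (c := M.deg F c 0 u) j with h | h
  · change M.cutAt F c u j = 0 at h
    rw [h]
    funext i
    simp [endAt]
  · obtain ⟨P, hP⟩ := Cut.exists_path M hp h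
    have : P = M.endAt F c u (M.cutAt F c u j) := by
      funext i
      exact (hP 0).eq_add i
    rw [← this]
    exact hP v

/-- The vertex reached at the cut that belongs to the `k`-th vertex is the part of colour `u` of
its image. -/
theorem endAt_deg (hp : M.Pure F c) {k : ℕ} (hk : k ≤ κ.n) (u : U) :
    M.endAt F c u (M.cutAt F c u (M.deg F c k u)) = fun i => M.posN F k (c.e u i) := by
  have h₁ := M.cutAt_path hp u (M.deg F c k u) 0
  obtain ⟨B, hB⟩ := M.exists_pre_eq F hk 0
  rw [M.cutAt_deg F c hk 0, hB, pull_append, List.take_left] at h₁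
  rw [M.cutAt_deg F c hk 0]
  exact h₁.unique ((M.pre_path F k 0).pull (c.e u) (c.strictMono u).injective)

variable (F c)

variable {G : TwoCat} {D : U → TwoCat} {N Q : ℕ} (MX : PathModel (fun _ : U => (⟨N, fun _ => Q⟩ : Theta)) G)
  (MD : ∀ u, PathModel (fun i => T (c.e u i)) (D u))

/-- The canonical factorization of a functor `F`, consisting of a functor `X` to a Gray tensor
product of copies of `[N; Q, …, Q]`, which moves the coordinate `u` by one whenever `F` moves a
coordinate of colour `u` by one, and functors `Ψ u` from `[N; Q, …, Q]`, which make at the cuts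
all the steps of colour `u` since the previous cut. -/
structure Canonical (X : TwoFunctor κ.toTwoCat G)
    (Ψ : ∀ u, TwoFunctor (Theta.toTwoCat ⟨N, fun _ => Q⟩) (D u)) : Prop where
  le_N : ∀ u, M.deg F c κ.n u ≤ N
  le_Q : ∀ k v, κ.Ok k v → v ≤ Q
  posX : ∀ k ≤ κ.n, MX.posN X k = M.deg F c k
  lettX : ∀ k v, κ.Ok k v →
    MX.lett X k v = colorPath v (M.deg F c k) (c.colors (M.lett F k v))
  posΨ : ∀ u, ∀ j ≤ N, (MD u).posN (Ψ u) j = M.endAt F c u (M.cutAt F c u j)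
  lettΨ : ∀ u j v, Theta.Ok ⟨N, fun _ => Q⟩ j v → (MD u).lett (Ψ u) j v =
    slice (pull (c.e u) (M.pre F κ.n v)) (M.cutAt F c u j) (M.cutAt F c u (j + 1))

theorem deg_mono {k k' : ℕ} (h : k ≤ k') (u : U) : M.deg F c k u ≤ M.deg F c k' u := by
  induction k', h using Nat.le_induction with
  | base => exact le_rfl
  | succ k' _ ih => rw [M.deg_succ F c k' 0]; omega

/-- A pure functor has a canonical factorization: by purity, the paths of colours increase with the
number of the edge, and the parts of each colour can be cut at positions that do not depend on it. -/
theorem exists_canonical (hp : M.Pure F c) (hN : ∀ u, M.deg F c κ.n u ≤ N)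
    (hQ : ∀ k v, κ.Ok k v → v ≤ Q) : ∃ X Ψ, M.Canonical F c MX MD X Ψ := by
  obtain ⟨X, hX, hX'⟩ := MX.exists_functor (κ := κ) (M.deg F c)
    (fun k v => colorPath v (M.deg F c k) (c.colors (M.lett F k v)))
    (fun k hk u => (M.deg_mono F c hk u).trans (hN u))
    (fun k v h => by
      rw [show M.deg F c (k + 1) = fun u => M.deg F c k u + (c.colors (M.lett F k v)).count u from
        funext fun u => M.deg_succ F c k v u]
      refine colorPath_path (hQ k v h) fun u => ?_
      rw [← M.deg_succ F c k v u]
      exact (M.deg_mono F c h.1 u).trans (hN u))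
    (fun k v v' _ h => c.lle_colorPath (M.lett_path F k v) (M.lett_path F k v')
      (M.lett_lle F k h) (hp k v v') h _)
  choose Ψ hΨ hΨ' using fun u => (MD u).exists_slice_functor (N := N) (Q := Q)
    (fun v => pull (c.e u) (M.pre F κ.n v)) (M.cutAt F c u)
    (fun j => M.endAt F c u (M.cutAt F c u j)) lastCut_mono
    (fun v => (M.pre_path F κ.n v).pull (c.e u) (c.strictMono u).injective)
    (fun v v' h => (M.pre_lle F κ.n h).pull (c.e u) (c.strictMono u))
    (fun i => M.posN_le F κ.n _) (fun j v => M.cutAt_path hp u j v)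
  exact ⟨X, Ψ, hN, hQ, hX, hX', hΨ, hΨ'⟩

namespace Canonical

variable {M F c MX MD} {X : TwoFunctor κ.toTwoCat G}
  {Ψ : ∀ u, TwoFunctor (Theta.toTwoCat ⟨N, fun _ => Q⟩) (D u)}

/-- The canonical factorization is a factorization, on edges. -/
theorem flatMap_lett (h : M.Canonical F c MX MD X Ψ) {k v : ℕ} (hok : κ.Ok k v) :
    (MX.lett X k v).flatMap (fun a => ((MD a.1).lett (Ψ a.1) a.2.1 a.2.2).map (push (c.e a.1))) =
      M.lett F k v := by
  have hp := MX.lett_path X k v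
  rw [h.lettX k v hok] at hp ⊢
  obtain ⟨B, hB⟩ := M.exists_pre_eq F (Nat.succ_le_of_lt hok.1) v
  rw [Nat.succ_eq_add_one, pre_succ, List.append_assoc] at hB
  have := c.flatMap_colorPath (M.pre F k v) (M.lett F k v) B v (M.deg F c 0)
    (M.cutAt F c) (fun u m => lastCut_le m) (fun u m => lastCut_succ m)
    (fun u W₁ W₂ hW h' => lastCut_of_cut (M.cut_of_append F c hok.1 hW h'))
  rw [show (fun u => M.deg F c 0 u + (pull (c.e u) (M.pre F k v)).length) = M.deg F c k from
    funext fun u => (M.deg_eq_pre F c k v u).symm] at this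
  refine Eq.trans (List.flatMap_congr fun a ha => ?_) this
  rw [h.lettΨ _ _ _ (hp.ok ha), mem_colorPath ha, hB]

/-- The canonical factorization is a factorization, on vertices. -/
theorem posΨ_deg (h : M.Canonical F c MX MD X Ψ) (hp : M.Pure F c) {k : ℕ} (hk : k ≤ κ.n) (u : U) :
    (MD u).posN (Ψ u) (M.deg F c k u) = fun i => M.posN F k (c.e u i) := by
  rw [h.posΨ u _ ((M.deg_mono F c hk u).trans (h.le_N u)), M.endAt_deg hp hk]

end Canonical

end PathModel

/-! ### The associativity 2-functor in terms of words -/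

/-- The 2-functor `⊠ F` replaces every letter by the word of its image. -/
theorem GHom.letters_map {ι : Type} {ζ ω : ι → Theta}
    (F : ∀ i, TwoFunctor (ζ i).toTwoCat (ω i).toTwoCat) {x y : ∀ i, (ζ i).toTwoCat.Obj}
    (f : GHom (fun i => (ζ i).toTwoCat) x y) :
    (f.map F).letters = f.letters.flatMap (fun a =>
      ((ω a.1).model.lett (F a.1) a.2.1 a.2.2).map (push (fun _ : Unit => a.1))) := by
  induction f using Quotient.ind with | _ w => ?_
  induction w with
  | id => rfl
  | @gen x y i a b f h =>
    change Theta.Hom.word i ((F i).map f) = (Theta.Hom.word i f).flatMap _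
    rw [Theta.Hom.word_eq_map i ((F i).map f), Theta.Hom.word_eq_map i f, List.flatMap_map]
    refine (congrArg _ ((ω i).model.word_map (F i) f)).trans ?_
    rw [List.map_flatMap]
    rfl
  | comp u v ih ih' =>
    exact (congrArg₂ _ ih ih').trans List.flatMap_append.symm

section Nest

variable {U : Type} {β : U → Type} [LinearOrder U] [∀ u, LinearOrder (β u)]

/-- The decomposition of a lexicographic sum into its summands. -/
def sigmaColoring (β : U → Type) [∀ u, LinearOrder (β u)] : Coloring (Σₗ u, β u) U β where
  col p := (ofLex p).1
  e u i := toLex ⟨u, i⟩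
  strictMono _ _ _ h := lex_lt_right h
  mem_range := by
    intro u p
    constructor
    · rintro ⟨i, rfl⟩
      rfl
    · rintro rfl
      exact ⟨(ofLex p).2, rfl⟩
  lt_of_col_lt := fun {p q} h => lex_lt_left (β := β) h (ofLex p).2 (ofLex q).2

variable (T : ∀ u, β u → Theta)

/-- The Gray tensor product of Gray tensor products of free 2-categories. -/
noncomputable abbrev nested : TwoCat := gray (fun u => gray (fun i => (T u i).toTwoCat))

variable {T}

/-- The letters of all the generators in a formal composite of 1-cells of `nested T`. -/
noncomputable def Word.nest : ∀ {X Y : ∀ u, (gray (fun i => (T u i).toTwoCat)).Obj},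
    Word (fun u => gray (fun i => (T u i).toTwoCat)) X Y → List (Letter (Σₗ u, β u))
  | _, _, .id _ => []
  | _, _, .gen u f _ => (GHom.letters (T := T u) f).map (push ((sigmaColoring β).e u))
  | _, _, .comp u v => u.nest ++ v.nest

theorem Word.Rel.nest {X Y : ∀ u, (gray (fun i => (T u i).toTwoCat)).Obj}
    {s t : Word (fun u => gray (fun i => (T u i).toTwoCat)) X Y} (h : Word.Rel _ s t) :
    s.nest = t.nest := by
  induction h with
  | refl => rfl
  | symm _ ih => exact ih.symm
  | trans _ _ ih ih' => exact ih.trans ih'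
  | comp_congr _ _ ih ih' => exact congrArg₂ _ ih ih'
  | id_comp => rfl
  | comp_id => exact List.append_nil _
  | assoc => exact List.append_assoc _ _ _
  | gen_id i a h => rfl
  | gen_comp i f g h h' h'' =>
    exact (congrArg _ (GHom.letters_comp (T := T i) f g)).trans List.map_append

/-- The word of a 1-cell of a nested Gray tensor product. -/
noncomputable def GHom.nest {X Y : ∀ u, (gray (fun i => (T u i).toTwoCat)).Obj}
    (f : GHom (fun u => gray (fun i => (T u i).toTwoCat)) X Y) : List (Letter (Σₗ u, β u)) :=
  Quotient.lift Word.nest (fun _ _ h => Word.Rel.nest h) f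

theorem GHom.nest_comp {X Y Z : ∀ u, (gray (fun i => (T u i).toTwoCat)).Obj}
    (f : GHom (fun u => gray (fun i => (T u i).toTwoCat)) X Y)
    (g : GHom (fun u => gray (fun i => (T u i).toTwoCat)) Y Z) :
    (f.comp g).nest = f.nest ++ g.nest := by
  induction f using Quotient.ind
  induction g using Quotient.ind
  rfl

theorem GHom.nest_path {X Y : ∀ u, (gray (fun i => (T u i).toTwoCat)).Obj}
    (f : GHom (fun u => gray (fun i => (T u i).toTwoCat)) X Y) :
    IsPath (flat T) (fun p => Theta.pos (X (ofLex p).1 (ofLex p).2)) f.nest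
      (fun p => Theta.pos (Y (ofLex p).1 (ofLex p).2)) := by
  induction f using Quotient.ind with | _ w => ?_
  induction w with
  | id => rfl
  | @gen X Y u P Q f h =>
    obtain ⟨rfl, rfl, h⟩ := h
    refine IsPath.push _ ((sigmaColoring β).strictMono u).injective
      (GHom.letters_path (T := T u) f) fun p hp => ?_
    rw [h]
    exact fun h' => hp ((sigmaColoring β).mem_range.2 h')
  | comp s t ih ih' => exact ih.append ih'

/-- The 2-functor `⊠ ψ` replaces every letter by the word of its image. -/
theorem GHom.nest_map {ζ : U → Theta}
    (ψ : ∀ u, TwoFunctor (ζ u).toTwoCat (gray (fun i => (T u i).toTwoCat)))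
    {x y : ∀ u, (ζ u).toTwoCat.Obj} (f : GHom (fun u => (ζ u).toTwoCat) x y) :
    GHom.nest (T := T) (GHom.map (B := fun u => gray (fun i => (T u i).toTwoCat)) ψ f) =
      f.letters.flatMap (fun a => ((grayModel (T a.1)).lett (ψ a.1) a.2.1 a.2.2).map
        (push ((sigmaColoring β).e a.1))) := by
  induction f using Quotient.ind with | _ w => ?_
  induction w with
  | id => rfl
  | @gen x y u a b f h =>
    change List.map _ (GHom.letters (T := T u) ((ψ u).map f)) = (Theta.Hom.word u f).flatMap _
    rw [Theta.Hom.word_eq_map u f, List.flatMap_map]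
    refine (congrArg _ ((grayModel (T u)).word_map (ψ u) f)).trans ?_
    rw [List.map_flatMap]
    rfl
  | comp u v ih ih' =>
    exact (congrArg₂ _ ih ih').trans List.flatMap_append.symm

/-- A 2-cell increases the word of a 1-cell.  An interchange of 1-cells of two factors moves all
letters of the earlier block in front of those of the later block. -/
theorem GCell.lle_nest {X Y : ∀ u, (gray (fun i => (T u i).toTwoCat)).Obj}
    (α : GCell (fun u => gray (fun i => (T u i).toTwoCat)) X Y) :
    LLe (src α).nest (tgt α).nest := by
  have key : ∀ {X Y : ∀ u, (gray (fun i => (T u i).toTwoCat)).Obj}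
      {f g : GHom (fun u => gray (fun i => (T u i).toTwoCat)) X Y}
      (_ : Term (fun u => gray (fun i => (T u i).toTwoCat)) f g), LLe f.nest g.nest := by
    intro X Y f g s
    induction s with
    | id f => exact f.nest_path.lle_refl
    | vcomp s t e ih ih' =>
      subst e
      exact LLe.trans (GHom.nest_path _) (GHom.nest_path _) ih ih'
    | hcomp s t ih ih' =>
      rw [GHom.nest_comp, GHom.nest_comp]
      exact LLe.append (GHom.nest_path _) (GHom.nest_path _) (GHom.nest_path _)
        (GHom.nest_path _) ih ih'
    | cell u α h => exact LLe.push _ ((sigmaColoring β).strictMono u) (GCell.lle (T := T u) α)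
    | @γ X Y Z W u v huv a b c d f g h₁ h₂ h₃ h₄ =>
      have hp := GHom.nest_path ((GHom.gen u f h₁).comp (GHom.gen v g h₄))
      rw [GHom.nest_comp] at hp ⊢
      rw [GHom.nest_comp]
      have hu : ∀ σ ∈ (GHom.nest (GHom.gen u f h₂)).map Letter.key, (ofLex σ.1).1 = u := by
        intro σ hσ
        obtain ⟨a, ha, rfl⟩ := List.mem_map.1 hσ
        obtain ⟨b, -, rfl⟩ := List.mem_map.1 ha
        rfl
      have hv : ∀ σ ∈ (GHom.nest (GHom.gen v g h₃)).map Letter.key, (ofLex σ.1).1 = v := by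
        intro σ hσ
        obtain ⟨a, ha, rfl⟩ := List.mem_map.1 hσ
        obtain ⟨b, -, rfl⟩ := List.mem_map.1 ha
        rfl
      refine ⟨fun i k w w' h h' => ?_, fun i j k l hij hb => ?_⟩
      · refine (hp.val_unique ?_ h').le
        rw [List.mem_append] at h ⊢
        exact h.symm
      · rw [bef_append] at hb ⊢
        rcases hb with hb | ⟨h, h'⟩ | hb
        · exact .inr (.inr hb)
        · exact absurd hij (not_lt.2 ((sigmaColoring β).lt_of_col_lt (by
            change (ofLex j).1 < (ofLex i).1
            have h₅ := hu _ h'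
            have h₆ := hv _ h
            simp only at h₅ h₆
            rw [h₅, h₆]
            exact huv)).le)
        · exact .inl hb
  induction α using GCell.ind with
  | _ f g s => exact key s

variable (T)

/-- There is a 2-functor that concatenates tuples of objects and words. -/
theorem exists_assoc : ∃ J : TwoFunctor (nested T) (gray (fun p => (flat T p).toTwoCat)),
    (∀ X p, J.obj X p = X (ofLex p).1 (ofLex p).2) ∧
      ∀ {X Y} (f : (nested T).Hom X Y), GHom.letters (T := flat T) (J.map f) = GHom.nest f := by
  let o (X : ∀ u, (gray (fun i => (T u i).toTwoCat)).Obj) (p : Σₗ u, β u) : (flat T p).toTwoCat.Obj :=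
    X (ofLex p).1 (ofLex p).2
  choose m hm using fun (X Y : ∀ u, (gray (fun i => (T u i).toTwoCat)).Obj)
    (f : GHom (fun u => gray (fun i => (T u i).toTwoCat)) X Y) =>
      GHom.exists_letters (T := flat T) (x := o X) (y := o Y) f.nest_path
  choose c hc hc' using fun (X Y : ∀ u, (gray (fun i => (T u i).toTwoCat)).Obj)
    (α : GCell (fun u => gray (fun i => (T u i).toTwoCat)) X Y) =>
      GCell.exists_of_lle (T := flat T) (f := m X Y (GCell.src α)) (g := m X Y (GCell.tgt α))
        (by rw [hm, hm]; exact α.lle_nest)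
  let C : TwoCat := gray (fun p => (flat T p).toTwoCat)
  have hcomp : ∀ {X Y Z} (f : (nested T).Hom X Y) (g : (nested T).Hom Y Z),
      m X Z (GHom.comp f g) = GHom.comp (m X Y f) (m Y Z g) := fun f g =>
    GHom.letters_injective (((hm _ _ _).trans (GHom.nest_comp f g)).trans
      ((congrArg₂ _ (hm _ _ _).symm (hm _ _ _).symm).trans (GHom.letters_comp _ _).symm))
  let J : TwoFunctor (nested T) C :=
    { obj := o
      map := fun {X Y} f => m X Y f
      cell := fun {X Y} α => c X Y α
      src_cell := fun α => hc _ _ α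
      tgt_cell := fun α => hc' _ _ α
      map_id := fun X => GHom.letters_injective (hm _ _ _)
      map_comp := fun f g => hcomp f g
      cell_id := fun f => GCell.thin (T := flat T) (hc _ _ _) (hc' _ _ _)
      cell_vcomp := fun α β e e' => GCell.thin (T := flat T)
        ((hc _ _ _).trans ((congrArg _ ((nested T).src_vcomp α β e)).trans
          ((hc _ _ _).symm.trans (C.src_vcomp _ _ e').symm)))
        ((hc' _ _ _).trans ((congrArg _ ((nested T).tgt_vcomp α β e)).trans
          ((hc' _ _ _).symm.trans (C.tgt_vcomp _ _ e').symm)))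
      cell_hcomp := fun α β => GCell.thin (T := flat T)
        ((hc _ _ _).trans ((congrArg _ ((nested T).src_hcomp α β)).trans
          ((hcomp _ _).trans ((congrArg₂ _ (hc _ _ _).symm (hc _ _ _).symm).trans
            (C.src_hcomp _ _).symm))))
        ((hc' _ _ _).trans ((congrArg _ ((nested T).tgt_hcomp α β)).trans
          ((hcomp _ _).trans ((congrArg₂ _ (hc' _ _ _).symm (hc' _ _ _).symm).trans
            (C.tgt_hcomp _ _).symm)))) }
  exact ⟨J, fun X p => rfl, fun f => hm _ _ f⟩

end Nest

section Associator

variable {U : Type} {β : U → Type} [LinearOrder U] [∀ u, LinearOrder (β u)]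
  {T : ∀ u, β u → Theta}
  {J : TwoFunctor (nested T) (gray (flat fun u i => (T u i).toTwoCat))}

/-- An associativity 2-functor is given only on the generators of generators; by functoriality it
is known on all generators of the outer tensor product. -/
theorem IsAssociator.letters_gen (hJ : IsAssociator (A := fun u i => (T u i).toTwoCat) J) {u : U}
    {P Q : ∀ i, (T u i).toTwoCat.Obj} (F : GHom (fun i => (T u i).toTwoCat) P Q)
    {X Y : ∀ u, (gray (fun i => (T u i).toTwoCat)).Obj}
    (H : Move (fun u => gray (fun i => (T u i).toTwoCat)) u P Q X Y) :
    GHom.letters (T := flat T)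
        (J.map (GHom.gen (A := fun u => gray (fun i => (T u i).toTwoCat)) u F H)) =
      F.letters.map (push ((sigmaColoring β).e u)) := by
  induction F using GHom.ind generalizing X with
  | id =>
    obtain rfl := H.eq_of_id
    have : GHom.gen (A := fun u => gray (fun i => (T u i).toTwoCat)) u (GHom.id Q) H =
      GHom.id X := GHom.gen_id (A := fun u => gray (fun i => (T u i).toTwoCat)) u Q H
    rw [this]
    exact congrArg (GHom.letters (T := flat T)) (J.map_id X)
  | @cons P P' i a b hab f h g ih =>
    let X' : ∀ u, (gray (fun i => (T u i).toTwoCat)).Obj := Function.update X u P'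
    have H₁ : Move (fun u => gray (fun i => (T u i).toTwoCat)) u P P' X X' :=
      ⟨H.1, Function.update_self .., fun v hv => (Function.update_of_ne hv ..).symm⟩
    have H₂ : Move (fun u => gray (fun i => (T u i).toTwoCat)) u P' Q X' Y :=
      ⟨Function.update_self .., H.2.1, fun v hv => (Function.update_of_ne hv ..).trans
        (H.2.2 v hv)⟩
    obtain ⟨h', e⟩ := hJ.map_gen f h H₁
    have : GHom.gen (A := fun u => gray (fun i => (T u i).toTwoCat)) u
        ((GHom.gen i f h).comp g) H = (GHom.gen u (GHom.gen i f h) H₁).comp (GHom.gen u g H₂) :=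
      GHom.gen_comp (A := fun u => gray (fun i => (T u i).toTwoCat)) u (GHom.gen i f h) g H₁ H₂ H
    rw [this]
    refine (congrArg (GHom.letters (T := flat T)) (J.map_comp (x := X) (y := X') (z := Y)
      (GHom.gen u (GHom.gen i f h) H₁) (GHom.gen u g H₂))).trans ?_
    refine (GHom.letters_comp (T := flat T) _ _).trans ?_
    refine (congrArg₂ _ (congrArg (GHom.letters (T := flat T)) e) (ih H₂)).trans ?_
    rw [GHom.letters_comp, List.map_append]
    congr 1
    change Theta.Hom.word _ f = List.map _ (Theta.Hom.word i f)
    simp only [Theta.Hom.word, List.map_map]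
    rfl

/-- The axioms of an associativity 2-functor determine the words of the images of all 1-cells. -/
theorem IsAssociator.letters_map (hJ : IsAssociator (A := fun u i => (T u i).toTwoCat) J)
    {X Y : ∀ u, (gray (fun i => (T u i).toTwoCat)).Obj}
    (f : GHom (fun u => gray (fun i => (T u i).toTwoCat)) X Y) :
    GHom.letters (T := flat T) (J.map f) = f.nest := by
  induction f using Quotient.ind with | _ w => ?_
  induction w with
  | id X => exact congrArg (GHom.letters (T := flat T)) (J.map_id X)
  | gen u F H => exact hJ.letters_gen F H
  | @comp X Y Z s t ih ih' =>
    refine (congrArg (GHom.letters (T := flat T)) (J.map_comp (x := X) (y := Y) (z := Z)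
      (Quotient.mk _ s) (Quotient.mk _ t))).trans ?_
    refine (GHom.letters_comp (T := flat T) _ _).trans ?_
    exact congrArg₂ _ ih ih'

/-- A 2-functor that concatenates words has the right values on generating 1-cells, since 1-cells
are determined by their words, and therefore on generating 2-cells, since these are determined by
their boundary. -/
theorem isAssociator_of_letters
    (hobj : ∀ X p, J.obj X p = X (ofLex p).1 (ofLex p).2)
    (hJ : ∀ {X Y} (f : (nested T).Hom X Y), GHom.letters (T := flat T) (J.map f) = GHom.nest f) :
    IsAssociator (A := fun u i => (T u i).toTwoCat) J := by
  have hmove : ∀ {X Y : ∀ u, (gray (fun i => (T u i).toTwoCat)).Obj} {u : U}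
      {P Q : ∀ i, (T u i).toTwoCat.Obj} {i : β u} {a b : (T u i).toTwoCat.Obj}
      (_ : Move (fun i => (T u i).toTwoCat) i a b P Q)
      (_ : Move (fun u => gray (fun i => (T u i).toTwoCat)) u P Q X Y),
      Move (flat fun u i => (T u i).toTwoCat) (toLex ⟨u, i⟩) a b (J.obj X) (J.obj Y) := by
    intro X Y u P Q i a b h H
    obtain ⟨rfl, rfl, h₁⟩ := H
    refine ⟨(hobj _ _).trans h.1, (hobj _ _).trans h.2.1, fun p hp => ?_⟩
    refine (hobj X p).trans (Eq.trans ?_ (hobj Y p).symm)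
    by_cases hu : (ofLex p).1 = u
    · obtain ⟨v, j⟩ := p
      obtain rfl : v = u := hu
      exact h.2.2 j fun e => hp (by subst e; rfl)
    · exact congrFun (h₁ _ hu) _
  have hgen : ∀ {X Y : ∀ u, (gray (fun i => (T u i).toTwoCat)).Obj} {u : U}
      {P Q : ∀ i, (T u i).toTwoCat.Obj} {i : β u} {a b : (T u i).toTwoCat.Obj}
      (f : (T u i).toTwoCat.Hom a b) (h : Move (fun i => (T u i).toTwoCat) i a b P Q)
      (H : Move (fun u => gray (fun i => (T u i).toTwoCat)) u P Q X Y)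
      (h' : Move (flat fun u i => (T u i).toTwoCat) (toLex ⟨u, i⟩) a b (J.obj X) (J.obj Y)),
      J.map (GHom.gen (A := fun u => gray (fun i => (T u i).toTwoCat)) u (GHom.gen i f h) H) =
        GHom.gen (A := flat fun u i => (T u i).toTwoCat) (toLex ⟨u, i⟩) f h' := by
    intro X Y u P Q i a b f h H h'
    refine GHom.letters_injective (T := flat T) ((hJ _).trans ?_)
    change List.map _ (Theta.Hom.word i f) = Theta.Hom.word _ f
    simp only [Theta.Hom.word, List.map_map]
    rfl
  refine ⟨hobj, fun f h H => ⟨hmove h H, hgen f h H _⟩, fun α h H => ⟨hmove h H, ?_⟩, ?_, ?_⟩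
  · refine GCell.thin (T := flat T) ?_ ?_
    · exact (J.src_cell _).trans (hgen _ h H _)
    · exact (J.tgt_cell _).trans (hgen _ h H _)
  · intro X Y u P Q R S i j hij a b c d f g h₁ h₂ h₃ h₄ H
    let Z : ∀ u, (gray (fun i => (T u i).toTwoCat)).Obj := Function.update X u Q
    let W : ∀ u, (gray (fun i => (T u i).toTwoCat)).Obj := Function.update X u R
    have H₁ : Move (fun u => gray (fun i => (T u i).toTwoCat)) u P Q X Z :=
      ⟨H.1, Function.update_self .., fun v hv => (Function.update_of_ne hv ..).symm⟩
    have H₂ : Move (fun u => gray (fun i => (T u i).toTwoCat)) u R S W Y :=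
      ⟨Function.update_self .., H.2.1, fun v hv => (Function.update_of_ne hv ..).trans
        (H.2.2 v hv)⟩
    have H₃ : Move (fun u => gray (fun i => (T u i).toTwoCat)) u P R X W :=
      ⟨H.1, Function.update_self .., fun v hv => (Function.update_of_ne hv ..).symm⟩
    have H₄ : Move (fun u => gray (fun i => (T u i).toTwoCat)) u Q S Z Y :=
      ⟨Function.update_self .., H.2.1, fun v hv => (Function.update_of_ne hv ..).trans
        (H.2.2 v hv)⟩
    refine ⟨J.obj Z, J.obj W, hmove h₁ H₁, hmove h₂ H₂, hmove h₃ H₃, hmove h₄ H₄, ?_⟩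
    have hc : ∀ {V : ∀ u, (gray (fun i => (T u i).toTwoCat)).Obj} {O : ∀ i, (T u i).toTwoCat.Obj}
        (F : GHom (fun i => (T u i).toTwoCat) P O) (G : GHom (fun i => (T u i).toTwoCat) O S)
        (K : Move (fun u => gray (fun i => (T u i).toTwoCat)) u P O X V)
        (L : Move (fun u => gray (fun i => (T u i).toTwoCat)) u O S V Y),
        J.map (GHom.gen (A := fun u => gray (fun i => (T u i).toTwoCat)) u (F.comp G) H) =
          GHom.comp (J.map (GHom.gen (A := fun u => gray (fun i => (T u i).toTwoCat)) u F K))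
            (J.map (GHom.gen (A := fun u => gray (fun i => (T u i).toTwoCat)) u G L)) :=
      fun {V _} F G K L => (congrArg J.map
        (GHom.gen_comp (A := fun u => gray (fun i => (T u i).toTwoCat)) u F G K L H)).trans
          (J.map_comp (x := X) (y := V) (z := Y) (GHom.gen u F K) (GHom.gen u G L))
    refine GCell.thin (T := flat T) ?_ ?_
    · exact (J.src_cell _).trans ((hc _ _ H₃ H₂).trans
        (congrArg₂ GHom.comp (hgen g h₃ H₃ _) (hgen f h₂ H₂ _)))
    · exact (J.tgt_cell _).trans ((hc _ _ H₁ H₄).trans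
        (congrArg₂ GHom.comp (hgen f h₁ H₁ _) (hgen g h₄ H₄ _)))
  · intro X Y Z W u v huv P Q R S i j a b c d f g h k H₁ H₂ H₃ H₄
    refine ⟨hmove h H₁, hmove h H₂, hmove k H₃, hmove k H₄, ?_⟩
    refine GCell.thin (T := flat T) ?_ ?_
    · exact (J.src_cell _).trans ((J.map_comp (x := X) (y := Z) (z := W)
        (GHom.gen v (GHom.gen j g k) H₃) (GHom.gen u (GHom.gen i f h) H₂)).trans
          (congrArg₂ GHom.comp (hgen g k H₃ _) (hgen f h H₂ _)))
    · exact (J.tgt_cell _).trans ((J.map_comp (x := X) (y := Y) (z := W)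
        (GHom.gen u (GHom.gen i f h) H₁) (GHom.gen v (GHom.gen j g k) H₄)).trans
          (congrArg₂ GHom.comp (hgen f h H₁ _) (hgen g k H₄ _)))

theorem IsAssociator.unique {J' : TwoFunctor (nested T) (gray (flat fun u i => (T u i).toTwoCat))}
    (hJ : IsAssociator (A := fun u i => (T u i).toTwoCat) J)
    (hJ' : IsAssociator (A := fun u i => (T u i).toTwoCat) J') : J = J' := by
  have hobj : J.obj = J'.obj := funext fun X => funext fun p => (hJ.obj X p).trans (hJ'.obj X p).symm
  have hl := @hJ.letters_map
  have hl' := @hJ'.letters_map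
  clear hJ hJ'
  obtain ⟨Fo, Fm, Fc, hs, ht, h₁, h₂, h₃, h₄, h₅⟩ := J
  obtain ⟨Go, Gm, Gc, ks, kt, k₁, k₂, k₃, k₄, k₅⟩ := J'
  simp only at hobj
  subst hobj
  have hm : @Fm = @Gm := by
    funext X Y f
    exact GHom.letters_injective (T := flat T) ((hl f).trans (hl' f).symm)
  subst hm
  have hc : @Fc = @Gc := by
    funext X Y α
    exact GCell.thin (T := flat T) ((hs α).trans (ks α).symm) ((ht α).trans (kt α).symm)
  subst hc
  rfl

theorem existsUnique_isAssociator (T : ∀ u, β u → Theta) :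
    ∃! J : TwoFunctor (nested T) (gray (flat fun u i => (T u i).toTwoCat)),
      IsAssociator (A := fun u i => (T u i).toTwoCat) J := by
  obtain ⟨J, h, h'⟩ := exists_assoc T
  exact ⟨J, isAssociator_of_letters h h', fun J' hJ' =>
    IsAssociator.unique hJ' (isAssociator_of_letters h h')⟩

end Associator

/-! ### The image of the comparison map -/

section Image

variable {U : Type} {β : U → Type} [LinearOrder U] [∀ u, LinearOrder (β u)]
  {T : ∀ u, β u → Theta}

/-- The composite of `χ`, `⊠ ψ` and the associativity 2-functor. -/
noncomputable def assembled (J : TwoFunctor (nested T) (gray (fun p => (flat T p).toTwoCat)))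
    {κ : Theta} {ζ : U → Theta} (χ : TwoFunctor κ.toTwoCat (gray (fun u => (ζ u).toTwoCat)))
    (ψ : ∀ u, TwoFunctor (ζ u).toTwoCat (gray (fun i => (T u i).toTwoCat))) :
    TwoFunctor κ.toTwoCat (gray (fun p => (flat T p).toTwoCat)) :=
  CategoryStruct.comp (obj := TwoCat) χ (CategoryStruct.comp (obj := TwoCat)
    (grayMap (B := fun u => gray (fun i => (T u i).toTwoCat)) ψ) J)

variable {J : TwoFunctor (nested T) (gray (fun p => (flat T p).toTwoCat))}
  (hJ : IsAssociator (A := fun u i => (T u i).toTwoCat) J) {κ : Theta} {ζ : U → Theta}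
  (χ : TwoFunctor κ.toTwoCat (gray (fun u => (ζ u).toTwoCat)))
  (ψ : ∀ u, TwoFunctor (ζ u).toTwoCat (gray (fun i => (T u i).toTwoCat)))

include hJ

theorem lett_assembled (k v : ℕ) : (grayModel (flat T)).lett (assembled J χ ψ) k v =
    ((grayModel ζ).lett χ k v).flatMap (fun a =>
      ((grayModel (T a.1)).lett (ψ a.1) a.2.1 a.2.2).map (push ((sigmaColoring β).e a.1))) :=
  (hJ.letters_map _).trans (GHom.nest_map ψ _)

theorem posN_assembled (k : ℕ) (u : U) (i : β u) :
    (grayModel (flat T)).posN (assembled J χ ψ) k ((sigmaColoring β).e u i) =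
      (grayModel (T u)).posN (ψ u) ((grayModel ζ).posN χ k u) i := by
  refine Eq.trans (congrArg Theta.pos (hJ.obj _ _)) ?_
  exact (congrFun ((grayModel (T u)).posN_val (ψ u) (χ.obj (κ.vert k) u)) i).symm

end Image

section Flat

variable {ι U : Type} [LinearOrder ι] [LinearOrder U] {β : U → Type} [∀ u, LinearOrder (β u)]
  (c : Coloring ι U β) {ζ : U → Theta} {T : ι → Theta}

/-- If every letter of a path of colours is replaced by a path of this colour, then the order of
two letters of the same colour can change only if they replace the same letter, and then all the
letters in between have the same colour. -/
theorem purePair_flatMap {L L' : List (Letter U)} {x y : U → ℕ} (h : IsPath ζ x L y)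
    (h' : IsPath ζ x L' y) {P : ∀ u, ℕ → β u → ℕ} {E : ∀ u, ℕ → ℕ → List (Letter (β u))}
    (hE : ∀ u k v, IsPath (fun i => T (c.e u i)) (P u k) (E u k v) (P u (k + 1)))
    (hn : ((L.flatMap (fun a => (E a.1 a.2.1 a.2.2).map (push (c.e a.1)))).map Letter.key).Nodup) :
    c.PurePair (L.flatMap (fun a => (E a.1 a.2.1 a.2.2).map (push (c.e a.1))))
      (L'.flatMap (fun a => (E a.1 a.2.1 a.2.2).map (push (c.e a.1)))) := by
  set E' : Letter U → List (Letter ι) := fun a => (E a.1 a.2.1 a.2.2).map (push (c.e a.1)) with hE'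
  have hcol : ∀ (a : Letter U) (σ : ι × ℕ), σ ∈ (E' a).map Letter.key → c.col σ.1 = a.1 := by
    intro a σ hσ
    obtain ⟨b, hb, rfl⟩ := List.mem_map.1 hσ
    obtain ⟨d, -, rfl⟩ := List.mem_map.1 hb
    exact c.col_e _ _
  have hkey : ∀ (u : U) (m v v' : ℕ) (σ : ι × ℕ), σ ∈ (E' (u, m, v)).map Letter.key →
      σ ∈ (E' (u, m, v')).map Letter.key := by
    intro u m v v' σ hσ
    obtain ⟨b, hb, rfl⟩ := List.mem_map.1 hσ
    obtain ⟨d, hd, rfl⟩ := List.mem_map.1 hb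
    have h₁ : (d.1, d.2.1) ∈ (E u m v').map Letter.key :=
      (hE u m v').mem_keys_iff.2 ((hE u m v).mem_keys_iff.1 (List.mem_map_of_mem hd))
    obtain ⟨w, hw⟩ := mem_keys.1 h₁
    exact mem_keys.2 ⟨w, List.mem_map.2 ⟨_, hw, rfl⟩⟩
  have hfind : ∀ (K : List (Letter U)) (σ : ι × ℕ), σ ∈ (K.flatMap E').map Letter.key →
      ∃ a ∈ K, σ ∈ (E' a).map Letter.key := by
    intro K σ hσ
    rw [List.map_flatMap, List.mem_flatMap] at hσ
    exact hσ
  have hsplit : ∀ (K : List (Letter U)) (σ τ : ι × ℕ), Bef (K.flatMap E') σ τ →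
      (∃ A a B, K = A ++ a :: B ∧ σ ∈ (E' a).map Letter.key ∧ τ ∈ (E' a).map Letter.key) ∨
      ∃ a b, Bef K a.key b.key ∧ σ ∈ (E' a).map Letter.key ∧ τ ∈ (E' b).map Letter.key := by
    intro K
    induction K with
    | nil => exact fun σ τ hb => absurd hb not_bef_nil
    | cons a K ih =>
      intro σ τ hb
      rw [List.flatMap_cons, bef_append] at hb
      rcases hb with hb | ⟨h₁, h₂⟩ | hb
      · exact .inl ⟨[], a, K, rfl, hb.mem_left, hb.mem_right⟩
      · obtain ⟨b, hb, h₃⟩ := hfind _ _ h₂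
        exact .inr ⟨a, b, bef_cons.2 (.inl ⟨rfl, List.mem_map_of_mem hb⟩), h₁, h₃⟩
      · rcases ih _ _ hb with ⟨A, b, B, rfl, h₁, h₂⟩ | ⟨d, b, h₀, h₁, h₂⟩
        · exact .inl ⟨a :: A, b, B, rfl, h₁, h₂⟩
        · exact .inr ⟨d, b, bef_cons.2 (.inr h₀), h₁, h₂⟩
  intro σ τ hb hστ
  rcases hsplit L σ τ hb with ⟨A, a, B, rfl, h₁, h₂⟩ | ⟨a, b, h₀, h₁, h₂⟩
  · refine .inr fun μ hσμ hμτ => ?_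
    rw [List.flatMap_append, List.flatMap_cons] at hσμ hμτ hn
    have hμ := hσμ.mem_right
    rw [List.map_append, List.map_append, List.mem_append, List.mem_append] at hμ
    rcases hμ with hμ | hμ | hμ
    · exact absurd hσμ (Bef.asymm hn (bef_append.2 (.inr (.inl ⟨hμ, by
        rw [List.map_append]; exact List.mem_append_left _ h₁⟩))))
    · rw [hcol _ _ hμ, hcol _ _ h₁]
    · exact absurd hμτ (Bef.asymm hn (bef_append.2 (.inr (.inr
        (bef_append.2 (.inr (.inl ⟨h₂, hμ⟩)))))))
  · refine .inl ?_
    obtain ⟨u, m, v⟩ := a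
    obtain ⟨u', m', v'⟩ := b
    obtain rfl : u = u' := (hcol _ _ h₁).symm.trans (hστ.trans (hcol _ _ h₂))
    have hm := h.mem_keys_iff.1 h₀.mem_left
    have hm' := h.mem_keys_iff.1 h₀.mem_right
    have hlt : m < m' := by
      rcases lt_trichotomy m m' with hlt | rfl | hlt
      · exact hlt
      · exact absurd rfl (h₀.ne h.nodup)
      · exact absurd h₀ ((h.bef_of_lt hlt hm'.1 hm.2).asymm h.nodup)
    obtain ⟨L₁, L₂, rfl, h₃, h₄⟩ := bef_iff.1 (h'.bef_of_lt hlt hm.1 hm'.2)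
    obtain ⟨w, hw⟩ := mem_keys.1 h₃
    obtain ⟨w', hw'⟩ := mem_keys.1 h₄
    rw [List.flatMap_append]
    refine bef_iff.2 ⟨_, _, rfl, ?_, ?_⟩
    · rw [List.map_flatMap]
      exact List.mem_flatMap.2 ⟨_, hw, hkey _ _ _ _ _ h₁⟩
    · rw [List.map_flatMap]
      exact List.mem_flatMap.2 ⟨_, hw', hkey _ _ _ _ _ h₂⟩

end Flat

section Image

variable {U : Type} {β : U → Type} [LinearOrder U] [∀ u, LinearOrder (β u)]
  {T : ∀ u, β u → Theta} {J : TwoFunctor (nested T) (gray (fun p => (flat T p).toTwoCat))}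
  (hJ : IsAssociator (A := fun u i => (T u i).toTwoCat) J) {κ : Theta}

include hJ

/-- The image of the comparison map consists of pure cells. -/
theorem pure_assembled {ζ : U → Theta}
    (χ : TwoFunctor κ.toTwoCat (gray (fun u => (ζ u).toTwoCat)))
    (ψ : ∀ u, TwoFunctor (ζ u).toTwoCat (gray (fun i => (T u i).toTwoCat))) :
    (grayModel (flat T)).Pure (assembled J χ ψ) (sigmaColoring β) := by
  intro k v v'
  have hn := ((grayModel (flat T)).lett_path (assembled J χ ψ) k v).nodup
  rw [lett_assembled hJ] at hn
  rw [lett_assembled hJ, lett_assembled hJ]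
  exact purePair_flatMap (T := flat T) (sigmaColoring β) ((grayModel ζ).lett_path χ k v)
    ((grayModel ζ).lett_path χ k v') (P := fun u => (grayModel (T u)).posN (ψ u))
    (E := fun u => (grayModel (T u)).lett (ψ u))
    (fun u k v => (grayModel (T u)).lett_path (ψ u) k v) hn

variable [∀ u, Fintype (β u)] {φ : TwoFunctor κ.toTwoCat (gray (fun p => (flat T p).toTwoCat))}
  {N Q : ℕ}

/-- The comparison map sends the canonical factorization of a pure cell to this cell. -/
theorem assembled_eq_of_canonical
    {X : TwoFunctor κ.toTwoCat (gray (fun _ : U => (⟨N, fun _ => Q⟩ : Theta).toTwoCat))}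
    {Ψ : ∀ u, TwoFunctor (⟨N, fun _ => Q⟩ : Theta).toTwoCat (gray (fun i => (T u i).toTwoCat))}
    (hp : (grayModel (flat T)).Pure φ (sigmaColoring β))
    (h : (grayModel (flat T)).Canonical φ (sigmaColoring β) (grayModel _)
      (fun u => grayModel (T u)) X Ψ) : assembled J X Ψ = φ := by
  refine (grayModel (flat T)).ext (fun k hk => ?_) (fun k v hok => ?_)
  · funext p
    obtain ⟨u, i⟩ := p
    refine (posN_assembled hJ X Ψ k u i).trans ?_
    rw [h.posX k hk]
    exact congrFun (h.posΨ_deg hp hk u) i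
  · rw [lett_assembled hJ]
    exact h.flatMap_lett hok

end Image

/-! ### Uniqueness of the canonical factorization -/

/-- The colouring with only one colour. -/
def oneColoring (β : Type) [LinearOrder β] : Coloring β Unit (fun _ => β) where
  col _ := ()
  e _ := id
  strictMono _ := strictMono_id
  mem_range := by simp
  lt_of_col_lt := fun h => absurd h (lt_irrefl _)

/-- The colouring in which all the elements have different colours. -/
def idColoring (U : Type) [LinearOrder U] : Coloring U U (fun _ => Unit) where
  col u := u
  e u _ := u
  strictMono _ := Subsingleton.strictMono _
  mem_range := by
    intro u i
    simp [eq_comm]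
  lt_of_col_lt := id

namespace Coloring

variable {ι U : Type} [LinearOrder ι] [LinearOrder U] {β : U → Type} [∀ u, LinearOrder (β u)]
  (c : Coloring ι U β) {E : ∀ u, ℕ → ℕ → List (Letter (β u))}

/-- The part of colour `u` of a concatenation of monochromatic words is the concatenation of the
words of colour `u`. -/
theorem pull_flatMap (u : U) (L : List (Letter U)) :
    pull (c.e u) (L.flatMap (fun a => (E a.1 a.2.1 a.2.2).map (push (c.e a.1)))) =
      (pull ((idColoring U).e u) L).flatMap (fun a => E u a.2.1 a.2.2) := by
  induction L with
  | nil => rfl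
  | cons a L ih =>
    rw [List.flatMap_cons, pull_append, ih, ← List.singleton_append, pull_append,
      List.flatMap_append]
    congr 1
    by_cases h : a.1 = u
    · obtain ⟨u', p⟩ := a
      obtain rfl : u' = u := h
      obtain ⟨i, -, hi⟩ := (idColoring U).pull_singleton (u', p)
      change pull ((idColoring U).e u') [(u', p)] = [(i, p)] at hi
      rw [pull_push _ (c.strictMono u').injective, hi]
      simp
    · rw [(idColoring U).pull_singleton_of_ne (a := a) h, c.pull_eq_nil]
      · rfl
      · intro b hb
        obtain ⟨d, -, rfl⟩ := List.mem_map.1 hb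
        exact fun h' => h ((c.col_e _ _).symm.trans h')

/-- A cut in a concatenation of monochromatic words is a cut between two of these words. -/
theorem exists_split_of_flatMap {u : U} {L : List (Letter U)} {W₁ W₂ : List (Letter ι)}
    (h : L.flatMap (fun a => (E a.1 a.2.1 a.2.2).map (push (c.e a.1))) = W₁ ++ W₂)
    (h' : W₁ = [] ∨ (c.colors W₂).head? ≠ some u) :
    ∃ L₁ L₂, L = L₁ ++ L₂ ∧ pull (c.e u) W₁ =
      pull (c.e u) (L₁.flatMap (fun a => (E a.1 a.2.1 a.2.2).map (push (c.e a.1)))) := by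
  induction L generalizing W₁ with
  | nil =>
    obtain ⟨rfl, rfl⟩ := List.append_eq_nil_iff.1 h.symm
    exact ⟨[], [], rfl, rfl⟩
  | cons a L ih =>
    rw [List.flatMap_cons] at h
    have hcol : ∀ b ∈ (E a.1 a.2.1 a.2.2).map (push (c.e a.1)), c.col b.1 = a.1 := by
      intro b hb
      obtain ⟨d, -, rfl⟩ := List.mem_map.1 hb
      exact c.col_e _ _
    rcases List.append_eq_append_iff.1 h with ⟨W₁', rfl, h₁⟩ | ⟨R, h₁, rfl⟩
    · obtain ⟨L₁, L₂, rfl, h₂⟩ := ih h₁ (h'.imp_left fun h => (List.append_eq_nil_iff.1 h).2)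
      exact ⟨a :: L₁, L₂, rfl, by rw [List.flatMap_cons, pull_append, h₂, pull_append]⟩
    · rcases R with _ | ⟨b, R⟩
      · rw [List.append_nil] at h₁
        exact ⟨[a], L, rfl, by rw [← h₁]; simp⟩
      · refine ⟨[], a :: L, rfl, ?_⟩
        rcases h' with rfl | h'
        · rfl
        · rw [h₁] at hcol
          have hb : c.col b.1 ≠ u := by simpa using h'
          rw [hcol b (by simp)] at hb
          exact c.pull_eq_nil fun d hd => by rw [hcol d (by simp [hd])]; exact hb

end Coloring

theorem slice_flatMap {α α' : Type} {L : List α} {L' : List α'} {f : α → List α'} {a b : ℕ}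
    (hab : a ≤ b) (ha : (L.take a).flatMap f = L'.take a) (hb : (L.take b).flatMap f = L'.take b) :
    (slice L a b).flatMap f = slice L' a b := by
  rw [← take_append_slice L hab, List.flatMap_append, ha, ← take_append_slice L' hab] at hb
  exact List.append_cancel_left hb

namespace PathModel

variable {ι : Type} [LinearOrder ι] {T : ι → Theta} {C : TwoCat} (M : PathModel T C) {κ : Theta}
  (F : TwoFunctor κ.toTwoCat C)

/-- A functor sends paths to paths. -/
theorem path_flatMap {x y : Unit → ℕ} {L : List (Letter Unit)}
    (h : IsPath (fun _ => κ) x L y) :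
    IsPath T (M.posN F (x ())) (L.flatMap (fun a => M.lett F a.2.1 a.2.2)) (M.posN F (y ())) := by
  induction L generalizing x with
  | nil =>
    obtain rfl : x = y := h
    rfl
  | cons a L ih =>
    obtain ⟨⟨⟩, m, v⟩ := a
    rw [List.flatMap_cons, show x () = m from h.1]
    refine (M.lett_path F _ _).append ?_
    have := ih h.2.2
    rwa [Function.update_self] at this

variable {l : Theta} (G : TwoFunctor l.toTwoCat κ.toTwoCat)

theorem lett_comp (k v : ℕ) : M.lett (CategoryStruct.comp (obj := TwoCat) G F) k v =
    (κ.model.lett G k v).flatMap (fun a => M.lett F a.2.1 a.2.2) :=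
  M.word_map F _

theorem posN_comp (k : ℕ) : M.posN (CategoryStruct.comp (obj := TwoCat) G F) k =
    M.posN F (κ.model.posN G k ()) :=
  (M.posN_val F (G.obj (l.vert k))).symm

variable {U : Type} {β : U → Type} [LinearOrder U] [∀ u, LinearOrder (β u)]
  {c : Coloring ι U β} [∀ u, Fintype (β u)] {F M}

theorem Cut.le_length {u : U} {m : ℕ} (h : M.Cut F c u m) (v : ℕ) :
    m ≤ (pull (c.e u) (M.pre F κ.n v)).length := by
  obtain ⟨k, hk, v', C₁, C₂, hC, -, rfl⟩ := h
  obtain ⟨W₁, W₂, hW, rfl, rfl⟩ := List.map_eq_append_iff.1 hC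
  change ((_ ++ c.colors W₁).count u) ≤ _
  rw [← M.colors_pre F c k v', ← c.colors_append, ← c.length_pull]
  have h₁ := M.deg_eq_pre F c κ.n v u
  have h₂ := M.deg_eq_pre F c κ.n v' u
  obtain ⟨B, hB⟩ := M.exists_pre_eq F (Nat.succ_le_of_lt hk) v'
  rw [Nat.succ_eq_add_one, pre_succ, hW] at hB
  have h₃ : (pull (c.e u) (M.pre F k v' ++ W₁)).length ≤
      (pull (c.e u) (M.pre F κ.n v')).length := by
    rw [hB]
    simp only [pull_append, List.length_append]
    omega
  omega

theorem cutAt_le_length (u : U) (j v : ℕ) :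
    M.cutAt F c u j ≤ (pull (c.e u) (M.pre F κ.n v)).length := by
  rcases lastCut_spec (P := M.Cut F c u) (c := M.deg F c 0 u) j with h | h
  · exact (Nat.zero_le _).trans' h.le
  · exact h.le_length v

end PathModel

/-- With only one colour every functor is pure. -/
theorem PathModel.pure_oneColoring {ι : Type} [LinearOrder ι] {T : ι → Theta} {C : TwoCat}
    (M : PathModel T C) {κ : Theta} (F : TwoFunctor κ.toTwoCat C) : M.Pure F (oneColoring ι) :=
  fun _ _ _ _ _ _ _ => .inr fun _ _ _ => rfl

/-- With all colours different every functor is pure. -/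
theorem PathModel.pure_idColoring {ι : Type} [LinearOrder ι] {T : ι → Theta} {C : TwoCat}
    (M : PathModel T C) {κ : Theta} (F : TwoFunctor κ.toTwoCat C) : M.Pure F (idColoring ι) := by
  rintro k v v' ⟨i, m⟩ ⟨j, l⟩ hb h
  obtain rfl : i = j := h
  have hm := (M.lett_path F k v).mem_keys_iff.1 hb.mem_left
  have hl := (M.lett_path F k v).mem_keys_iff.1 hb.mem_right
  refine .inl ((M.lett_path F k v').bef_of_lt ?_ hm.1 hl.2)
  rcases lt_trichotomy m l with hlt | rfl | hlt
  · exact hlt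
  · exact absurd rfl (hb.ne (M.lett_path F k v).nodup)
  · exact absurd hb (((M.lett_path F k v).bef_of_lt hlt hl.1 hm.2).asymm
      (M.lett_path F k v).nodup)

theorem Coloring.colors_flatMap {ι U : Type} [LinearOrder ι] [LinearOrder U] {β : U → Type}
    [∀ u, LinearOrder (β u)] (c : Coloring ι U β) (E : ∀ u, ℕ → ℕ → List (Letter (β u)))
    (L : List (Letter U)) :
    c.colors (L.flatMap (fun a => (E a.1 a.2.1 a.2.2).map (push (c.e a.1)))) =
      L.flatMap (fun a => List.replicate (E a.1 a.2.1 a.2.2).length a.1) := by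
  unfold Coloring.colors
  rw [List.map_flatMap]
  refine List.flatMap_congr fun a _ => ?_
  rw [List.map_map, List.eq_replicate_iff]
  refine ⟨by simp, fun u hu => ?_⟩
  obtain ⟨d, -, rfl⟩ := List.mem_map.1 hu
  exact c.col_e _ _

/-- Every functor factors through some `[N; Q, …, Q]`, by a functor that sends a vertex to the
sum of the coordinates of its image. -/
theorem PathModel.exists_unit_factorization {ι : Type} [LinearOrder ι] [Fintype ι] {T : ι → Theta}
    {C : TwoCat} (M : PathModel T C) {κ : Theta} (F : TwoFunctor κ.toTwoCat C) :
    ∃ (ω : Theta) (g : TwoFunctor κ.toTwoCat ω.toTwoCat) (F' : TwoFunctor ω.toTwoCat C),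
      CategoryStruct.comp (obj := TwoCat) g F' = F ∧
      (∀ k ≤ κ.n, ω.model.posN g k () = ∑ i, M.posN F k i) ∧
      (∀ k ≤ κ.n, M.posN F' (∑ i, M.posN F k i) = M.posN F k) ∧
      ∀ k v, κ.Ok k v → (ω.model.lett g k v).length = (M.lett F k v).length := by
  have hp := M.pure_oneColoring F
  obtain ⟨g, F', h⟩ := M.exists_canonical F (oneColoring ι) (N := M.deg F (oneColoring ι) κ.n ())
    (Q := ∑ k, κ.q k) (Theta.model _) (fun _ => M) hp (fun _ => le_rfl) fun k v hok => hok.2.trans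
      (Finset.single_le_sum (f := κ.q) (fun _ _ => Nat.zero_le _) (Finset.mem_univ _))
  have hpos : ∀ k ≤ κ.n, M.posN (F' ()) (∑ i, M.posN F k i) = M.posN F k :=
    fun k hk => h.posΨ_deg hp hk ()
  refine ⟨_, g, F' (), M.ext (fun k hk => ?_) (fun k v hok => ?_), fun k hk => ?_, hpos,
    fun k v hok => ?_⟩
  · rw [M.posN_comp, h.posX k hk]
    exact hpos k hk
  · rw [M.lett_comp]
    refine Eq.trans (List.flatMap_congr fun a _ => ?_) (h.flatMap_lett hok)
    exact (List.map_id _).symm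
  · rw [h.posX k hk]
    rfl
  · rw [h.lettX k v hok, ← List.length_map (f := Prod.fst), colorPath_map_fst]
    exact List.length_map _

section Unique

variable {U : Type} {β : U → Type} [LinearOrder U] [∀ u, LinearOrder (β u)]
  {T : ∀ u, β u → Theta} {J : TwoFunctor (nested T) (gray (fun p => (flat T p).toTwoCat))}

/-- The comparison map is compatible with the relation that defines the coend. -/
theorem assembled_comp {κ : Theta} {ζ ω : U → Theta}
    (χ : TwoFunctor κ.toTwoCat (gray (fun u => (ζ u).toTwoCat)))
    (g : ∀ u, TwoFunctor (ζ u).toTwoCat (ω u).toTwoCat)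
    (ψ : ∀ u, TwoFunctor (ω u).toTwoCat (gray (fun i => (T u i).toTwoCat))) :
    assembled J (CategoryStruct.comp (obj := TwoCat) χ
      (grayMap (A := fun u => (ζ u).toTwoCat) (B := fun u => (ω u).toTwoCat) g)) ψ =
      assembled J χ (fun u => CategoryStruct.comp (obj := TwoCat) (g u) (ψ u)) :=
  (congrArg (fun G => CategoryStruct.comp (obj := TwoCat) χ (CategoryStruct.comp (obj := TwoCat) G J))
    (grayMap_comp (A := fun u => (ζ u).toTwoCat) (B := fun u => (ω u).toTwoCat)
      (C := fun u => gray (fun i => (T u i).toTwoCat)) g ψ)).symm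

/-- Cells of the tensor product, given by representatives. -/
def tensorMk {κ : Theta} {ζ : U → Theta}
    (χ : TwoFunctor κ.toTwoCat (gray (fun u => (ζ u).toTwoCat)))
    (ψ : ∀ u, TwoFunctor (ζ u).toTwoCat (gray (fun i => (T u i).toTwoCat))) :
    Quot (PreTensor.Rel (fun u => nerve (gray (fun i => (T u i).toTwoCat))) κ) :=
  Quot.mk _ ⟨ζ, ψ, χ⟩

/-- The relation that defines the coend. -/
theorem tensorMk_comp {κ : Theta} {ζ ω : U → Theta}
    (χ : TwoFunctor κ.toTwoCat (gray (fun u => (ζ u).toTwoCat)))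
    (g : ∀ u, TwoFunctor (ζ u).toTwoCat (ω u).toTwoCat)
    (ψ : ∀ u, TwoFunctor (ω u).toTwoCat (gray (fun i => (T u i).toTwoCat))) :
    tensorMk χ (fun u => CategoryStruct.comp (obj := TwoCat) (g u) (ψ u)) =
      tensorMk (CategoryStruct.comp (obj := TwoCat) χ
        (grayMap (A := fun u => (ζ u).toTwoCat) (B := fun u => (ω u).toTwoCat) g)) ψ :=
  Quot.sound (.mk (X := fun u => nerve (gray (fun i => (T u i).toTwoCat))) g ψ χ)

variable (hJ : IsAssociator (A := fun u i => (T u i).toTwoCat) J) [∀ u, Fintype (β u)]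

include hJ

/-- Every representative of a cell of the tensor product is equivalent to the canonical
factorization of its image. -/
theorem tensorMk_eq_of_canonical {κ : Theta} {ζ : U → Theta}
    (χ : TwoFunctor κ.toTwoCat (gray (fun u => (ζ u).toTwoCat)))
    (ψ : ∀ u, TwoFunctor (ζ u).toTwoCat (gray (fun i => (T u i).toTwoCat))) {N Q : ℕ}
    {X : TwoFunctor κ.toTwoCat (gray (fun _ : U => (⟨N, fun _ => Q⟩ : Theta).toTwoCat))}
    {Ψ : ∀ u, TwoFunctor (⟨N, fun _ => Q⟩ : Theta).toTwoCat (gray (fun i => (T u i).toTwoCat))}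
    (h : (grayModel (flat T)).Canonical (assembled J χ ψ) (sigmaColoring β) (grayModel _)
      (fun u => grayModel (T u)) X Ψ) : tensorMk χ ψ = tensorMk X Ψ := by
  -- Factor `ψ u` as `g u` followed by `ψ' u`, with `g u` preserving the lengths of words, and let
  -- `χ'` be the composite of `χ` and `⊠ g`.  The pairs `(χ, ψ)` and `(χ', ψ')` represent the same
  -- cell.
  choose ω g ψ' hg hpos hpos' hlen using
    fun u => (grayModel (T u)).exists_unit_factorization (ψ u)
  obtain rfl : (fun u => CategoryStruct.comp (obj := TwoCat) (g u) (ψ' u)) = ψ := funext hg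
  set ψ : ∀ u, TwoFunctor (ζ u).toTwoCat (gray (fun i => (T u i).toTwoCat)) :=
    fun u => CategoryStruct.comp (obj := TwoCat) (g u) (ψ' u) with hψ
  set χ' : TwoFunctor κ.toTwoCat (gray (fun u => (ω u).toTwoCat)) :=
    CategoryStruct.comp (obj := TwoCat) χ
      (grayMap (A := fun u => (ζ u).toTwoCat) (B := fun u => (ω u).toTwoCat) g) with hχ'
  have hφ : assembled J χ' ψ' = assembled J χ ψ := assembled_comp χ g ψ'
  have hlett : ∀ k v, (grayModel ω).lett χ' k v = ((grayModel ζ).lett χ k v).flatMap (fun a =>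
      ((ω a.1).model.lett (g a.1) a.2.1 a.2.2).map (push ((idColoring U).e a.1))) :=
    fun k v => GHom.letters_map g _
  have hpφ := pure_assembled hJ χ ψ
  set φ := assembled J χ ψ with hφ'
  set M := grayModel (flat T) with hM
  set c := sigmaColoring β with hc
  have hposφ : ∀ k u i, M.posN φ k (c.e u i) =
      (grayModel (T u)).posN (ψ u) ((grayModel ζ).posN χ k u) i := posN_assembled hJ χ ψ
  -- The sequences of colours, the degrees and hence the cuts of `χ'`, whose coordinates are
  -- regarded as having different colours, are those of `φ`.
  have hcol : ∀ k v, (idColoring U).colors ((grayModel ω).lett χ' k v) =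
      c.colors (M.lett φ k v) := by
    intro k v
    rw [hlett, lett_assembled hJ]
    refine ((idColoring U).colors_flatMap (fun u => (ω u).model.lett (g u)) _).trans
      (Eq.trans ?_ (c.colors_flatMap (fun u => (grayModel (T u)).lett (ψ u)) _).symm)
    refine List.flatMap_congr fun a ha => ?_
    rw [hlen a.1 _ _ (((grayModel ζ).lett_path χ k v).ok ha)]
  have hposχ' : ∀ k u, (grayModel ω).posN χ' k u = M.deg φ c k u := by
    intro k u
    have h₁ : (grayModel ω).posN χ' k u = (ω u).model.posN (g u) ((grayModel ζ).posN χ k u) () :=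
      (congrFun ((ω u).model.posN_val (g u) (χ.obj (κ.vert k) u)) ()).symm
    rw [h₁, hpos u _ ((grayModel ζ).posN_le χ k u)]
    exact Finset.sum_congr rfl fun i _ => (hposφ k u i).symm
  have hdeg : (grayModel ω).deg χ' (idColoring U) = M.deg φ c := by
    funext k u
    rw [← hposχ']
    exact Fintype.sum_unique _
  have hcut : (grayModel ω).cutAt χ' (idColoring U) = M.cutAt φ c := by
    funext u j
    unfold PathModel.cutAt PathModel.Cut
    simp only [hcol, hdeg]
  -- The canonical factorization of `χ'` therefore consists of `X` and functors `γ u`, and it remains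
  -- to see that the composite of `γ u` and `ψ' u` is `Ψ u`.
  obtain ⟨X', γ, h'⟩ := (grayModel ω).exists_canonical χ' (idColoring U) (N := N) (Q := Q)
    (grayModel (fun _ : U => ⟨N, fun _ => Q⟩)) (fun u => (ω u).model)
    ((grayModel ω).pure_idColoring χ') (by rw [hdeg]; exact h.le_N) h.le_Q
  have hX : X' = X := by
    refine (grayModel (fun _ : U => ⟨N, fun _ => Q⟩)).ext (fun k hk => ?_) (fun k v hok => ?_)
    · rw [h'.posX k hk, h.posX k hk, hdeg]
    · rw [h'.lettX k v hok, h.lettX k v hok, hdeg, hcol]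
  subst hX
  have hXγ : CategoryStruct.comp (obj := TwoCat) X' (grayMap
      (A := fun _ : U => (⟨N, fun _ => Q⟩ : Theta).toTwoCat) (B := fun u => (ω u).toTwoCat) γ) =
      χ' := by
    refine (grayModel ω).ext (fun k hk => ?_) (fun k v hok => ?_)
    · funext u
      have h₁ := (congrFun ((ω u).model.posN_val (γ u) (X'.obj (κ.vert k) u)) ()).symm
      refine h₁.trans ?_
      change (ω u).model.posN (γ u) ((grayModel (fun _ : U => ⟨N, fun _ => Q⟩)).posN X' k u) () = _
      rw [h'.posX k hk]
      exact congrFun (h'.posΨ_deg ((grayModel ω).pure_idColoring χ') hk u) ()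
    · exact (GHom.letters_map γ _).trans (h'.flatMap_lett hok)
  -- The part of colour `u` of `φ` is obtained from the one of `χ'` by applying `ψ' u`.
  have hfull : ∀ u v, (pull ((idColoring U).e u) ((grayModel ω).pre χ' κ.n v)).flatMap
      (fun a => (grayModel (T u)).lett (ψ' u) a.2.1 a.2.2) = pull (c.e u) (M.pre φ κ.n v) := by
    intro u v
    rw [← c.pull_flatMap (E := fun u => (grayModel (T u)).lett (ψ' u)), PathModel.pre,
      PathModel.pre, List.flatMap_assoc]
    refine congrArg _ (List.flatMap_congr fun k _ => ?_)
    rw [← hφ, lett_assembled hJ]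
  have hstart : ∀ u, (grayModel (T u)).posN (ψ' u) ((grayModel ω).posN χ' 0 u) =
      fun i => M.posN φ 0 (c.e u i) := by
    intro u
    funext i
    rw [hposφ, hposχ', ← hpos' u _ ((grayModel ζ).posN_le χ 0 u)]
    refine congrFun (congrArg _ (Finset.sum_congr rfl fun i _ => hposφ 0 u i)) i
  have hVpath : ∀ u j v, IsPath (fun _ : Unit => ω u) (fun _ => (grayModel ω).posN χ' 0 u)
      ((pull ((idColoring U).e u) ((grayModel ω).pre χ' κ.n v)).take (M.cutAt φ c u j))
      (fun _ => (grayModel ω).posN χ' 0 u + M.cutAt φ c u j) := by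
    intro u j v
    have h₁ := (grayModel ω).cutAt_path ((grayModel ω).pure_idColoring χ') u j v
    rw [hcut] at h₁
    have h₂ := h₁.sum_eq
    have h₃ := (grayModel ω).cutAt_le_length (F := χ') (c := idColoring U) u j v
    rw [hcut] at h₃
    rw [List.length_take, min_eq_left h₃, Fintype.sum_unique, Fintype.sum_unique] at h₂
    have h₄ : (grayModel ω).endAt χ' (idColoring U) u (M.cutAt φ c u j) =
        fun _ => (grayModel ω).posN χ' 0 u + M.cutAt φ c u j := funext fun _ => h₂
    rw [h₄] at h₁
    exact h₁
  -- A cut lies between the words that replace two letters of `χ`, so it is at the image of a vertex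
  -- `y` of `ζ u`; there `ψ' u` preserves the degree.
  have hcutpos : ∀ u j, ∑ i, (grayModel (T u)).posN (ψ' u)
      ((grayModel ω).posN χ' 0 u + M.cutAt φ c u j) i =
        (grayModel ω).posN χ' 0 u + M.cutAt φ c u j := by
    intro u j
    suffices H : ∃ y ≤ (ζ u).n, ∑ i, (grayModel (T u)).posN (ψ u) y i =
        (grayModel ω).posN χ' 0 u + M.cutAt φ c u j by
      obtain ⟨y, hy, hy'⟩ := H
      conv_lhs => rw [← hy', hpos' u y hy]
      exact hy'
    rcases lastCut_spec (P := M.Cut φ c u) (c := M.deg φ c 0 u) j with h₀ | h₀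
    · change M.cutAt φ c u j = 0 at h₀
      refine ⟨(grayModel ζ).posN χ 0 u, (grayModel ζ).posN_le χ 0 u, ?_⟩
      rw [h₀, add_zero, hposχ']
      exact Finset.sum_congr rfl fun i _ => (hposφ 0 u i).symm
    · change M.Cut φ c u (M.cutAt φ c u j) at h₀
      generalize M.cutAt φ c u j = m at h₀ ⊢
      obtain ⟨k, hk, v, C₁, C₂, hC, hcut, rfl⟩ := h₀
      obtain ⟨W₁, W₂, hW, rfl, rfl⟩ := List.map_eq_append_iff.1 hC
      change W₁.map _ = [] ∨ (c.colors W₂).head? ≠ some u at hcut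
      rw [List.map_eq_nil_iff] at hcut
      change ∃ y ≤ (ζ u).n, _ = _ + (_ ++ c.colors W₁).count u
      rw [lett_assembled hJ] at hW
      obtain ⟨L₁, L₂, hL, hL'⟩ :=
        c.exists_split_of_flatMap (E := fun u => (grayModel (T u)).lett (ψ u)) hW hcut
      have hp := (grayModel ζ).lett_path χ k v
      rw [hL] at hp
      obtain ⟨y, hy, hy'⟩ := isPath_append.1 hp
      refine ⟨y u, (hy'.le u).trans ((grayModel ζ).posN_le χ _ u), ?_⟩
      have h₁ := ((grayModel (T u)).path_flatMap (ψ u)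
        (hy.pull ((idColoring U).e u) ((idColoring U).strictMono u).injective)).sum_eq
      rw [← c.pull_flatMap u (E := fun u => (grayModel (T u)).lett (ψ u)), ← hL',
        c.length_pull] at h₁
      refine h₁.trans ?_
      rw [List.count_append, ← M.colors_pre φ c k v, ← c.length_pull u (M.pre φ k v), ← add_assoc, hposχ',
        ← M.deg_eq_pre φ c k v u]
      congr 1
      exact Finset.sum_congr rfl fun i _ => (hposφ k u i).symm
  -- Hence `ψ' u` sends the part before a cut of `χ'` to the part before the same cut of `φ`.
  have htake : ∀ u j v, ((pull ((idColoring U).e u) ((grayModel ω).pre χ' κ.n v)).take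
      (M.cutAt φ c u j)).flatMap (fun a => (grayModel (T u)).lett (ψ' u) a.2.1 a.2.2) =
        (pull (c.e u) (M.pre φ κ.n v)).take (M.cutAt φ c u j) := by
    intro u j v
    have h₁ := ((grayModel (T u)).path_flatMap (ψ' u) (hVpath u j v)).sum_eq
    rw [hcutpos, hstart] at h₁
    have h₂ : ∑ i, M.posN φ 0 (c.e u i) = (grayModel ω).posN χ' 0 u := (hposχ' 0 u).symm
    rw [h₂] at h₁
    have h₃ := hfull u v
    rw [← List.take_append_drop (M.cutAt φ c u j)
      (pull ((idColoring U).e u) ((grayModel ω).pre χ' κ.n v)), List.flatMap_append] at h₃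
    rw [← h₃]
    exact (List.take_left' (by omega)).symm
  have hγ : (fun u => CategoryStruct.comp (obj := TwoCat) (γ u) (ψ' u)) = Ψ := by
    funext u
    refine (grayModel (T u)).ext (fun j hj => ?_) (fun j v hok => ?_)
    · have h₀ : (ω u).model.posN (γ u) j = _ := h'.posΨ u j hj
      have h₀' : (grayModel (T u)).posN (Ψ u) j = M.endAt φ c u (M.cutAt φ c u j) := h.posΨ u j hj
      rw [PathModel.posN_comp, h₀, h₀', hcut]
      have h₁ := (grayModel ω).cutAt_path ((grayModel ω).pure_idColoring χ') u j 0
      rw [hcut] at h₁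
      have h₂ := (grayModel (T u)).path_flatMap (ψ' u) h₁
      rw [htake] at h₂
      have h₃ := M.cutAt_path hpφ u j 0
      rw [← hstart] at h₃
      exact h₂.unique h₃
    · have h₀ : (ω u).model.lett (γ u) j v = _ := h'.lettΨ u j v hok
      have h₀' : (grayModel (T u)).lett (Ψ u) j v = slice (pull (c.e u) (M.pre φ κ.n v))
        (M.cutAt φ c u j) (M.cutAt φ c u (j + 1)) := h.lettΨ u j v hok
      rw [PathModel.lett_comp, h₀, h₀', hcut]
      exact slice_flatMap (lastCut_mono (Nat.le_succ j)) (htake u j v) (htake u (j + 1) v)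
  rw [← hγ]
  exact (tensorMk_comp χ g ψ').trans ((congrArg (tensorMk · ψ') hXγ.symm).trans
    (tensorMk_comp X' γ ψ').symm)

end Unique

/-! ### Pure cells in terms of words -/

/-- The order in which the entries of a list without repetitions occur. -/
theorem idxOf_le_iff {α : Type} [BEq α] [LawfulBEq α] {L : List α} (h : L.Nodup) {a b : α}
    (ha : a ∈ L) (hb : b ∈ L) : L.idxOf a ≤ L.idxOf b ↔ a = b ∨ List.Sublist [a, b] L := by
  induction L with
  | nil => simp at ha
  | cons c L ih =>
    rw [List.nodup_cons] at h
    classical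
    by_cases hac : a = c
    · subst hac
      simp only [List.idxOf_cons_self, Nat.zero_le, true_iff]
      rcases List.mem_cons.1 hb with rfl | hb
      · exact .inl rfl
      · exact .inr ((List.singleton_sublist.2 hb).cons_cons a)
    · have ha' : a ∈ L := (List.mem_cons.1 ha).resolve_left hac
      rw [List.idxOf_cons_ne _ (Ne.symm hac)]
      by_cases hbc : b = c
      · subst hbc
        rw [List.idxOf_cons_self]
        refine ⟨fun h' => absurd h' (by omega), fun h' => ?_⟩
        rcases h' with rfl | h'
        · exact absurd rfl hac
        · cases h' with
          | cons _ h' => exact absurd (h'.subset (by simp)) h.1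
          | cons_cons _ h' => exact absurd rfl hac
      · have hb' : b ∈ L := (List.mem_cons.1 hb).resolve_left hbc
        rw [List.idxOf_cons_ne _ (Ne.symm hbc), Nat.succ_le_succ_iff, ih h.2 ha' hb']
        refine or_congr_right ⟨fun h' => h'.cons c, fun h' => ?_⟩
        cases h' with
        | cons _ h' => exact h'
        | cons_cons _ h' => exact absurd rfl hac

theorem Bef.trans {ι : Type} {L : List (Letter ι)} (hn : (L.map Letter.key).Nodup) {σ τ μ : ι × ℕ}
    (h : Bef L σ τ) (h' : Bef L τ μ) : Bef L σ μ := by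
  obtain ⟨L₁, L₂, rfl, h₁, h₂⟩ := bef_iff.1 h
  rcases bef_append.1 h' with h₃ | ⟨-, h₃⟩ | h₃
  · rw [List.map_append, List.nodup_append] at hn
    exact absurd rfl (hn.2.2 _ h₃.mem_left _ h₂)
  · exact bef_append.2 (.inr (.inl ⟨h₁, h₃⟩))
  · exact bef_append.2 (.inr (.inl ⟨h₁, h₃.mem_right⟩))

section Steps

variable {ι : Type} {T : ι → Theta} {x y : ∀ i, (T i).toTwoCat.Obj}

/-- A step from `k` to `k + 1` is denoted by its source `k` in words, but by its target `k + 1` in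
shuffles. -/
theorem GHom.steps_eq (f : GHom (fun i => (T i).toTwoCat) x y) :
    f.steps = (f.letters.map Letter.key).map (fun σ => (σ.1, σ.2 + 1)) := by
  induction f using Quotient.ind with | _ w => ?_
  induction w with
  | id => rfl
  | @gen x y i a b f h =>
    change List.map _ _ = List.map _ (List.map _ (Theta.Hom.word i f))
    unfold Theta.Hom.word
    rw [List.map_map, List.map_map, List.range'_succ_left, List.map_map]
    rfl
  | comp u v ih ih' =>
    change _ ++ _ = List.map _ (List.map _ (_ ++ _))
    rw [List.map_append, List.map_append]
    exact congrArg₂ _ ih ih'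

theorem mem_stepSet {σ : ι × ℕ} : σ ∈ stepSet x y ↔
    ∃ τ : ι × ℕ, σ = (τ.1, τ.2 + 1) ∧ vpos x τ.1 ≤ τ.2 ∧ τ.2 < vpos y τ.1 := by
  obtain ⟨i, k⟩ := σ
  constructor
  · rintro ⟨h₁, h₂⟩
    change Theta.pos (x i) < k at h₁
    change k ≤ Theta.pos (y i) at h₂
    exact ⟨(i, k - 1), Prod.ext rfl (by simp only; omega), by change Theta.pos (x i) ≤ k - 1; omega,
      by change k - 1 < Theta.pos (y i); omega⟩
  · rintro ⟨⟨j, l⟩, h, h₁, h₂⟩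
    obtain ⟨rfl, rfl⟩ := Prod.mk.inj h
    exact ⟨Nat.lt_succ_of_le h₁, h₂⟩

variable [LinearOrder ι]

theorem GHom.prec_iff (f : GHom (fun i => (T i).toTwoCat) x y) {σ τ : ι × ℕ}
    (hσ : σ ∈ f.letters.map Letter.key) (hτ : τ ∈ f.letters.map Letter.key) :
    f.Prec (σ.1, σ.2 + 1) (τ.1, τ.2 + 1) ↔ σ = τ ∨ Bef f.letters σ τ := by
  have hinj : Function.Injective (fun σ : ι × ℕ => (σ.1, σ.2 + 1)) := by
    rintro ⟨i, k⟩ ⟨j, l⟩ h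
    simpa using h
  unfold GHom.Prec
  rw [GHom.steps_eq, idxOf_le_iff (f.letters_path.nodup.map hinj)
    (List.mem_map_of_mem (f := fun σ : ι × ℕ => (σ.1, σ.2 + 1)) hσ)
    (List.mem_map_of_mem (f := fun σ : ι × ℕ => (σ.1, σ.2 + 1)) hτ), hinj.eq_iff]
  refine or_congr_right ?_
  unfold Bef
  refine ⟨fun h => ?_, fun h => h.map (fun σ : ι × ℕ => (σ.1, σ.2 + 1))⟩
  obtain ⟨l, hl, e⟩ := List.sublist_map_iff.1 h
  rcases l with _ | ⟨σ', _ | ⟨τ', _ | _⟩⟩ <;> simp at e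
  obtain ⟨⟨h₁, h₂⟩, h₃, h₄⟩ := e
  rwa [show σ = σ' from Prod.ext h₁ h₂, show τ = τ' from Prod.ext h₃ h₄]

end Steps

section Pure

variable {ι U : Type} [LinearOrder ι] [LinearOrder U] {β : U → Type} [∀ u, LinearOrder (β u)]
  (c : Coloring ι U β) {T : ι → Theta} {κ : Theta}
  (φ : TwoFunctor κ.toTwoCat (gray (fun i => (T i).toTwoCat)))

/-- The word of the image of the `p`-th edge from `k` to `k + 1`, which is a 1-cell of the restriction
to the `k`-th globe. -/
theorem letters_etaH (k : Fin κ.n) (p : Fin (κ.q k + 1)) :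
    GHom.letters (φ.map ((κ.etaH k).map (Theta.globeArrow p))) =
      (grayModel T).lett φ k.val p.val := by
  have h := (grayModel T).word_map φ ((κ.etaH k).map (Theta.globeArrow p))
  have h' : Theta.eword ((κ.etaH k).map (Theta.globeArrow p)) = [((), k.val, p.val)] := by
    refine (Theta.Hom.word_of_step () (κ.etaHMap k (Theta.globeArrow p)) rfl).trans ?_
    have h₁ := Theta.Hom.valN_eq (κ.etaHMap k (Theta.globeArrow p)) k (Fin.le_def.2 le_rfl)
      (Fin.lt_def.2 (Nat.lt_succ_self _))
    exact congrArg (fun n => [((), k.val, n)]) h₁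
  rw [h', List.flatMap_singleton] at h
  exact h

/-- Purity of the restriction to a globe, as a condition on all pairs of underlying shuffles: if two
steps change their order, then no step of a different colour lies between them in any shuffle. -/
theorem isPureGlobe_iff (k : Fin κ.n) :
    IsPureGlobe c.col (CategoryStruct.comp (obj := TwoCat) (Theta.incl.map (κ.etaH k)) φ) ↔
      ∀ v v', c.PurePair ((grayModel T).lett φ k.val v) ((grayModel T).lett φ k.val v') := by
  set L : ℕ → List (Letter ι) := fun v => (grayModel T).lett φ k.val v with hL
  set S : Set (ι × ℕ) := {σ | (grayModel T).posN φ k.val σ.1 ≤ σ.2 ∧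
    σ.2 < (grayModel T).posN φ (k.val + 1) σ.1} with hS
  have hmem : ∀ v σ, σ ∈ (L v).map Letter.key ↔ σ ∈ S :=
    fun v σ => ((grayModel T).lett_path φ k.val v).mem_keys_iff
  have hnodup : ∀ v, ((L v).map Letter.key).Nodup := fun v =>
    ((grayModel T).lett_path φ k.val v).nodup
  set ψ : TwoFunctor (Theta.globe (κ.q k)).toTwoCat (gray (fun i => (T i).toTwoCat)) :=
    CategoryStruct.comp (obj := TwoCat) (Theta.incl.map (κ.etaH k)) φ with hψ
  have hpos₀ : vpos (ψ.obj (0 : Fin 2)) = (grayModel T).posN φ k.val :=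
    ((grayModel T).posN_val φ (κ.etaHObj k 0)).symm
  have hpos₁ : vpos (ψ.obj (1 : Fin 2)) = (grayModel T).posN φ (k.val + 1) :=
    ((grayModel T).posN_val φ (κ.etaHObj k 1)).symm
  have hstep : ∀ σ, σ ∈ stepSet (ψ.obj (0 : Fin 2)) (ψ.obj (1 : Fin 2)) ↔
      ∃ τ ∈ S, σ = (τ.1, τ.2 + 1) := by
    intro σ
    refine mem_stepSet.trans (exists_congr fun τ => ?_)
    have : τ ∈ S ↔ vpos (ψ.obj (0 : Fin 2)) τ.1 ≤ τ.2 ∧ τ.2 < vpos (ψ.obj (1 : Fin 2)) τ.1 := by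
      rw [hpos₀, hpos₁]
      exact Iff.rfl
    rw [this]
    exact and_comm
  have hsh : ∀ (p : Fin (κ.q k + 1)), ∀ σ ∈ S, ∀ τ ∈ S,
      (shuffle ψ p (σ.1, σ.2 + 1) (τ.1, τ.2 + 1) ↔ σ = τ ∨ Bef (L p.val) σ τ) := by
    intro p σ hσ τ hτ
    have h₁ : GHom.letters (ψ.map (Theta.globeArrow p)) = L p.val := letters_etaH φ k p
    have := GHom.prec_iff (ψ.map (Theta.globeArrow p)) (σ := σ) (τ := τ)
      (by rw [h₁, hmem]; exact hσ) (by rw [h₁, hmem]; exact hτ)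
    rwa [h₁] at this
  have hex : ∀ v, ∃ p : Fin (κ.q k + 1), L v = L p.val := fun v =>
    ⟨⟨min v (κ.q k), Nat.lt_succ_of_le (min_le_right _ _)⟩,
      ((grayModel T).lett_min φ k.isLt v).symm⟩
  constructor
  · intro h v v' σ τ hb hcol
    have hσ := (hmem v σ).1 hb.mem_left
    have hτ := (hmem v τ).1 hb.mem_right
    obtain ⟨p, hp⟩ := hex v
    obtain ⟨p', hp'⟩ := hex v'
    have hne := hb.ne (hnodup v)
    change Bef (L v) σ τ at hb
    change Bef (L v') σ τ ∨ ∀ μ, Bef (L v) σ μ → Bef (L v) μ τ → _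
    rw [hp] at hb ⊢
    rw [hp']
    rcases h _ ((hstep _).2 ⟨σ, hσ, rfl⟩) _ ((hstep _).2 ⟨τ, hτ, rfl⟩) hcol with h | h | h
    · exact .inl (((hsh p' σ hσ τ hτ).1 (h p')).resolve_left hne)
    · exact absurd (((hsh p τ hτ σ hσ).1 (h p)).resolve_left hne.symm) (hb.asymm (hnodup _))
    · refine .inr fun μ h₁ h₂ => ?_
      have hμ := (hmem _ μ).1 h₁.mem_right
      exact h (μ.1, μ.2 + 1) ((hstep _).2 ⟨μ, hμ, rfl⟩) p
        (.inl ⟨(hsh p σ hσ μ hμ).2 (.inr h₁), (hsh p μ hμ τ hτ).2 (.inr h₂)⟩)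
  -- If `σ` and `τ` are in both orders in the shuffles `p` and `p'`, but a step of a different colour
  -- lies between them in the shuffle `p''`, compare `p''` with the one in which they are in the
  -- opposite order.
  · intro h σ' hσ' τ' hτ' hcol
    obtain ⟨σ, hσ, rfl⟩ := (hstep _).1 hσ'
    obtain ⟨τ, hτ, rfl⟩ := (hstep _).1 hτ'
    change c.col σ.1 = c.col τ.1 at hcol
    by_contra! hc
    obtain ⟨⟨p, hp⟩, ⟨p', hp'⟩, μ', hμ', p'', h₁, hμc⟩ := hc
    obtain ⟨μ, hμ, rfl⟩ := (hstep _).1 hμ'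
    change c.col μ.1 ≠ c.col σ.1 at hμc
    rw [hsh p σ hσ τ hτ] at hp
    rw [hsh p' τ hτ σ hσ] at hp'
    rw [hsh p'' σ hσ μ hμ, hsh p'' μ hμ τ hτ, hsh p'' τ hτ μ hμ, hsh p'' μ hμ σ hσ] at h₁
    have hμσ : μ ≠ σ := fun e => hμc (by rw [e])
    have hμτ : μ ≠ τ := fun e => hμc (by rw [e, hcol])
    push Not at hp hp'
    have hb : Bef (L p.val) τ σ := (bef_total ((hmem _ _).2 hσ) ((hmem _ _).2 hτ) hp.1).resolve_left
      hp.2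
    have hb' : Bef (L p'.val) σ τ :=
      (bef_total ((hmem _ _).2 hσ) ((hmem _ _).2 hτ) hp.1).resolve_right hp'.2
    rcases h₁ with ⟨h₁, h₂⟩ | ⟨h₁, h₂⟩
    · replace h₁ := h₁.resolve_left hμσ.symm
      replace h₂ := h₂.resolve_left hμτ
      have h₃ : Bef (L p''.val) σ τ := by
        rcases bef_total ((hmem p''.val _).2 hσ) ((hmem _ _).2 hτ) hp.1 with h₃ | h₃
        · exact h₃
        · exact absurd (h₁.trans (hnodup _) h₂) (h₃.asymm (hnodup _))
      rcases h p''.val p.val σ τ h₃ hcol with h₄ | h₄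
      · exact hb.asymm (hnodup _) h₄
      · exact hμc (h₄ μ h₁ h₂)
    · replace h₁ := h₁.resolve_left hμτ.symm
      replace h₂ := h₂.resolve_left hμσ
      have h₃ : Bef (L p''.val) τ σ := by
        rcases bef_total ((hmem p''.val _).2 hσ) ((hmem _ _).2 hτ) hp.1 with h₃ | h₃
        · exact absurd (h₁.trans (hnodup _) h₂) (h₃.asymm (hnodup _))
        · exact h₃
      rcases h p''.val p'.val τ σ h₃ hcol.symm with h₄ | h₄
      · exact hb'.asymm (hnodup _) h₄
      · exact hμc ((h₄ μ h₁ h₂).trans hcol.symm)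

theorem isPure_iff : IsPure c.col φ ↔ (grayModel T).Pure φ c := by
  constructor
  · intro h k
    by_cases hk : k < κ.n
    · exact (isPureGlobe_iff c φ ⟨k, hk⟩).1 (h ⟨k, hk⟩)
    · intro v v' σ τ hb
      rw [(grayModel T).lett_of_le φ (not_lt.1 hk)] at hb
      exact absurd hb not_bef_nil
  · exact fun h k => (isPureGlobe_iff c φ k).2 (h k.val)

end Pure

/-! ### Injectivity and image of the comparison map -/

section Comparison

variable {U : Type} {β : U → Type} [LinearOrder U] [∀ u, LinearOrder (β u)]
  {T : ∀ u, β u → Theta} {J : TwoFunctor (nested T) (gray (fun p => (flat T p).toTwoCat))}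
  (hJ : IsAssociator (A := fun u i => (T u i).toTwoCat) J) [Fintype U] [∀ u, Fintype (β u)]

include hJ

/-- Every pure cell has a canonical factorization. -/
theorem exists_canonical_of_pure {κ : Theta}
    {φ : TwoFunctor κ.toTwoCat (gray (fun p => (flat T p).toTwoCat))}
    (h : (grayModel (flat T)).Pure φ (sigmaColoring β)) :
    ∃ (N Q : ℕ)
      (X : TwoFunctor κ.toTwoCat (gray (fun _ : U => (⟨N, fun _ => Q⟩ : Theta).toTwoCat)))
      (Ψ : ∀ u, TwoFunctor (⟨N, fun _ => Q⟩ : Theta).toTwoCat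
        (gray (fun i => (T u i).toTwoCat))),
      (grayModel (flat T)).Canonical φ (sigmaColoring β) (grayModel _)
        (fun u => grayModel (T u)) X Ψ ∧ assembled J X Ψ = φ := by
  obtain ⟨X, Ψ, hX⟩ := (grayModel (flat T)).exists_canonical φ (sigmaColoring β)
    (N := ∑ u, (grayModel (flat T)).deg φ (sigmaColoring β) κ.n u) (Q := ∑ k, κ.q k)
    (grayModel (fun _ : U => ⟨_, fun _ => _⟩)) (fun u => grayModel (T u)) h
    (fun u => Finset.single_le_sum (f := (grayModel (flat T)).deg φ (sigmaColoring β) κ.n)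
      (fun _ _ => Nat.zero_le _) (Finset.mem_univ u))
    fun k v hok => hok.2.trans
      (Finset.single_le_sum (f := κ.q) (fun _ _ => Nat.zero_le _) (Finset.mem_univ _))
  exact ⟨_, _, X, Ψ, hX, assembled_eq_of_canonical hJ h hX⟩

/-- The canonical factorization depends only on the image of a cell, and it is equivalent to every
representative. -/
theorem assembled_injective {κ : Theta} {ζ ζ' : U → Theta}
    {χ : TwoFunctor κ.toTwoCat (gray (fun u => (ζ u).toTwoCat))}
    {ψ : ∀ u, TwoFunctor (ζ u).toTwoCat (gray (fun i => (T u i).toTwoCat))}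
    {χ' : TwoFunctor κ.toTwoCat (gray (fun u => (ζ' u).toTwoCat))}
    {ψ' : ∀ u, TwoFunctor (ζ' u).toTwoCat (gray (fun i => (T u i).toTwoCat))}
    (h : assembled J χ ψ = assembled J χ' ψ') : tensorMk χ ψ = tensorMk χ' ψ' := by
  obtain ⟨N, Q, X, Ψ, hX, -⟩ := exists_canonical_of_pure hJ (pure_assembled hJ χ ψ)
  rw [tensorMk_eq_of_canonical hJ χ ψ hX]
  rw [h] at hX
  rw [tensorMk_eq_of_canonical hJ χ' ψ' hX]

theorem mono_comparison : Mono (comparison (A := fun u i => (T u i).toTwoCat) J) := by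
  have : ∀ κ, Mono ((comparison (A := fun u i => (T u i).toTwoCat) J).app κ) := by
    intro κ
    rw [mono_iff_injective]
    intro s s' h
    induction s using Quot.ind with | _ s => ?_
    induction s' using Quot.ind with | _ s' => ?_
    exact assembled_injective hJ (χ := s.χ) (ψ := s.x) (χ' := s'.χ) (ψ' := s'.x) h
  exact NatTrans.mono_of_mono_app _

theorem mem_range_comparison_iff {κ : Theta}
    (φ : TwoFunctor κ.toTwoCat (gray (fun p => (flat T p).toTwoCat))) :
    (∃ x : (tensor (fun u => nerve (gray fun i => (T u i).toTwoCat))).obj (Opposite.op κ),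
      (comparison (A := fun u i => (T u i).toTwoCat) J).app (Opposite.op κ) x = φ) ↔
      IsPure (fun p : Σₗ u, β u => (ofLex p).1) φ := by
  refine Iff.trans ?_ (isPure_iff (sigmaColoring β) φ).symm
  constructor
  · rintro ⟨x, rfl⟩
    induction x using Quot.ind with | _ s => ?_
    exact pure_assembled hJ s.χ s.x
  · intro h
    obtain ⟨N, Q, X, Ψ, -, h'⟩ := exists_canonical_of_pure hJ h
    exact ⟨tensorMk X Ψ, h'⟩

end Comparison

end GrayTheta

theorem mainTheorem5 {a : ℕ} {b : Fin a → ℕ} (θ : ∀ u : Fin a, Fin (b u) → GrayTheta.Theta) :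
    (∃! J : GrayTheta.gray (fun u => GrayTheta.gray (fun i => (θ u i).toTwoCat)) ⟶
        GrayTheta.gray (GrayTheta.flat fun u i => (θ u i).toTwoCat),
      GrayTheta.IsAssociator (A := fun u i => (θ u i).toTwoCat) J) ∧
    ∀ J : GrayTheta.gray (fun u => GrayTheta.gray (fun i => (θ u i).toTwoCat)) ⟶
        GrayTheta.gray (GrayTheta.flat fun u i => (θ u i).toTwoCat),
      GrayTheta.IsAssociator (A := fun u i => (θ u i).toTwoCat) J →
        Mono (GrayTheta.comparison (A := fun u i => (θ u i).toTwoCat) J) ∧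
        ∀ (κ : GrayTheta.Theta)
          (φ : κ.toTwoCat ⟶ GrayTheta.gray (fun p => (GrayTheta.flat θ p).toTwoCat)),
          (∃ x : (GrayTheta.tensor
              (fun u => GrayTheta.nerve (GrayTheta.gray fun i => (θ u i).toTwoCat))).obj
                (Opposite.op κ),
            (GrayTheta.comparison (A := fun u i => (θ u i).toTwoCat) J).app
              (Opposite.op κ) x = φ) ↔
          GrayTheta.IsPure (fun p : Σₗ u : Fin a, Fin (b u) => (ofLex p).1) φ :=
  ⟨GrayTheta.existsUnique_isAssociator θ, fun _ hJ =>
    ⟨GrayTheta.mono_comparison hJ, fun _ φ => GrayTheta.mem_range_comparison_iff hJ φ⟩⟩
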